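/- **Conventions.** A non-empty open set $\Omega\subset\mathbb P^n=\mathbb P(\mathbb R^{n+1})$ is *properly convex* if some affine chart of $\mathbb P^n$ contains its closure $\overline\Omega$ and $\Omega$ is convex in that chart; it is *strictly convex* if moreover $\partial\Omega$ contains no non-trivial segment. $\mathrm{Aut}(\Omega)$ is the subgroup of $\mathrm{SL}_{n+1}(\mathbb R)$ preserving $\Omega$. For $\Gamma\le\mathrm{Aut}(\Omega)$ discrete, the limit set $\Lambda_\Gamma$ is the set of points of $\overline{\Gamma x}\smallsetminus\Gamma x$, $x\in\Omega$; the convex core of $\Omega/\Gamma$ is the image in $\Omega/\Gamma$ of the closure in $\Omega$ of the convex hull of $\Lambda_\Gamma$; and $\Gamma$ *acts convex-cocompactly* on $\Omega$ if the convex core is compact. Let $V_d\cong\mathbb R^{d+1}$ be the space of real binary forms of degree $d$ and $\rho_d:\mathrm{SL}_2(\mathbb R)\to\mathrm{SL}(V_d)\cong\mathrm{SL}_{d+1}(\mathbb R)$, $\rho_d(g)P=P\circ g^{-1}$. A discrete subgroup $\Gamma'$ of $\mathrm{SL}_2(\mathbb R)$ is *convex-cocompact* if $\rho_2(\Gamma')$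 acts convex-cocompactly on the hyperbolic plane (the set of points of $\mathbb P(V_2)$ represented by positive definite quadratic forms), and *non-elementary* if the limit set of this action is infinite; it is a *cocompact lattice* if $\mathrm{SL}_2(\mathbb R)/\Gamma'$ is compact. Zariski closures are taken in the group $\mathrm{SL}_5(\mathbb R)$ of real points, i.e. are the sets of common zeros of real polynomials in the matrix entries. **Proposition 10.6.** There is a properly convex, strictly convex open set $\Omega\subset\mathbb P^4$ with $C^1$ boundary such that, for every discrete subgroup $\Gamma'$ of $\mathrm{SL}_2(\mathbb R)$ which is a cocompact lattice, or convex-cocompact and non-elementary (and there are such $\Gamma'$), the group $\Gamma=\rho_4(\Gamma')$ has the following properties: 1. $\Gamma$ is a discrete subgroup of $\mathrm{Aut}(\Omega)$ and acts convex-cocompactly on $\Omega$; 2. the Zariski closure of $\Gamma$ in $\mathrm{SL}_5(\mathbb R)$ is the group of all substitutions $P\mapsto P\circ A$ of $V_4$ with $A\in\mathrm{GL}_2(\mathbb R)$, $\det A=\pm1$ (this group contains $\rho_4(\mathrm{SL}_2(\mathbb R))$ with index two); 3. this Zariski closure is contained in a conjugate of $\mathrm{SO}_{2,3}(\mathbb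 R)$ in $\mathrm{SL}_5(\mathbb R)$; 4. this Zariski closure is neither $\mathrm{SL}_5(\mathbb R)$ nor conjugate in $\mathrm{SL}_5(\mathbb R)$ to $\mathrm{SO}_{4,1}(\mathbb R)$. In particular there exist a properly convex, strictly convex open set $\Omega\subset\mathbb P^4$ with $C^1$ boundary and a discrete subgroup $\Gamma$ of $\mathrm{Aut}(\Omega)$ acting convex-cocompactly whose Zariski closure is neither $\mathrm{SL}_5(\mathbb R)$ nor conjugate to $\mathrm{SO}_{4,1}(\mathbb R)$. -/

import Mathlib

open scoped LinearAlgebra.Projectivization MatrixGroups Matrix Pointwise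

/-- The quotient topology on the real projective space of `ℝ^m`. -/
instance projectiveTopology (m : ℕ) : TopologicalSpace (ℙ ℝ (Fin m → ℝ)) :=
  inferInstanceAs (TopologicalSpace (Quotient (projectivizationSetoid ℝ (Fin m → ℝ))))

namespace HilbertGeometry

section Convexity

variable {m : ℕ}

/-- The affine chart `{φ ≠ 0}` of projective space: the complement of the projective hyperplane
defined by the linear form `φ`. It is identified with the affine hyperplane `{φ = 1}`. -/
def affineChart (φ : Module.Dual ℝ (Fin m → ℝ)) : Set (ℙ ℝ (Fin m → ℝ)) :=
  {p | ¬ p.submodule ≤ LinearMap.ker φ}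

/-- The trace of a set `S` of projective points in the affine chart of `φ`, seen as a subset of
the affine hyperplane `{φ = 1}`. -/
def affinePart (φ : Module.Dual ℝ (Fin m → ℝ)) (S : Set (ℙ ℝ (Fin m → ℝ))) : Set (Fin m → ℝ) :=
  {x | φ x = 1 ∧ ∃ hx : x ≠ 0, Projectivization.mk ℝ x hx ∈ S}

/-- A (non-empty) properly convex open set: it has an affine chart which contains its closure and
in which it is convex. -/
def IsProperlyConvex (Ω : Set (ℙ ℝ (Fin m → ℝ))) : Prop :=
  IsOpen Ω ∧ Ω.Nonempty ∧
    ∃ φ : Module.Dual ℝ (Fin m → ℝ), closure Ω ⊆ affineChart φ ∧ Convex ℝ (affinePart φ Ω)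

/-- The boundary contains no non-trivial segment. -/
def HasStrictlyConvexBoundary (Ω : Set (ℙ ℝ (Fin m → ℝ))) : Prop :=
  ∀ φ : Module.Dual ℝ (Fin m → ℝ), closure Ω ⊆ affineChart φ →
    ∀ x ∈ affinePart φ (frontier Ω), ∀ y ∈ affinePart φ (frontier Ω),
      segment ℝ x y ⊆ affinePart φ (frontier Ω) → x = y

/-- In affine charts, `Ω` is locally at each boundary point `{f < 0}`, where `f` is a `C¹` function
whose derivative at that point does not vanish on the direction `{φ = 0}` of the chart. -/
def HasC1Boundary (Ω : Set (ℙ ℝ (Fin m → ℝ))) : Prop :=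
  ∀ φ : Module.Dual ℝ (Fin m → ℝ), closure Ω ⊆ affineChart φ →
    ∀ x ∈ affinePart φ (frontier Ω), ∃ U : Set (Fin m → ℝ), IsOpen U ∧ x ∈ U ∧
      ∃ f : (Fin m → ℝ) → ℝ, ContDiffOn ℝ 1 f U ∧ (∃ w, φ w = 0 ∧ fderiv ℝ f x w ≠ 0) ∧
        ∀ y ∈ U, φ y = 1 → (y ∈ affinePart φ Ω ↔ f y < 0)

/-- `Aut(Ω)`: the elements of `SL_m(ℝ)` which preserve `Ω`. -/
noncomputable def Aut (Ω : Set (ℙ ℝ (Fin m → ℝ))) : Subgroup SL(m, ℝ) :=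
  MulAction.stabilizer SL(m, ℝ) Ω

/-- The limit set: the points of `closure (Γ x) \ Γ x`, for points `x` of `Ω`. -/
noncomputable def limitSet (Ω : Set (ℙ ℝ (Fin m → ℝ))) (Γ : Subgroup SL(m, ℝ)) :
    Set (ℙ ℝ (Fin m → ℝ)) :=
  {p | ∃ x ∈ Ω, p ∈ closure (MulAction.orbit Γ x) \ MulAction.orbit Γ x}

/-- The convex hull of a subset `S` of the closure of a properly convex open set `Ω`, taken in an
affine chart containing the closure of `Ω`. -/
def hull (Ω S : Set (ℙ ℝ (Fin m → ℝ))) : Set (ℙ ℝ (Fin m → ℝ)) :=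
  {p | ∃ φ : Module.Dual ℝ (Fin m → ℝ), closure Ω ⊆ affineChart φ ∧
    ∃ (x : Fin m → ℝ) (hx : x ≠ 0), x ∈ convexHull ℝ (affinePart φ S) ∧
      p = Projectivization.mk ℝ x hx}

/-- The preimage in `Ω` of the convex core of `Ω / Γ`: the closure in `Ω` of the convex hull of the
limit set. -/
def convexCore (Ω : Set (ℙ ℝ (Fin m → ℝ))) (Γ : Subgroup SL(m, ℝ)) : Set (ℙ ℝ (Fin m → ℝ)) :=
  Ω ∩ closure (hull Ω (limitSet Ω Γ))

/-- The convex core of `Ω / Γ` is compact. (For `Ω` open and invariant, `Ω / Γ` is an open subspace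
of the quotient of the projective space by `Γ`.) -/
def ActsConvexCocompactly (Ω : Set (ℙ ℝ (Fin m → ℝ))) (Γ : Subgroup SL(m, ℝ)) : Prop :=
  IsCompact ((fun p => (Quotient.mk (MulAction.orbitRel Γ (ℙ ℝ (Fin m → ℝ))) p)) ''
    convexCore Ω Γ)

/-- The Zariski closure in `SL_m(ℝ)` of a set `S`: the common zeros in `SL_m(ℝ)` of the real
polynomials in the matrix entries which vanish on `S`. -/
def zariskiClosure (S : Set SL(m, ℝ)) : Set SL(m, ℝ) :=
  {g | ∀ P : MvPolynomial (Fin m × Fin m) ℝ,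
    (∀ s ∈ S, MvPolynomial.eval (fun ij => s.1 ij.1 ij.2) P = 0) →
      MvPolynomial.eval (fun ij => g.1 ij.1 ij.2) P = 0}

/-- The diagonal matrix with `p` entries `1` followed by `m - p` entries `-1`. -/
def signatureMatrix (m p : ℕ) : Matrix (Fin m) (Fin m) ℝ :=
  Matrix.diagonal fun i => if (i : ℕ) < p then 1 else -1

/-- The group `SO_{p, m-p}(ℝ)`. -/
def indefiniteSO (m p : ℕ) : Subgroup SL(m, ℝ) where
  carrier := {g | g.1ᵀ * signatureMatrix m p * g.1 = signatureMatrix m p}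
  one_mem' := by simp
  mul_mem' := by
    intro a b ha hb
    simp only [Set.mem_ofPred_eq] at ha hb ⊢
    calc (a * b).1ᵀ * signatureMatrix m p * (a * b).1
        = b.1ᵀ * (a.1ᵀ * signatureMatrix m p * a.1) * b.1 := by
          rw [show (a * b).1 = a.1 * b.1 from rfl, Matrix.transpose_mul]
          simp only [Matrix.mul_assoc]
      _ = _ := by rw [ha, hb]
  inv_mem' := by
    intro a ha
    simp only [Set.mem_ofPred_eq] at ha ⊢
    have h1 : a.1 * (a⁻¹).1 = 1 := congrArg Subtype.val (mul_inv_cancel a)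
    have h2 : (a⁻¹).1ᵀ * a.1ᵀ = 1 := by rw [← Matrix.transpose_mul, h1, Matrix.transpose_one]
    calc (a⁻¹).1ᵀ * signatureMatrix m p * (a⁻¹).1
        = (a⁻¹).1ᵀ * (a.1ᵀ * signatureMatrix m p * a.1) * (a⁻¹).1 := by rw [ha]
      _ = ((a⁻¹).1ᵀ * a.1ᵀ) * signatureMatrix m p * (a.1 * (a⁻¹).1) := by
          simp only [Matrix.mul_assoc]
      _ = _ := by rw [h1, h2]; simp

end Convexity

section BinaryForms

/-- The value at `v` of the binary form of degree `d` with coefficient vector `c`, that is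
`∑ i, c i * X ^ i * Y ^ (d - i)`. Thus `ℝ^(d+1)` is the space `V_d` of binary forms. -/
noncomputable def binaryForm {d : ℕ} (c : Fin (d + 1) → ℝ) (v : Fin 2 → ℝ) : ℝ :=
  ∑ i : Fin (d + 1), c i * v 0 ^ (i : ℕ) * v 1 ^ (d - (i : ℕ))

open Polynomial in
/-- The matrix, in the monomial basis of `V_d`, of the linear substitution `P ↦ P ∘ A`. -/
noncomputable def substMatrix (d : ℕ) (A : Matrix (Fin 2) (Fin 2) ℝ) :
    Matrix (Fin (d + 1)) (Fin (d + 1)) ℝ :=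
  Matrix.of fun i j =>
    ((C (A 0 0) * X + C (A 0 1)) ^ (j : ℕ) * (C (A 1 0) * X + C (A 1 1)) ^ (d - (j : ℕ))).coeff i

open Polynomial in
theorem natDegree_column_le (d : ℕ) (A : Matrix (Fin 2) (Fin 2) ℝ) (j : Fin (d + 1)) :
    ((C (A 0 0) * X + C (A 0 1)) ^ (j : ℕ) *
      (C (A 1 0) * X + C (A 1 1)) ^ (d - (j : ℕ))).natDegree ≤ d := by
  have h : ∀ a b : ℝ, (C a * X + C b).natDegree ≤ 1 := fun a b => natDegree_linear_le
  refine natDegree_mul_le.trans ?_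
  have h1 := natDegree_pow_le_of_le (j : ℕ) (h (A 0 0) (A 0 1))
  have h2 := natDegree_pow_le_of_le (d - (j : ℕ)) (h (A 1 0) (A 1 1))
  have := j.2
  omega

theorem binaryForm_of_one {d : ℕ} (c : Fin (d + 1) → ℝ) (x : ℝ) :
    binaryForm c ![x, 1] = ∑ i : Fin (d + 1), c i * x ^ (i : ℕ) := by
  simp [binaryForm]

theorem binaryForm_smul {d : ℕ} (c : Fin (d + 1) → ℝ) (t : ℝ) (v : Fin 2 → ℝ) :
    binaryForm c (t • v) = t ^ d * binaryForm c v := by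
  simp only [binaryForm, Finset.mul_sum, Pi.smul_apply, smul_eq_mul, mul_pow]
  refine Finset.sum_congr rfl fun i _ => ?_
  have : t ^ d = t ^ (i : ℕ) * t ^ (d - (i : ℕ)) := by
    rw [← pow_add]; congr 1; have := i.2; omega
  rw [this]; ring

open Polynomial in
theorem binaryForm_subst_of_one {d : ℕ} (A : Matrix (Fin 2) (Fin 2) ℝ) (c : Fin (d + 1) → ℝ)
    (x : ℝ) : binaryForm (substMatrix d A *ᵥ c) ![x, 1] = binaryForm c (A *ᵥ ![x, 1]) := by
  rw [binaryForm_of_one]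
  have e : ∀ i : Fin (d + 1), (substMatrix d A *ᵥ c) i * x ^ (i : ℕ) =
      ∑ j, substMatrix d A i j * c j * x ^ (i : ℕ) := fun i => by
    rw [← Finset.sum_mul]; rfl
  simp only [e]
  rw [Finset.sum_comm]
  refine Finset.sum_congr rfl fun j _ => ?_
  have h := eval_eq_sum_range' (Nat.lt_succ_of_le (natDegree_column_le d A j)) x
  rw [Finset.sum_range] at h
  simp only [eval_mul, eval_pow, eval_add, eval_C, eval_X] at h
  have e0 : (A *ᵥ ![x, 1]) 0 = A 0 0 * x + A 0 1 := by
    simp [Matrix.mulVec, dotProduct, Fin.sum_univ_two]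
  have e1 : (A *ᵥ ![x, 1]) 1 = A 1 0 * x + A 1 1 := by
    simp [Matrix.mulVec, dotProduct, Fin.sum_univ_two]
  rw [e0, e1, mul_assoc, h, Finset.mul_sum]
  refine Finset.sum_congr rfl fun i _ => ?_
  simp only [substMatrix, Matrix.of_apply]
  ring

theorem continuous_binaryForm {d : ℕ} (c : Fin (d + 1) → ℝ) : Continuous (binaryForm c) := by
  unfold binaryForm
  fun_prop

/-- `substMatrix d A` is indeed the matrix of the substitution `P ↦ P ∘ A`. -/
theorem binaryForm_subst {d : ℕ} (A : Matrix (Fin 2) (Fin 2) ℝ) (c : Fin (d + 1) → ℝ)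
    (v : Fin 2 → ℝ) : binaryForm (substMatrix d A *ᵥ c) v = binaryForm c (A *ᵥ v) := by
  have key : ∀ v : Fin 2 → ℝ, v 1 ≠ 0 →
      binaryForm (substMatrix d A *ᵥ c) v = binaryForm c (A *ᵥ v) := by
    intro v hv
    have e : v = v 1 • ![v 0 / v 1, 1] := by
      ext i; fin_cases i
      · simp [mul_div_cancel₀ _ hv]
      · simp
    rw [e, Matrix.mulVec_smul, binaryForm_smul, binaryForm_smul, binaryForm_subst_of_one]
  have hc : Continuous fun t : ℝ => (v + t • ![0, 1] : Fin 2 → ℝ) := by fun_prop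
  have hA : Continuous fun w : Fin 2 → ℝ => A *ᵥ w := by fun_prop
  have h1 := ((continuous_binaryForm (substMatrix d A *ᵥ c)).comp hc).tendsto 0
  have h2 := (((continuous_binaryForm c).comp hA).comp hc).tendsto 0
  have hev : ∀ᶠ t : ℝ in nhdsWithin 0 {0}ᶜ, v 1 + t ≠ 0 := by
    by_cases hv : v 1 = 0
    · filter_upwards [self_mem_nhdsWithin] with t ht
      simpa [hv] using ht
    · have : ContinuousAt (fun t : ℝ => v 1 + t) 0 := by fun_prop
      exact (this.eventually_ne (by simpa using hv)).filter_mono nhdsWithin_le_nhds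
  have h3 := tendsto_nhds_unique_of_eventuallyEq (h1.mono_left nhdsWithin_le_nhds)
    (h2.mono_left nhdsWithin_le_nhds) (by
      filter_upwards [hev] with t ht
      exact key _ (by simpa using ht))
  have e0 : (v + (0 : ℝ) • ![0, 1] : Fin 2 → ℝ) = v := by rw [zero_smul, add_zero]
  simpa only [Function.comp_apply, e0] using h3

open Polynomial in
theorem binaryForm_injective (d : ℕ) :
    Function.Injective (binaryForm : (Fin (d + 1) → ℝ) → (Fin 2 → ℝ) → ℝ) := by
  intro c c' h
  have hp : (∑ i : Fin (d + 1), C (c i) * X ^ (i : ℕ)) =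
      ∑ i : Fin (d + 1), C (c' i) * X ^ (i : ℕ) := by
    refine Polynomial.funext fun x => ?_
    have := congrFun h ![x, 1]
    rw [binaryForm_of_one, binaryForm_of_one] at this
    simpa [eval_finsetSum] using this
  funext i
  have := congrArg (fun p => p.coeff (i : ℕ)) hp
  simpa [finsetSum_coeff, coeff_C_mul, coeff_X_pow, Fin.val_inj] using this

theorem substMatrix_one (d : ℕ) : substMatrix d 1 = 1 := by
  refine Matrix.mulVec_injective (funext fun c => binaryForm_injective d (funext fun v => ?_))
  rw [binaryForm_subst, Matrix.one_mulVec, Matrix.one_mulVec]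

theorem substMatrix_mul (d : ℕ) (A B : Matrix (Fin 2) (Fin 2) ℝ) :
    substMatrix d (A * B) = substMatrix d B * substMatrix d A := by
  refine Matrix.mulVec_injective (funext fun c => binaryForm_injective d (funext fun v => ?_))
  rw [binaryForm_subst, ← Matrix.mulVec_mulVec, ← Matrix.mulVec_mulVec, binaryForm_subst,
    binaryForm_subst]

/-- The representation by matrices, before checking that the determinants are `1`. -/
noncomputable def rhoMatrix (d : ℕ) :
    SL(2, ℝ) →* Matrix (Fin (d + 1)) (Fin (d + 1)) ℝ where
  toFun g := substMatrix d (g⁻¹).1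
  map_one' := by
    rw [inv_one]; exact substMatrix_one d
  map_mul' g h := by
    rw [mul_inv_rev, ← substMatrix_mul]; rfl

theorem det_rhoMatrix (d : ℕ) (g : SL(2, ℝ)) : (rhoMatrix d g).det = 1 := by
  let f : SL(2, ℝ) →* ℝˣ := ((Matrix.detMonoidHom).comp (rhoMatrix d)).toHomUnits
  have hf : commutator SL(2, ℝ) ≤ f.ker := Abelianization.commutator_subset_ker f
  rw [Matrix.SL2.commutator_eq_top (a := (2 : ℝ)) (by norm_num)
    (by norm_num)] at hf
  have : f g = 1 := hf (Subgroup.mem_top g)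
  simpa [f] using congrArg Units.val this

/-- The representation `ρ_d` of `SL₂(ℝ)` on the space `V_d` of binary forms of degree `d`,
`(ρ_d(g) P)(v) = P(g⁻¹ v)`, in the monomial basis. -/
noncomputable def rho (d : ℕ) : SL(2, ℝ) →* SL(d + 1, ℝ) where
  toFun g := ⟨rhoMatrix d g, det_rhoMatrix d g⟩
  map_one' := Subtype.ext (map_one (rhoMatrix d))
  map_mul' g h := Subtype.ext (map_mul (rhoMatrix d) g h)

/-- The hyperbolic plane in its projective (Klein) model: the points of the projective plane
`ℙ(V_2)` represented by positive definite binary quadratic forms, on which `SL₂(ℝ)` acts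
through `ρ_2`. -/
def hyperbolicPlane : Set (ℙ ℝ (Fin 3 → ℝ)) :=
  {p | ∃ (c : Fin 3 → ℝ) (hc : c ≠ 0), p = Projectivization.mk ℝ c hc ∧
    ∀ v : Fin 2 → ℝ, v ≠ 0 → 0 < binaryForm (d := 2) c v}

/-- A discrete subgroup of `SL₂(ℝ)` is convex-cocompact when its action on the hyperbolic plane is;
it is non-elementary when its limit set is infinite. -/
def IsNonelementaryConvexCocompact (Γ : Subgroup SL(2, ℝ)) : Prop :=
  (limitSet hyperbolicPlane (Γ.map (rho 2))).Infinite ∧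
    ActsConvexCocompactly hyperbolicPlane (Γ.map (rho 2))

/-- Discrete subgroups of `SL₂(ℝ)` which are cocompact lattices, or convex-cocompact and
non-elementary. -/
def IsAdmissible (Γ : Subgroup SL(2, ℝ)) : Prop :=
  DiscreteTopology Γ ∧ (CompactSpace (SL(2, ℝ) ⧸ Γ) ∨ IsNonelementaryConvexCocompact Γ)

end BinaryForms

end HilbertGeometry

/-!
Binary quartics `c` are given by their coefficients, and `substMatrix 4 g.1 *ᵥ c` is `c ∘ g`.

**The domain.** The convex cones in `V₄` which are invariant under `SL₂(ℝ)` and salient lie between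
the cone of sums of fourth powers of linear forms and the cone of nonnegative quartics. Neither of
these two is strictly convex with `C¹` boundary, but an intermediate one is. Every positive quartic
is an `SL₂(ℝ)`-translate of some `normalForm α β = α (x² + y²)² + β Re (x + iy)⁴` with `|β| < α`
(`IsPositive.exists_normalForm`: minimize the mean over the circle along the orbit). The cone
`middleCone` consists of the positive quartics on which all translates of the linear form
`supportForm` are positive; `supportForm` is chosen to vanish on the ray of `normalForm 3 2`. An
explicit inequality shows that along the orbit of a normal form with `β ≥ 0` the form `supportForm`
is smallest at the normal form itself. So `middleCone` is the union of the orbits of the normal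
forms with `3 |β| < 2 α`, and the boundary of its closure consists of the orbit of the ray of
`normalForm 3 2` and of the fourth powers `ℓ⁴` (`eq_linearPower_of_mem_closedMiddleCone`). A
boundary point has, up to scaling, only one supporting hyperplane, and this hyperplane meets the
cone in one ray. Strict convexity follows, and so does the regularity of the boundary, because a
maximum of linear forms over a compact set is `C¹` wherever the maximizer is unique
(`contDiffOn_max_of_unique`).

**Convex-cocompactness.** Orbits of a discrete group on positive quartics are discrete, so limit
points in the quartic domain are fourth powers `ℓ⁴`, and then `ℓ²` is a limit point in the
hyperbolic plane (`limitSet_quarticDomain`). The Laplacian of quartics does not commute with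
substitutions, but at a translate `normalForm α β ∘ g` it can be used after transport by `g`: it
sends fourth powers to nonnegative multiples of squares and normal forms to multiples of `x² + y²`.
Hence if `normalForm α β ∘ g` is in the closed convex hull of the limit set, then `(x² + y²) ∘ g` is
in the corresponding hull in the hyperbolic plane, and moreover `3 |β| ≤ α`
(`normalForm_of_mem_closure_hull`). The convex core in the quartic domain is thus covered by
translates of a compact set as soon as the convex core in the hyperbolic plane is, or as soon as the
group is a cocompact lattice.

**The Zariski closure.** The group preserves the quadratic invariant `invI` and the cubic invariant
`invJ` of quartics, hence so does its Zariski closure. A matrix preserving both is a substitution of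
determinant `±1` (`PreservesInvariants.exists_eq_subst`): it preserves the cone over the fourth
powers, which is where `invI` and the gradient of `invJ` vanish, and after composition with a
substitution it fixes the lines of `x⁴` and `y⁴`, which forces it to be diagonal. Conversely a
non-elementary group contains, after conjugation, a hyperbolic diagonal matrix `γ` and a matrix `δ`
without zero entries. A polynomial vanishing on the group vanishes on the products
`γⁿ (δ γᵐ δ⁻¹) γᵏ`, hence on the corresponding products of tori, and these are dense enough to force
it to vanish on `SL₂(ℝ)` (`IsNonelementary.eq_zero_of_isRegular`). The form `-invI` has signature
`(2, 3)`. The group `SO(4,1)` contains an element of trace `-3`, while the trace of a substitution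
of determinant `±1` on quartics is at least `-5/4`.

**Existence of lattices.** The units of norm one of an order in a quaternion division algebra over
`ℚ` which splits over `ℝ` form a cocompact lattice (`isAdmissible_quatGroup`), by Minkowski's
theorem and the finiteness of the set of classes of integral quaternions of given norm.
-/

namespace HilbertGeometry

open Filter Topology

/-! ### Binary forms and substitutions -/

theorem substMatrix_two_mulVec (p q r s : ℝ) (c : Fin 3 → ℝ) :
    substMatrix 2 !![p, q; r, s] *ᵥ c =
      ![c 0 * s ^ 2 + c 1 * (q * s) + c 2 * q ^ 2,
        c 0 * (2 * r * s) + c 1 * (q * r + p * s) + c 2 * (2 * p * q),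
        c 0 * r ^ 2 + c 1 * (p * r) + c 2 * p ^ 2] := by
  refine binaryForm_injective 2 (funext fun v => ?_)
  rw [binaryForm_subst]
  simp [binaryForm, Fin.sum_univ_three, Matrix.mulVec, dotProduct, Fin.sum_univ_two]
  ring

theorem substMatrix_four_mulVec (p q r s : ℝ) (c : Fin 5 → ℝ) :
    substMatrix 4 !![p, q; r, s] *ᵥ c =
      ![c 0 * s ^ 4 + c 1 * (q * s ^ 3) + c 2 * (q ^ 2 * s ^ 2) + c 3 * (q ^ 3 * s) + c 4 * q ^ 4,
        c 0 * (4 * r * s ^ 3) + c 1 * (3 * q * r * s ^ 2 + p * s ^ 3)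
          + c 2 * (2 * q ^ 2 * r * s + 2 * p * q * s ^ 2)
          + c 3 * (q ^ 3 * r + 3 * p * q ^ 2 * s) + c 4 * (4 * p * q ^ 3),
        c 0 * (6 * r ^ 2 * s ^ 2) + c 1 * (3 * q * r ^ 2 * s + 3 * p * r * s ^ 2)
          + c 2 * (q ^ 2 * r ^ 2 + 4 * p * q * r * s + p ^ 2 * s ^ 2)
          + c 3 * (3 * p * q ^ 2 * r + 3 * p ^ 2 * q * s) + c 4 * (6 * p ^ 2 * q ^ 2),
        c 0 * (4 * r ^ 3 * s) + c 1 * (q * r ^ 3 + 3 * p * r ^ 2 * s)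
          + c 2 * (2 * p * q * r ^ 2 + 2 * p ^ 2 * r * s)
          + c 3 * (3 * p ^ 2 * q * r + p ^ 3 * s) + c 4 * (4 * p ^ 3 * q),
        c 0 * r ^ 4 + c 1 * (p * r ^ 3) + c 2 * (p ^ 2 * r ^ 2) + c 3 * (p ^ 3 * r)
          + c 4 * p ^ 4] := by
  refine binaryForm_injective 4 (funext fun v => ?_)
  rw [binaryForm_subst]
  simp [binaryForm, Fin.sum_univ_five, Matrix.mulVec, dotProduct, Fin.sum_univ_two]
  ring

theorem substMatrix_mul_mulVec {d : ℕ} (A B : Matrix (Fin 2) (Fin 2) ℝ) (c : Fin (d + 1) → ℝ) :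
    substMatrix d (A * B) *ᵥ c = substMatrix d B *ᵥ (substMatrix d A *ᵥ c) := by
  rw [substMatrix_mul, Matrix.mulVec_mulVec]

theorem substMatrix_inv_mulVec {d : ℕ} (g : SL(2, ℝ)) (c : Fin (d + 1) → ℝ) :
    substMatrix d (g⁻¹).1 *ᵥ (substMatrix d g.1 *ᵥ c) = c := by
  rw [← substMatrix_mul_mulVec, ← Matrix.SpecialLinearGroup.coe_mul, mul_inv_cancel]
  simp [substMatrix_one]

theorem substMatrix_mulVec_inv {d : ℕ} (g : SL(2, ℝ)) (c : Fin (d + 1) → ℝ) :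
    substMatrix d g.1 *ᵥ (substMatrix d (g⁻¹).1 *ᵥ c) = c := by
  simpa using substMatrix_inv_mulVec g⁻¹ c

theorem substMatrix_coe_mul_mulVec {d : ℕ} (g h : SL(2, ℝ)) (c : Fin (d + 1) → ℝ) :
    substMatrix d (g * h).1 *ᵥ c = substMatrix d h.1 *ᵥ (substMatrix d g.1 *ᵥ c) := by
  rw [Matrix.SpecialLinearGroup.coe_mul, substMatrix_mul_mulVec]

theorem rho_val (d : ℕ) (g : SL(2, ℝ)) : (rho d g).1 = substMatrix d (g⁻¹).1 := rfl

/-- The element of `SL₂(ℝ)` with the given entries. -/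
def slMk (p q r s : ℝ) (h : p * s - q * r = 1) : SL(2, ℝ) :=
  ⟨!![p, q; r, s], by rw [Matrix.det_fin_two_of, h]⟩

@[simp] theorem slMk_val (p q r s : ℝ) (h : p * s - q * r = 1) :
    (slMk p q r s h).1 = !![p, q; r, s] := rfl

theorem exists_eq_slMk (g : SL(2, ℝ)) :
    ∃ (p q r s : ℝ) (h : p * s - q * r = 1), g = slMk p q r s h := by
  have h := g.2
  rw [Matrix.det_fin_two] at h
  exact ⟨g.1 0 0, g.1 0 1, g.1 1 0, g.1 1 1, h, Subtype.ext (Matrix.eta_fin_two g.1)⟩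

theorem continuous_slVal : Continuous fun g : SL(2, ℝ) => g.1 :=
  Matrix.SpecialLinearGroup.isClosedEmbedding_val.continuous

theorem binaryForm_add {d : ℕ} (c c' : Fin (d + 1) → ℝ) (v : Fin 2 → ℝ) :
    binaryForm (c + c') v = binaryForm c v + binaryForm c' v := by
  simp [binaryForm, add_mul, Finset.sum_add_distrib]

theorem binaryForm_const_smul {d : ℕ} (t : ℝ) (c : Fin (d + 1) → ℝ) (v : Fin 2 → ℝ) :
    binaryForm (t • c) v = t * binaryForm c v := by
  simp [binaryForm, Finset.mul_sum, mul_assoc]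

theorem binaryForm_neg {d : ℕ} (c : Fin (d + 1) → ℝ) (v : Fin 2 → ℝ) :
    binaryForm (-c) v = -binaryForm c v := by
  simp [binaryForm]

theorem continuous_binaryForm_coeff {d : ℕ} (v : Fin 2 → ℝ) :
    Continuous fun c : Fin (d + 1) → ℝ => binaryForm c v := by
  unfold binaryForm
  fun_prop

theorem binaryForm_two (c : Fin 3 → ℝ) (v : Fin 2 → ℝ) :
    binaryForm (d := 2) c v = c 0 * v 1 ^ 2 + c 1 * v 0 * v 1 + c 2 * v 0 ^ 2 := by
  simp [binaryForm, Fin.sum_univ_three]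

theorem binaryForm_four (c : Fin 5 → ℝ) (v : Fin 2 → ℝ) :
    binaryForm (d := 4) c v = c 0 * v 1 ^ 4 + c 1 * v 0 * v 1 ^ 3 + c 2 * v 0 ^ 2 * v 1 ^ 2
      + c 3 * v 0 ^ 3 * v 1 + c 4 * v 0 ^ 4 := by
  simp [binaryForm, Fin.sum_univ_five]

/-- Entrywise bounded subsets of `SL₂(ℝ)` are relatively compact. -/
theorem isCompact_slBox (R : ℝ) : IsCompact {g : SL(2, ℝ) | ∀ i j, |g.1 i j| ≤ R} := by
  have h : IsCompact {A : Matrix (Fin 2) (Fin 2) ℝ | ∀ i j, |A i j| ≤ R} := by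
    have := isCompact_univ_pi fun _ : Fin 2 => isCompact_univ_pi fun _ : Fin 2 =>
      (isCompact_Icc : IsCompact (Set.Icc (-R) R))
    have e : {A : Matrix (Fin 2) (Fin 2) ℝ | ∀ i j, |A i j| ≤ R} =
        Set.pi Set.univ fun _ : Fin 2 => Set.pi Set.univ fun _ : Fin 2 => Set.Icc (-R) R :=
      Set.ext fun A => ⟨fun h i _ j _ => abs_le.1 (h i j), fun h i j =>
        abs_le.2 (h i trivial j trivial)⟩
    rw [e]
    exact this
  exact Matrix.SpecialLinearGroup.isClosedEmbedding_val.isCompact_preimage h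

/-- The binary form with coefficient vector `c` is positive definite. -/
def IsPositive {d : ℕ} (c : Fin (d + 1) → ℝ) : Prop :=
  ∀ v : Fin 2 → ℝ, v ≠ 0 → 0 < binaryForm c v

theorem mulVec_ne_zero (g : SL(2, ℝ)) {v : Fin 2 → ℝ} (hv : v ≠ 0) : g.1 *ᵥ v ≠ 0 := by
  intro h
  apply hv
  have : (g⁻¹).1 *ᵥ (g.1 *ᵥ v) = v := by
    rw [Matrix.mulVec_mulVec, ← Matrix.SpecialLinearGroup.coe_mul, inv_mul_cancel]
    simp
  rw [← this, h, Matrix.mulVec_zero]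

theorem IsPositive.subst {d : ℕ} {c : Fin (d + 1) → ℝ} (hc : IsPositive c) (g : SL(2, ℝ)) :
    IsPositive (substMatrix d g.1 *ᵥ c) := fun v hv => by
  rw [binaryForm_subst]
  exact hc _ (mulVec_ne_zero g hv)

theorem IsPositive.exists_le {d : ℕ} {c : Fin (d + 1) → ℝ} (hc : IsPositive c) :
    ∃ ε : ℝ, 0 < ε ∧ ∀ v : Fin 2 → ℝ, ε * ‖v‖ ^ d ≤ binaryForm c v := by
  have hne : (Metric.sphere (0 : Fin 2 → ℝ) 1).Nonempty := by
    refine ⟨![1, 0], ?_⟩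
    simp [Pi.norm_def, Fin.univ_succ]
  obtain ⟨w, hw, hmin⟩ := (isCompact_sphere (0 : Fin 2 → ℝ) 1).exists_isMinOn hne
    (continuous_binaryForm c).continuousOn
  have hw1 : ‖w‖ = 1 := by simpa using hw
  have hw0 : w ≠ 0 := by rintro rfl; simp at hw1
  refine ⟨binaryForm c w, hc w hw0, fun v => ?_⟩
  by_cases hv : v = 0
  · subst hv
    rcases Nat.eq_zero_or_pos d with rfl | hd
    · simp [binaryForm]
    · have : binaryForm c 0 = 0 := by
        have := binaryForm_smul c 0 0
        rwa [zero_smul, zero_pow hd.ne', zero_mul] at this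
      rw [this, norm_zero, zero_pow hd.ne', mul_zero]
  · have hv' : ‖v‖ ≠ 0 := by simpa using hv
    have h1 : binaryForm c w ≤ binaryForm c (‖v‖⁻¹ • v) :=
      hmin (by simp [norm_smul, hv'])
    have h2 : v = ‖v‖ • (‖v‖⁻¹ • v) := by rw [smul_smul, mul_inv_cancel₀ hv', one_smul]
    rw [h2, binaryForm_smul, ← h2, mul_comm]
    exact mul_le_mul_of_nonneg_left h1 (by positivity)

/-- The entries of `g` are controlled by the extreme coefficients of `c ∘ g`, for `c` positive. -/
theorem abs_entry_pow_le {d : ℕ} {c : Fin (d + 1) → ℝ} {ε : ℝ}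
    (h : ∀ v : Fin 2 → ℝ, ε * ‖v‖ ^ d ≤ binaryForm c v) (hε : 0 < ε)
    (A : Matrix (Fin 2) (Fin 2) ℝ) (i j : Fin 2) :
    |A i j| ^ d ≤ binaryForm (substMatrix d A *ᵥ c) (Pi.single j 1) / ε := by
  rw [le_div_iff₀ hε, binaryForm_subst, mul_comm]
  refine le_trans ?_ (h _)
  gcongr
  have := norm_le_pi_norm (A *ᵥ Pi.single j 1) i
  simpa using this

/-! ### The normal form of positive quartics -/

/-- The average over the unit circle of a quartic form, up to the normalization which gives
`(x² + y²)²` mean `1`. -/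
noncomputable def circleMean (c : Fin 5 → ℝ) : ℝ := (3 * c 0 + c 2 + 3 * c 4) / 8

/-- The quartic `α (x² + y²)² + β Re (x + iy)⁴`. -/
noncomputable def normalForm (α β : ℝ) : Fin 5 → ℝ := ![α + β, 0, 2 * α - 6 * β, 0, α + β]

theorem circleMean_eq (c : Fin 5 → ℝ) :
    8 * circleMean c = 2 * binaryForm (d := 4) c ![1, 0] + 2 * binaryForm (d := 4) c ![0, 1]
      + (binaryForm (d := 4) c ![1, 1] + binaryForm (d := 4) c ![1, -1]) / 2 := by
  simp [circleMean, binaryForm_four]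
  ring

theorem normalForm_smul (t α β : ℝ) : t • normalForm α β = normalForm (t * α) (t * β) := by
  ext i
  fin_cases i <;> simp [normalForm] <;> ring

theorem normalForm_add (α β α' β' : ℝ) :
    normalForm α β + normalForm α' β' = normalForm (α + α') (β + β') := by
  ext i
  fin_cases i <;> simp [normalForm] <;> ring

theorem continuous_substMatrix_four_mulVec (c : Fin 5 → ℝ) :
    Continuous fun A : Matrix (Fin 2) (Fin 2) ℝ => substMatrix 4 A *ᵥ c := by
  have h : (fun A : Matrix (Fin 2) (Fin 2) ℝ => substMatrix 4 A *ᵥ c) =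
      fun A => substMatrix 4 !![A 0 0, A 0 1; A 1 0, A 1 1] *ᵥ c := by
    funext A; rw [← Matrix.eta_fin_two A]
  rw [h]
  simp only [substMatrix_four_mulVec]
  refine continuous_pi fun i => ?_
  fin_cases i <;> simp <;> fun_prop

theorem circleMean_subst_coercive {c : Fin 5 → ℝ} {ε : ℝ}
    (h : ∀ v : Fin 2 → ℝ, ε * ‖v‖ ^ 4 ≤ binaryForm (d := 4) c v) (hε : 0 < ε)
    (A : Matrix (Fin 2) (Fin 2) ℝ) (i j : Fin 2) :
    ε * |A i j| ^ 4 ≤ 4 * circleMean (substMatrix 4 A *ᵥ c) := by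
  have h0 : ∀ v : Fin 2 → ℝ, 0 ≤ binaryForm (d := 4) (substMatrix 4 A *ᵥ c) v := fun v => by
    rw [binaryForm_subst]
    exact le_trans (by positivity) (h _)
  have h1 := abs_entry_pow_le h hε A i j
  rw [le_div_iff₀ hε] at h1
  have e := circleMean_eq (substMatrix 4 A *ᵥ c)
  have e1 : (Pi.single 0 1 : Fin 2 → ℝ) = ![1, 0] := by ext k; fin_cases k <;> rfl
  have e2 : (Pi.single 1 1 : Fin 2 → ℝ) = ![0, 1] := by ext k; fin_cases k <;> rfl
  have a1 := h0 ![1, 0]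
  have a2 := h0 ![0, 1]
  have a3 := h0 ![1, 1]
  have a4 := h0 ![1, -1]
  fin_cases j
  · simp only [Fin.zero_eta, e1] at h1
    simp only [Fin.zero_eta]
    linarith
  · simp only [Fin.mk_one, e2] at h1
    simp only [Fin.mk_one]
    linarith

/-- A positive quartic has an `SL₂(ℝ)`-translate of minimal circle mean. -/
theorem IsPositive.exists_min_circleMean {c : Fin 5 → ℝ} (hc : IsPositive (d := 4) c) :
    ∃ g : SL(2, ℝ), ∀ h : SL(2, ℝ),
      circleMean (substMatrix 4 g.1 *ᵥ c) ≤ circleMean (substMatrix 4 h.1 *ᵥ c) := by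
  obtain ⟨ε, hε, hle⟩ := hc.exists_le
  have hcont : Continuous fun g : SL(2, ℝ) => circleMean (substMatrix 4 g.1 *ᵥ c) := by
    have h1 := (continuous_substMatrix_four_mulVec c).comp continuous_slVal
    have h2 : Continuous circleMean := by unfold circleMean; fun_prop
    exact h2.comp h1
  set M := circleMean (substMatrix 4 (1 : SL(2, ℝ)).1 *ᵥ c) with hM
  set R := 1 + 4 * |M| / ε with hR
  have hR1 : 1 ≤ R := by rw [hR]; have : 0 ≤ 4 * |M| / ε := by positivity
                         linarith
  obtain ⟨g, -, hg⟩ := (isCompact_slBox R).exists_isMinOn ⟨1, fun i j => by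
    fin_cases i <;> fin_cases j <;> simp <;> linarith⟩ hcont.continuousOn
  refine ⟨g, fun h => ?_⟩
  by_cases hh : ∀ i j, |h.1 i j| ≤ R
  · exact hg hh
  · push Not at hh
    obtain ⟨i, j, hij⟩ := hh
    have h1 := circleMean_subst_coercive hle hε h.1 i j
    have h2 : R ≤ |h.1 i j| ^ 4 := by
      have : |h.1 i j| ≤ |h.1 i j| ^ 4 := le_self_pow₀ (by linarith) (by norm_num)
      linarith
    have h3 : 4 * |M| < ε * R := by
      rw [hR, mul_add, mul_div_cancel₀ _ hε.ne']; linarith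
    have h4 : M ≤ circleMean (substMatrix 4 h.1 *ᵥ c) := by
      have := mul_le_mul_of_nonneg_left h2 hε.le
      have := le_abs_self M
      linarith
    refine le_trans (hg (a := 1) (fun i j => ?_)) h4
    fin_cases i <;> fin_cases j <;> simp <;> linarith

theorem linear_coeff_eq_zero {a b c d : ℝ}
    (h : ∀ t : ℝ, 0 ≤ a * t + b * t ^ 2 + c * t ^ 3 + d * t ^ 4) : a = 0 := by
  have hp : ∀ n : ℕ, HasDerivAt (fun t : ℝ => t ^ (n + 2)) 0 0 := fun n => by
    simpa using hasDerivAt_pow (n + 2) (0 : ℝ)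
  have hd : HasDerivAt (fun t : ℝ => a * t + b * t ^ 2 + c * t ^ 3 + d * t ^ 4) a 0 := by
    have := ((((hasDerivAt_id (0 : ℝ)).const_mul a).fun_add ((hp 0).const_mul b)).fun_add
      ((hp 1).const_mul c)).fun_add ((hp 2).const_mul d)
    refine this.congr_deriv ?_
    ring
  exact IsLocalMin.hasDerivAt_eq_zero (Filter.Eventually.of_forall fun t => by simpa using h t) hd

theorem eq_of_forall_le_exp {a b : ℝ}
    (h : ∀ t : ℝ, a + b ≤ a * Real.exp (-t) ^ 4 + b * Real.exp t ^ 4) : a = b := by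
  have hd : HasDerivAt (fun t : ℝ => a * Real.exp (-t) ^ 4 + b * Real.exp t ^ 4)
      (4 * b - 4 * a) 0 := by
    have h1 : HasDerivAt (fun t : ℝ => Real.exp (-t)) (-1) 0 := by
      simpa using ((hasDerivAt_id (0 : ℝ)).neg).exp
    have h2 : HasDerivAt (fun t : ℝ => Real.exp t) 1 0 := by
      simpa using Real.hasDerivAt_exp 0
    refine (((h1.fun_pow 4).const_mul a).fun_add ((h2.fun_pow 4).const_mul b)).congr_deriv ?_
    simp
    ring
  have := IsLocalMin.hasDerivAt_eq_zero (Filter.Eventually.of_forall fun t => by simpa using h t) hd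
  linarith

/-- A quartic of minimal circle mean in its orbit has no component of weight `2` for the rotation
group. -/
theorem coeff_eq_of_min_circleMean {c : Fin 5 → ℝ}
    (h : ∀ g : SL(2, ℝ), circleMean c ≤ circleMean (substMatrix 4 g.1 *ᵥ c)) :
    c 0 = c 4 ∧ c 3 = -c 1 := by
  constructor
  · refine eq_of_forall_le_exp fun t => ?_
    have := h (slMk (Real.exp t) 0 0 (Real.exp (-t)) (by rw [← Real.exp_add]; simp))
    rw [slMk_val, substMatrix_four_mulVec] at this
    have e3 : Real.exp t ^ 2 * Real.exp (-t) ^ 2 = 1 := by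
      rw [← mul_pow, ← Real.exp_add]; simp
    simp only [circleMean, Matrix.cons_val] at this
    simp only [e3] at this
    linarith
  · have := linear_coeff_eq_zero (a := 3 * c 1 + 3 * c 3) (b := 3 * c 2 + 6 * c 4) (c := 3 * c 3)
      (d := 3 * c 4) fun t => by
        have := h (slMk 1 t 0 1 (by ring))
        rw [slMk_val, substMatrix_four_mulVec] at this
        simp [circleMean] at this
        linarith
    linarith

/-- A quartic without component of weight `2` is brought to normal form by a rotation. -/
theorem exists_rotation_eq_normalForm {c : Fin 5 → ℝ} (h0 : c 0 = c 4) (h1 : c 3 = -c 1) :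
    ∃ (g : SL(2, ℝ)) (α β : ℝ), 0 ≤ β ∧ substMatrix 4 g.1 *ᵥ c = normalForm α β := by
  set α := circleMean c with hα
  set w : ℂ := ⟨c 0 - α, c 1 / 4⟩ with hw
  obtain ⟨ζ, hζ, hζw⟩ : ∃ ζ : ℂ, ‖ζ‖ = 1 ∧ ζ ^ 4 * w = ‖w‖ := by
    refine ⟨Complex.exp ((-(w.arg / 4) : ℝ) * Complex.I), Complex.norm_exp_ofReal_mul_I _, ?_⟩
    nth_rw 2 [← Complex.norm_mul_exp_arg_mul_I w]
    rw [← Complex.exp_nat_mul, mul_left_comm, ← Complex.exp_add]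
    have : ((4 : ℕ) : ℂ) * ((-(w.arg / 4) : ℝ) * Complex.I) + w.arg * Complex.I = 0 := by
      push_cast; ring
    rw [this]
    simp
  set p := ζ.re with hp
  set r := ζ.im with hr
  have hpr : p ^ 2 + r ^ 2 = 1 := by
    have := Complex.sq_norm ζ
    rw [hζ, Complex.normSq_apply] at this
    linarith
  have hre := congrArg Complex.re hζw
  have him := congrArg Complex.im hζw
  have hζ4 : ζ ^ 4 = ⟨p ^ 4 - 6 * p ^ 2 * r ^ 2 + r ^ 4, 4 * p ^ 3 * r - 4 * p * r ^ 3⟩ := by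
    apply Complex.ext <;> simp [pow_succ, ← hp, ← hr] <;> ring
  rw [hζ4] at hre him
  simp [hw] at hre him
  refine ⟨slMk p (-r) r p (by linarith), α, ‖w‖, norm_nonneg _, ?_⟩
  rw [slMk_val, substMatrix_four_mulVec, ← h0, h1]
  have h2 : c 2 = 8 * α - 6 * c 0 := by rw [hα, circleMean, ← h0]; ring
  rw [h2]
  generalize ‖w‖ = n at *
  ext i
  fin_cases i <;> simp [normalForm]
  · linear_combination (α * (p ^ 2 + r ^ 2 + 1)) * hpr + hre
  · linear_combination 4 * him
  · linear_combination (2 * α * (p ^ 2 + r ^ 2 + 1)) * hpr - 6 * hre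
  · linear_combination (-4) * him
  · linear_combination (α * (p ^ 2 + r ^ 2 + 1)) * hpr + hre

theorem IsPositive.exists_normalForm {c : Fin 5 → ℝ} (hc : IsPositive (d := 4) c) :
    ∃ (g : SL(2, ℝ)) (α β : ℝ), 0 ≤ β ∧ β < α ∧ c = substMatrix 4 g.1 *ᵥ normalForm α β := by
  obtain ⟨g, hg⟩ := hc.exists_min_circleMean
  obtain ⟨h0, h1⟩ := coeff_eq_of_min_circleMean (c := substMatrix 4 g.1 *ᵥ c) fun h => by
    rw [← substMatrix_coe_mul_mulVec]; exact hg _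
  obtain ⟨k, α, β, hβ, hk⟩ := exists_rotation_eq_normalForm h0 h1
  rw [← substMatrix_coe_mul_mulVec] at hk
  refine ⟨(g * k)⁻¹, α, β, hβ, ?_, ?_⟩
  · have hpos := hc.subst (g * k)
    rw [hk] at hpos
    have := hpos ![1, 1] (by simp)
    rw [binaryForm_four] at this
    simp [normalForm] at this
    linarith
  · rw [← hk, substMatrix_inv_mulVec]

/-! ### An invariant convex cone of quartics -/

/-- The linear form on quartics whose zero hyperplane supports the invariant cone
`middleCone` along the ray of `normalForm 3 2`. -/
def supportForm (c : Fin 5 → ℝ) : ℝ := 3 * c 0 + 5 * c 2 + 3 * c 4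

theorem supportForm_add (c c' : Fin 5 → ℝ) :
    supportForm (c + c') = supportForm c + supportForm c' := by
  simp [supportForm]; ring

theorem supportForm_smul (t : ℝ) (c : Fin 5 → ℝ) : supportForm (t • c) = t * supportForm c := by
  simp [supportForm]; ring

theorem supportForm_normalForm (α β : ℝ) :
    supportForm (normalForm α β) = 16 * α - 24 * β := by
  simp [supportForm, normalForm]; ring

theorem continuous_supportForm : Continuous supportForm := by
  unfold supportForm; fun_prop

theorem abs_hopf_le (p q r s : ℝ) (h : p * s - q * r = 1) :
    |(p * q - r * s) ^ 2 - (p * s + q * r) ^ 2| ≤ 1 + (p * q + r * s) ^ 2 := by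
  have e : 1 + (p * q + r * s) ^ 2 = (p * q - r * s) ^ 2 + (p * s + q * r) ^ 2 := by
    have : (p * s - q * r) ^ 2 = 1 := by rw [h]; norm_num
    linear_combination -this
  rw [e, abs_le]
  constructor <;> nlinarith [sq_nonneg (p * q - r * s), sq_nonneg (p * s + q * r)]

theorem supportForm_subst_normalForm {p q r s : ℝ} (h : p * s - q * r = 1) (α β : ℝ) :
    supportForm (substMatrix 4 !![p, q; r, s] *ᵥ normalForm α β) =
      α * (3 * (p ^ 2 + r ^ 2) ^ 2 + 3 * (q ^ 2 + s ^ 2) ^ 2 + 10 + 30 * (p * q + r * s) ^ 2)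
        + 3 * β * ((p ^ 2 - r ^ 2 + q ^ 2 - s ^ 2) ^ 2 - 4 * (p * r + q * s) ^ 2)
        + 24 * β * ((p * q - r * s) ^ 2 - (p * s + q * r) ^ 2) := by
  have h2 : (p * s - q * r) ^ 2 = 1 := by rw [h]; norm_num
  rw [supportForm, substMatrix_four_mulVec]
  simp [normalForm]
  linear_combination (10 * α) * h2

/-- The defect of `g` from being a rotation; it is nonnegative on `SL₂(ℝ)`. -/
theorem two_le_sq_add_sq {p q r s : ℝ} (h : p * s - q * r = 1) :
    2 + 2 * (p * q + r * s) ^ 2 ≤ (p ^ 2 + r ^ 2) ^ 2 + (q ^ 2 + s ^ 2) ^ 2 := by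
  have h2 : (p * s - q * r) ^ 2 = 1 := by rw [h]; norm_num
  nlinarith [sq_nonneg (p ^ 2 + r ^ 2 - (q ^ 2 + s ^ 2))]

theorem supportForm_subst_normalForm_ge {α β p q r s : ℝ} (hβ : |β| ≤ α)
    (h : p * s - q * r = 1) :
    16 * α - 24 * |β| + 3 * (α - |β|) * ((p ^ 2 + r ^ 2) ^ 2 + (q ^ 2 + s ^ 2) ^ 2 - 2) ≤
      supportForm (substMatrix 4 !![p, q; r, s] *ᵥ normalForm α β) := by
  rw [supportForm_subst_normalForm h]
  have h2 : (p * s - q * r) ^ 2 = 1 := by rw [h]; norm_num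
  have h1 := abs_hopf_le p q r s h
  have h3 : |(p ^ 2 - r ^ 2 + q ^ 2 - s ^ 2) ^ 2 - 4 * (p * r + q * s) ^ 2| ≤
      (p ^ 2 + r ^ 2) ^ 2 + (q ^ 2 + s ^ 2) ^ 2 + 2 * (p * q + r * s) ^ 2 - 2 := by
    have e : (p ^ 2 + r ^ 2) ^ 2 + (q ^ 2 + s ^ 2) ^ 2 + 2 * (p * q + r * s) ^ 2 - 2 =
        (p ^ 2 - r ^ 2 + q ^ 2 - s ^ 2) ^ 2 + 4 * (p * r + q * s) ^ 2 := by
      linear_combination 2 * h2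
    rw [e, abs_le]
    constructor <;> nlinarith [sq_nonneg (p ^ 2 - r ^ 2 + q ^ 2 - s ^ 2), sq_nonneg (p * r + q * s)]
  set E := (p * q - r * s) ^ 2 - (p * s + q * r) ^ 2
  set H := (p ^ 2 - r ^ 2 + q ^ 2 - s ^ 2) ^ 2 - 4 * (p * r + q * s) ^ 2
  set B := p * q + r * s
  set X := (p ^ 2 + r ^ 2) ^ 2 + (q ^ 2 + s ^ 2) ^ 2
  have h4 : -(|β| * (1 + B ^ 2)) ≤ β * E := by
    have := neg_abs_le (β * E)
    rw [abs_mul] at this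
    have := mul_le_mul_of_nonneg_left h1 (abs_nonneg β)
    linarith
  have h5 : -(|β| * (X + 2 * B ^ 2 - 2)) ≤ β * H := by
    have := neg_abs_le (β * H)
    rw [abs_mul] at this
    have := mul_le_mul_of_nonneg_left h3 (abs_nonneg β)
    linarith
  have h6 : |β| * B ^ 2 ≤ α * B ^ 2 := mul_le_mul_of_nonneg_right hβ (sq_nonneg B)
  have e : α * (3 * (p ^ 2 + r ^ 2) ^ 2 + 3 * (q ^ 2 + s ^ 2) ^ 2 + 10 + 30 * B ^ 2) =
      α * (3 * X + 10 + 30 * B ^ 2) := by ring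
  rw [e]
  linarith

theorem supportForm_subst_ge {α β : ℝ} (hβ : |β| ≤ α) (g : SL(2, ℝ)) :
    16 * α - 24 * |β| ≤ supportForm (substMatrix 4 g.1 *ᵥ normalForm α β) := by
  obtain ⟨p, q, r, s, hd, rfl⟩ := exists_eq_slMk g
  refine le_trans ?_ (supportForm_subst_normalForm_ge hβ hd)
  have h1 := two_le_sq_add_sq hd
  have h2 : 0 ≤ (α - |β|) * ((p ^ 2 + r ^ 2) ^ 2 + (q ^ 2 + s ^ 2) ^ 2 - 2) :=
    mul_nonneg (by linarith) (by nlinarith [sq_nonneg (p * q + r * s)])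
  linarith

/-- The minimum of `supportForm` on an orbit is attained only at the normal form. -/
theorem subst_normalForm_eq_of_supportForm_le {α β : ℝ} (h0 : 0 < β) (hβ : β < α) (g : SL(2, ℝ))
    (h : supportForm (substMatrix 4 g.1 *ᵥ normalForm α β) ≤ 16 * α - 24 * β) :
    substMatrix 4 g.1 *ᵥ normalForm α β = normalForm α β := by
  obtain ⟨p, q, r, s, hd, rfl⟩ := exists_eq_slMk g
  rw [slMk_val] at h ⊢
  have h1 := two_le_sq_add_sq hd
  have h2 := supportForm_subst_normalForm_ge (α := α) (β := β)
    (by rw [abs_of_pos h0]; exact hβ.le) hd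
  rw [abs_of_pos h0] at h2
  have h2' : (α - β) * ((p ^ 2 + r ^ 2) ^ 2 + (q ^ 2 + s ^ 2) ^ 2 - 2) ≤ 0 := by linarith
  have h3 : (p ^ 2 + r ^ 2) ^ 2 + (q ^ 2 + s ^ 2) ^ 2 ≤ 2 := by
    by_contra hc
    push Not at hc
    have := mul_pos (sub_pos.2 hβ) (sub_pos.2 hc)
    linarith
  have hAC : p ^ 2 + r ^ 2 + (q ^ 2 + s ^ 2) ≤ 2 := by
    nlinarith [sq_nonneg (p ^ 2 + r ^ 2 - 1), sq_nonneg (q ^ 2 + s ^ 2 - 1)]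
  have h4 : (p - s) ^ 2 + (q + r) ^ 2 ≤ 0 := by nlinarith
  have hs : s = p := by nlinarith [sq_nonneg (p - s), sq_nonneg (q + r)]
  have hq : q = -r := by nlinarith [sq_nonneg (p - s), sq_nonneg (q + r)]
  subst hs hq
  have hpr : s ^ 2 + r ^ 2 = 1 := by linarith
  rw [supportForm_subst_normalForm hd] at h
  have h5 : β * (s * r) ^ 2 ≤ 0 := by
    have e : (s ^ 2 + r ^ 2) ^ 2 = 1 := by rw [hpr]; norm_num
    have e2 : ((-r) ^ 2 + s ^ 2) ^ 2 = 1 := by rw [← e]; ring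
    nlinarith
  have h6 : s * r = 0 := by
    have : (s * r) ^ 2 ≤ 0 := by
      by_contra hc
      push Not at hc
      have := mul_pos h0 hc
      linarith
    exact pow_eq_zero_iff (two_ne_zero) |>.1 (le_antisymm this (sq_nonneg _))
  rw [substMatrix_four_mulVec]
  ext i
  fin_cases i <;> simp [normalForm]
  · linear_combination (α + β) * (s ^ 2 + r ^ 2 + 1) * hpr - 8 * β * s * r * h6
  · linear_combination (-16 * β * r ^ 2 + 16 * β * s ^ 2) * h6
  · linear_combination (2 * α - 6 * β) * (s ^ 2 + r ^ 2 + 1) * hpr + 48 * β * s * r * h6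
  · linear_combination (16 * β * r ^ 2 - 16 * β * s ^ 2) * h6
  · linear_combination (α + β) * (s ^ 2 + r ^ 2 + 1) * hpr - 8 * β * s * r * h6

/-- The cone over the domain `quarticDomain`: the positive quartics on which every
`SL₂(ℝ)`-translate of `supportForm` is positive. It lies strictly between the cone of sums of
fourth powers and the cone of nonnegative quartics. -/
def middleCone : Set (Fin 5 → ℝ) :=
  {c | IsPositive (d := 4) c ∧ ∀ g : SL(2, ℝ), 0 < supportForm (substMatrix 4 g.1 *ᵥ c)}

/-- The closure of `middleCone`. -/
def closedMiddleCone : Set (Fin 5 → ℝ) :=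
  {c | (∀ v, 0 ≤ binaryForm (d := 4) c v) ∧
    ∀ g : SL(2, ℝ), 0 ≤ supportForm (substMatrix 4 g.1 *ᵥ c)}

theorem binaryForm_zero_right {d : ℕ} (hd : d ≠ 0) (c : Fin (d + 1) → ℝ) : binaryForm c 0 = 0 := by
  have := binaryForm_smul c 0 0
  rwa [zero_smul, zero_pow hd, zero_mul] at this

theorem IsPositive.nonneg {c : Fin 5 → ℝ} (hc : IsPositive (d := 4) c) (v : Fin 2 → ℝ) :
    0 ≤ binaryForm (d := 4) c v := by
  by_cases hv : v = 0
  · rw [hv, binaryForm_zero_right (by norm_num)]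
  · exact (hc v hv).le

theorem IsPositive.ne_zero {d : ℕ} {c : Fin (d + 1) → ℝ} (hc : IsPositive c) : c ≠ 0 := by
  rintro rfl
  have := hc ![1, 0] (by simp)
  simp [binaryForm] at this

theorem middleCone_subset : middleCone ⊆ closedMiddleCone := fun _ hc =>
  ⟨hc.1.nonneg, fun g => (hc.2 g).le⟩

theorem closedMiddleCone_add_mem {c c' : Fin 5 → ℝ} (hc : c ∈ closedMiddleCone)
    (hc' : c' ∈ middleCone) : c + c' ∈ middleCone := by
  refine ⟨fun v hv => ?_, fun g => ?_⟩
  · rw [binaryForm_add]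
    exact add_pos_of_nonneg_of_pos (hc.1 v) (hc'.1 v hv)
  · rw [Matrix.mulVec_add, supportForm_add]
    exact add_pos_of_nonneg_of_pos (hc.2 g) (hc'.2 g)

theorem closedMiddleCone_add {c c' : Fin 5 → ℝ} (hc : c ∈ closedMiddleCone)
    (hc' : c' ∈ closedMiddleCone) : c + c' ∈ closedMiddleCone := by
  refine ⟨fun v => ?_, fun g => ?_⟩
  · rw [binaryForm_add]
    exact add_nonneg (hc.1 v) (hc'.1 v)
  · rw [Matrix.mulVec_add, supportForm_add]
    exact add_nonneg (hc.2 g) (hc'.2 g)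

theorem smul_mem_middleCone {c : Fin 5 → ℝ} (hc : c ∈ middleCone) {t : ℝ} (ht : 0 < t) :
    t • c ∈ middleCone := by
  refine ⟨fun v hv => ?_, fun g => ?_⟩
  · rw [binaryForm_const_smul]
    exact mul_pos ht (hc.1 v hv)
  · rw [Matrix.mulVec_smul, supportForm_smul]
    exact mul_pos ht (hc.2 g)

theorem smul_mem_closedMiddleCone {c : Fin 5 → ℝ} (hc : c ∈ closedMiddleCone) {t : ℝ}
    (ht : 0 ≤ t) : t • c ∈ closedMiddleCone := by
  refine ⟨fun v => ?_, fun g => ?_⟩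
  · rw [binaryForm_const_smul]
    exact mul_nonneg ht (hc.1 v)
  · rw [Matrix.mulVec_smul, supportForm_smul]
    exact mul_nonneg ht (hc.2 g)

theorem subst_mem_middleCone {c : Fin 5 → ℝ} (hc : c ∈ middleCone) (g : SL(2, ℝ)) :
    substMatrix 4 g.1 *ᵥ c ∈ middleCone :=
  ⟨hc.1.subst g, fun h => by rw [← substMatrix_coe_mul_mulVec]; exact hc.2 _⟩

theorem subst_mem_closedMiddleCone {c : Fin 5 → ℝ} (hc : c ∈ closedMiddleCone) (g : SL(2, ℝ)) :
    substMatrix 4 g.1 *ᵥ c ∈ closedMiddleCone :=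
  ⟨fun v => by rw [binaryForm_subst]; exact hc.1 _,
    fun h => by rw [← substMatrix_coe_mul_mulVec]; exact hc.2 _⟩

theorem subst_mem_middleCone_iff {c : Fin 5 → ℝ} (g : SL(2, ℝ)) :
    substMatrix 4 g.1 *ᵥ c ∈ middleCone ↔ c ∈ middleCone := by
  refine ⟨fun h => ?_, fun h => subst_mem_middleCone h g⟩
  have := subst_mem_middleCone h g⁻¹
  rwa [substMatrix_inv_mulVec] at this

theorem isClosed_closedMiddleCone : IsClosed closedMiddleCone := by
  have e : closedMiddleCone = (⋂ v, {c | 0 ≤ binaryForm (d := 4) c v}) ∩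
      ⋂ g : SL(2, ℝ), {c | 0 ≤ supportForm (substMatrix 4 g.1 *ᵥ c)} := by
    ext c
    simp [closedMiddleCone]
  rw [e]
  refine (isClosed_iInter fun v => isClosed_le continuous_const
    (continuous_binaryForm_coeff v)).inter (isClosed_iInter fun g => isClosed_le continuous_const
    (continuous_supportForm.comp ?_))
  fun_prop

/-- The closed cone is salient. -/
theorem eq_zero_of_nonneg_of_neg_nonneg {c : Fin 5 → ℝ} (h : ∀ v, 0 ≤ binaryForm (d := 4) c v)
    (h' : ∀ v, 0 ≤ binaryForm (d := 4) (-c) v) : c = 0 := by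
  refine binaryForm_injective 4 (funext fun v => ?_)
  have h1 := h v
  have h2 := h' v
  rw [binaryForm_neg] at h2
  have : binaryForm (d := 4) 0 v = 0 := by simp [binaryForm]
  rw [this]
  linarith

theorem isPositive_normalForm {α β : ℝ} (h : |β| < α) : IsPositive (d := 4) (normalForm α β) := by
  intro v hv
  have e : binaryForm (d := 4) (normalForm α β) v = α * (v 0 ^ 2 + v 1 ^ 2) ^ 2
      + β * ((v 0 ^ 2 - v 1 ^ 2) ^ 2 - 4 * (v 0 * v 1) ^ 2) := by
    simp [binaryForm_four, normalForm]; ring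
  have hpos : 0 < v 0 ^ 2 + v 1 ^ 2 := by
    by_contra hc
    apply hv
    have h0 : v 0 = 0 := by nlinarith [sq_nonneg (v 0), sq_nonneg (v 1)]
    have h1 : v 1 = 0 := by nlinarith [sq_nonneg (v 0), sq_nonneg (v 1)]
    ext i; fin_cases i <;> simp [h0, h1]
  have h2 : |(v 0 ^ 2 - v 1 ^ 2) ^ 2 - 4 * (v 0 * v 1) ^ 2| ≤ (v 0 ^ 2 + v 1 ^ 2) ^ 2 := by
    rw [abs_le]
    constructor <;> nlinarith [sq_nonneg (v 0 ^ 2 - v 1 ^ 2), sq_nonneg (v 0 * v 1)]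
  have h3 := neg_abs_le (β * ((v 0 ^ 2 - v 1 ^ 2) ^ 2 - 4 * (v 0 * v 1) ^ 2))
  rw [abs_mul] at h3
  have h4 := mul_le_mul_of_nonneg_left h2 (abs_nonneg β)
  have h5 := mul_lt_mul_of_pos_right h (pow_pos hpos 2)
  rw [e]
  linarith

theorem normalForm_mem_middleCone {α β : ℝ} (h : 3 * |β| < 2 * α) :
    normalForm α β ∈ middleCone := by
  have h1 : |β| < α := by linarith [abs_nonneg β]
  refine ⟨isPositive_normalForm h1, fun g => ?_⟩
  have := supportForm_subst_ge h1.le g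
  linarith

theorem normalForm_mem_closedMiddleCone {α β : ℝ} (hα : 0 ≤ α) (h : 3 * |β| ≤ 2 * α) :
    normalForm α β ∈ closedMiddleCone := by
  rcases hα.eq_or_lt with rfl | hα
  · have : β = 0 := abs_eq_zero.1 (by linarith [abs_nonneg β])
    subst this
    have e : normalForm 0 0 = 0 := by ext i; fin_cases i <;> simp [normalForm]
    rw [e]
    exact ⟨fun v => by simp [binaryForm], fun g => by simp [supportForm]⟩
  have h1 : |β| < α := by linarith [abs_nonneg β]
  refine ⟨(isPositive_normalForm h1).nonneg, fun g => ?_⟩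
  have := supportForm_subst_ge h1.le g
  linarith

theorem exists_normalForm_of_mem_closedMiddleCone {c : Fin 5 → ℝ} (hc : c ∈ closedMiddleCone)
    (hp : IsPositive (d := 4) c) : ∃ (g : SL(2, ℝ)) (α β : ℝ), 0 ≤ β ∧ β < α ∧ 3 * β ≤ 2 * α ∧
      c = substMatrix 4 g.1 *ᵥ normalForm α β := by
  obtain ⟨g, α, β, h0, h1, rfl⟩ := hp.exists_normalForm
  refine ⟨g, α, β, h0, h1, ?_, rfl⟩
  have := hc.2 g⁻¹
  rw [substMatrix_inv_mulVec, supportForm_normalForm] at this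
  linarith

theorem exists_normalForm_of_mem_middleCone {c : Fin 5 → ℝ} (hc : c ∈ middleCone) :
    ∃ (g : SL(2, ℝ)) (α β : ℝ), 0 ≤ β ∧ β < α ∧ 3 * β < 2 * α ∧
      c = substMatrix 4 g.1 *ᵥ normalForm α β := by
  obtain ⟨g, α, β, h0, h1, rfl⟩ := hc.1.exists_normalForm
  refine ⟨g, α, β, h0, h1, ?_, rfl⟩
  have := hc.2 g⁻¹
  rw [substMatrix_inv_mulVec, supportForm_normalForm] at this
  linarith

/-- The coefficient vector of the `d`-th power of the linear form `u 0 * X + u 1 * Y`. -/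
noncomputable def linearPower (d : ℕ) (u : Fin 2 → ℝ) : Fin (d + 1) → ℝ :=
  fun i => u 0 ^ (i : ℕ) * u 1 ^ (d - (i : ℕ)) * (d.choose i)

theorem binaryForm_linearPower (d : ℕ) (u v : Fin 2 → ℝ) :
    binaryForm (linearPower d u) v = (u 0 * v 0 + u 1 * v 1) ^ d := by
  rw [add_pow, Finset.sum_range, binaryForm]
  refine Finset.sum_congr rfl fun i _ => ?_
  rw [linearPower, mul_pow, mul_pow]
  ring

theorem subst_linearPower (d : ℕ) (A : Matrix (Fin 2) (Fin 2) ℝ) (u : Fin 2 → ℝ) :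
    substMatrix d A *ᵥ linearPower d u = linearPower d (Aᵀ *ᵥ u) := by
  refine binaryForm_injective d (funext fun v => ?_)
  rw [binaryForm_subst, binaryForm_linearPower, binaryForm_linearPower]
  simp [Matrix.mulVec, dotProduct, Fin.sum_univ_two]
  ring

theorem linearPower_four (u : Fin 2 → ℝ) : linearPower 4 u =
    ![u 1 ^ 4, 4 * u 0 * u 1 ^ 3, 6 * u 0 ^ 2 * u 1 ^ 2, 4 * u 0 ^ 3 * u 1, u 0 ^ 4] := by
  ext i
  fin_cases i <;> simp [linearPower] <;> norm_num [Nat.choose] <;> ring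

theorem linearPower_two (u : Fin 2 → ℝ) : linearPower 2 u =
    ![u 1 ^ 2, 2 * u 0 * u 1, u 0 ^ 2] := by
  ext i
  fin_cases i <;> simp [linearPower]
  ring

theorem linearPower_mem_closedMiddleCone (u : Fin 2 → ℝ) :
    linearPower 4 u ∈ closedMiddleCone := by
  refine ⟨fun v => ?_, fun g => ?_⟩
  · rw [binaryForm_linearPower]; positivity
  · rw [subst_linearPower, linearPower_four, supportForm]
    simp
    positivity

theorem linearPower_ne_zero {d : ℕ} {u : Fin 2 → ℝ} (hu : u ≠ 0) : linearPower d u ≠ 0 := by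
  intro h
  have h1 := binaryForm_linearPower d u u
  rw [h] at h1
  have h2 : u 0 * u 0 + u 1 * u 1 ≠ 0 := by
    intro h0
    apply hu
    have h3 : u 0 = 0 := by nlinarith [mul_self_nonneg (u 0), mul_self_nonneg (u 1)]
    have h4 : u 1 = 0 := by nlinarith [mul_self_nonneg (u 0), mul_self_nonneg (u 1)]
    ext i; fin_cases i <;> simp [h3, h4]
  exact pow_ne_zero d h2 (by rw [← h1]; simp [binaryForm])

theorem linearPower_smul (d : ℕ) (t : ℝ) (u : Fin 2 → ℝ) :
    linearPower d (t • u) = t ^ d • linearPower d u := by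
  refine binaryForm_injective d (funext fun v => ?_)
  rw [binaryForm_const_smul, binaryForm_linearPower, binaryForm_linearPower, ← mul_pow]
  simp
  ring

theorem exists_slMk_column {v : Fin 2 → ℝ} (hv : v ≠ 0) :
    ∃ g : SL(2, ℝ), g.1 *ᵥ ![1, 0] = v := by
  have hn : v 0 ^ 2 + v 1 ^ 2 ≠ 0 := by
    intro h0
    apply hv
    have h3 : v 0 = 0 := by nlinarith [sq_nonneg (v 0), sq_nonneg (v 1)]
    have h4 : v 1 = 0 := by nlinarith [sq_nonneg (v 0), sq_nonneg (v 1)]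
    ext i; fin_cases i <;> simp [h3, h4]
  refine ⟨slMk (v 0) (-v 1 / (v 0 ^ 2 + v 1 ^ 2)) (v 1) (v 0 / (v 0 ^ 2 + v 1 ^ 2)) ?_, ?_⟩
  · field_simp
    ring
  · ext i
    fin_cases i <;> simp [Matrix.mulVec, dotProduct, Fin.sum_univ_two]

theorem quadratic_coeff_eq_zero {a b c : ℝ} (h : ∀ t : ℝ, 0 ≤ a * t ^ 2 + b * t + c)
    (ha : a ≤ 0) : a = 0 ∧ b = 0 ∧ 0 ≤ c := by
  have hc : 0 ≤ c := by simpa using h 0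
  have hdisc : b ^ 2 ≤ 4 * a * c := by
    have := discrim_le_zero (a := a) (b := b) (c := c) fun t => by
      have := h t
      linarith
    rw [discrim] at this
    linarith
  have hac : a * c ≤ 0 := mul_nonpos_of_nonpos_of_nonneg ha hc
  have hb : b = 0 :=
    pow_eq_zero_iff (two_ne_zero) |>.1 (le_antisymm (by linarith) (sq_nonneg b))
  subst hb
  refine ⟨?_, rfl, hc⟩
  rcases mul_eq_zero.1 (show a * c = 0 by nlinarith) with h5 | h5
  · exact h5
  · have := h 1
    rw [h5] at this
    linarith

/-- A quartic of the closed cone with a real zero is a fourth power. -/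
theorem eq_linearPower_of_mem_closedMiddleCone {c : Fin 5 → ℝ} (hc : c ∈ closedMiddleCone)
    (h0 : c ≠ 0) (hp : ¬ IsPositive (d := 4) c) : ∃ u : Fin 2 → ℝ, u ≠ 0 ∧ c = linearPower 4 u := by
  unfold IsPositive at hp
  push Not at hp
  obtain ⟨v, hv, hcv⟩ := hp
  obtain ⟨g, rfl⟩ := exists_slMk_column hv
  have hP := subst_mem_closedMiddleCone hc g
  set P := substMatrix 4 g.1 *ᵥ c with hPdef
  have hcP : c = substMatrix 4 (g⁻¹).1 *ᵥ P := (substMatrix_inv_mulVec g c).symm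
  have h4 : P 4 = 0 := by
    have h1 := hP.1 ![1, 0]
    rw [hPdef, binaryForm_subst] at h1
    have h2 : binaryForm (d := 4) P ![1, 0] = 0 := by
      rw [hPdef, binaryForm_subst]; exact le_antisymm hcv h1
    simpa [binaryForm_four] using h2
  have h3 : P 3 = 0 :=
    linear_coeff_eq_zero (b := P 2) (c := P 1) (d := P 0) fun t => by
      have := hP.1 ![1, t]
      simp [binaryForm_four, h4] at this
      linarith
  -- the translates by `x ↦ σ⁻¹ (x + y)`, `y ↦ σ (y - x) / 2` have support form `→ -P 2`
  have h2 : P 2 ≤ 0 := by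
    have key : ∀ σ : ℝ, 0 < σ → P 2 ≤ 9 / 4 * P 0 * σ ^ 4 := fun σ hσ => by
      obtain ⟨τ, hτ⟩ : ∃ τ : ℝ, τ * σ = 1 := ⟨σ⁻¹, inv_mul_cancel₀ hσ.ne'⟩
      have := hP.2 (slMk τ τ (-(σ / 2)) (σ / 2) (by linarith))
      rw [slMk_val, substMatrix_four_mulVec, supportForm] at this
      simp only [h3, h4] at this
      simp at this
      have e : P 2 * (τ ^ 2 * σ ^ 2) = P 2 := by rw [← mul_pow, hτ]; ring
      linarith
    have hlim : Tendsto (fun σ : ℝ => 9 / 4 * P 0 * σ ^ 4) (𝓝[>] 0) (𝓝 (9 / 4 * P 0 * 0 ^ 4)) :=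
      (Continuous.tendsto (by fun_prop) 0).mono_left nhdsWithin_le_nhds
    have := ge_of_tendsto hlim (by filter_upwards [self_mem_nhdsWithin] with σ hσ using key σ hσ)
    simpa using this
  have hq : ∀ t : ℝ, 0 ≤ P 2 * t ^ 2 + P 1 * t + P 0 := fun t => by
    have := hP.1 ![t, 1]
    simp [binaryForm_four, h4, h3] at this
    linarith
  obtain ⟨h2', h1, hP0⟩ := quadratic_coeff_eq_zero hq h2
  have hPe : P = linearPower 4 ![0, P 0 ^ (1 / 4 : ℝ)] := by
    have e : (P 0 ^ (1 / 4 : ℝ)) ^ 4 = P 0 := by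
      rw [← Real.rpow_natCast, ← Real.rpow_mul hP0]; norm_num
    rw [linearPower_four]
    ext i
    fin_cases i
    · simpa using e.symm
    · simpa using h1
    · simpa using h2'
    · simpa using h3
    · simpa using h4
  rw [hPe, subst_linearPower] at hcP
  refine ⟨_, fun hu => h0 ?_, hcP⟩
  rw [hcP, hu, linearPower_four]
  ext i; fin_cases i <;> simp

theorem linearPower_add_mem_middleCone {u w : Fin 2 → ℝ} (h : u 0 * w 1 - u 1 * w 0 ≠ 0) :
    linearPower 4 u + linearPower 4 w ∈ middleCone := by
  have hpos : IsPositive (d := 4) (linearPower 4 u + linearPower 4 w) := by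
    intro v hv
    rw [binaryForm_add, binaryForm_linearPower, binaryForm_linearPower]
    by_contra hc
    have h1 : u 0 * v 0 + u 1 * v 1 = 0 := by
      have : (u 0 * v 0 + u 1 * v 1) ^ 4 = 0 := le_antisymm
        (by nlinarith [(Even.pow_nonneg (by decide : Even 4) (w 0 * v 0 + w 1 * v 1))])
        (by positivity)
      exact pow_eq_zero_iff (by norm_num) |>.1 this
    have h2 : w 0 * v 0 + w 1 * v 1 = 0 := by
      have : (w 0 * v 0 + w 1 * v 1) ^ 4 = 0 := le_antisymm
        (by nlinarith [(Even.pow_nonneg (by decide : Even 4) (u 0 * v 0 + u 1 * v 1))])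
        (by positivity)
      exact pow_eq_zero_iff (by norm_num) |>.1 this
    apply hv
    have h3 : (u 0 * w 1 - u 1 * w 0) * v 0 = 0 := by linear_combination w 1 * h1 - u 1 * h2
    have h4 : (u 0 * w 1 - u 1 * w 0) * v 1 = 0 := by linear_combination u 0 * h2 - w 0 * h1
    have h5 := (mul_eq_zero.1 h3).resolve_left h
    have h6 := (mul_eq_zero.1 h4).resolve_left h
    ext i; fin_cases i <;> simp [h5, h6]
  have h2 : ∀ (g : SL(2, ℝ)) (u : Fin 2 → ℝ), 0 ≤ (substMatrix 4 g.1 *ᵥ linearPower 4 u) 2 := by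
    intro g u
    rw [subst_linearPower, linearPower_four]
    simp
    positivity
  obtain ⟨g, α, β, h0, h1, he⟩ := hpos.exists_normalForm
  rw [he, subst_mem_middleCone_iff]
  apply normalForm_mem_middleCone
  have h3 := add_nonneg (h2 g⁻¹ u) (h2 g⁻¹ w)
  rw [← Pi.add_apply, ← Matrix.mulVec_add, he, substMatrix_inv_mulVec] at h3
  simp [normalForm] at h3
  rw [abs_of_nonneg h0]
  linarith

theorem abs_binaryForm_le {d : ℕ} {c : Fin (d + 1) → ℝ} {δ : ℝ} (hδ : ∀ i, |c i| ≤ δ)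
    (v : Fin 2 → ℝ) : |binaryForm c v| ≤ (d + 1) * (δ * ‖v‖ ^ d) := by
  unfold binaryForm
  refine (Finset.abs_sum_le_sum_abs _ _).trans ?_
  have : ∀ i ∈ (Finset.univ : Finset (Fin (d + 1))),
      |c i * v 0 ^ (i : ℕ) * v 1 ^ (d - (i : ℕ))| ≤ δ * ‖v‖ ^ d := by
    intro i _
    have e : ‖v‖ ^ d = ‖v‖ ^ (i : ℕ) * ‖v‖ ^ (d - (i : ℕ)) := by
      rw [← pow_add]; congr 1; have := i.2; omega
    rw [abs_mul, abs_mul, abs_pow, abs_pow, e, mul_assoc]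
    have h0 : |v 0| ≤ ‖v‖ := norm_le_pi_norm v 0
    have h1 : |v 1| ≤ ‖v‖ := norm_le_pi_norm v 1
    have := hδ i
    gcongr
    exact (abs_nonneg _).trans this
  refine (Finset.sum_le_card_nsmul _ _ _ this).trans ?_
  simp

theorem norm_sq_le (v : Fin 2 → ℝ) : ‖v‖ ^ 2 ≤ v 0 ^ 2 + v 1 ^ 2 := by
  obtain ⟨i, hi⟩ : ∃ i, ‖v‖ = |v i| := by
    obtain ⟨i, -, hi⟩ := Finset.exists_mem_eq_sup' (s := (Finset.univ : Finset (Fin 2)))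
      ⟨0, Finset.mem_univ _⟩ (fun i => ‖v i‖)
    refine ⟨i, le_antisymm ?_ (norm_le_pi_norm v i)⟩
    rw [pi_norm_le_iff_of_nonneg (abs_nonneg _)]
    intro j
    have := Finset.le_sup' (fun i => ‖v i‖) (Finset.mem_univ j)
    rw [hi] at this
    exact this
  rw [hi, sq_abs]
  fin_cases i
  · simpa using sq_nonneg (v 1)
  · simpa using sq_nonneg (v 0)

theorem supportForm_eq_eval (c : Fin 5 → ℝ) : supportForm c =
    5 / 2 * (binaryForm (d := 4) c ![1, 1] + binaryForm (d := 4) c ![1, -1])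
      - 2 * binaryForm (d := 4) c ![1, 0] - 2 * binaryForm (d := 4) c ![0, 1] := by
  simp [supportForm, binaryForm_four]
  ring

theorem abs_supportForm_subst_le {c : Fin 5 → ℝ} {δ : ℝ} (hδ : ∀ i, |c i| ≤ δ) (p q r s : ℝ) :
    |supportForm (substMatrix 4 !![p, q; r, s] *ᵥ c)| ≤
      210 * δ * ((p ^ 2 + r ^ 2) ^ 2 + (q ^ 2 + s ^ 2) ^ 2) := by
  have hδ0 : 0 ≤ δ := (abs_nonneg _).trans (hδ 0)
  have key : ∀ x y : ℝ, |binaryForm (d := 4) (substMatrix 4 !![p, q; r, s] *ᵥ c) ![x, y]| ≤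
      5 * δ * ((p * x + q * y) ^ 2 + (r * x + s * y) ^ 2) ^ 2 := by
    intro x y
    rw [binaryForm_subst]
    refine (abs_binaryForm_le hδ _).trans ?_
    have h1 := norm_sq_le (!![p, q; r, s] *ᵥ ![x, y])
    have h2 : ‖!![p, q; r, s] *ᵥ ![x, y]‖ ^ 4 = (‖!![p, q; r, s] *ᵥ ![x, y]‖ ^ 2) ^ 2 := by ring
    rw [h2]
    have h3 : (‖!![p, q; r, s] *ᵥ ![x, y]‖ ^ 2) ^ 2 ≤
        ((p * x + q * y) ^ 2 + (r * x + s * y) ^ 2) ^ 2 := by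
      refine pow_le_pow_left₀ (by positivity) (h1.trans (le_of_eq ?_)) 2
      simp [Matrix.mulVec, dotProduct, Fin.sum_univ_two]
    have := mul_le_mul_of_nonneg_left h3 hδ0
    push_cast
    linarith
  rw [supportForm_eq_eval]
  have k1 := key 1 1
  have k2 := key 1 (-1)
  have k3 := key 1 0
  have k4 := key 0 1
  simp only [mul_one, mul_zero, add_zero, zero_add, mul_neg] at k1 k2 k3 k4
  rw [abs_le] at k1 k2 k3 k4 ⊢
  have b1 : ((p + q) ^ 2 + (r + s) ^ 2) ^ 2 ≤ 8 * ((p ^ 2 + r ^ 2) ^ 2 + (q ^ 2 + s ^ 2) ^ 2) := by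
    have : ((p + q) ^ 2 + (r + s) ^ 2) ≤ 2 * (p ^ 2 + r ^ 2 + (q ^ 2 + s ^ 2)) := by
      nlinarith [sq_nonneg (p - q), sq_nonneg (r - s)]
    have := pow_le_pow_left₀ (by positivity) this 2
    nlinarith [sq_nonneg (p ^ 2 + r ^ 2 - (q ^ 2 + s ^ 2))]
  have b2 : ((p + -q) ^ 2 + (r + -s) ^ 2) ^ 2 ≤
      8 * ((p ^ 2 + r ^ 2) ^ 2 + (q ^ 2 + s ^ 2) ^ 2) := by
    have : ((p + -q) ^ 2 + (r + -s) ^ 2) ≤ 2 * (p ^ 2 + r ^ 2 + (q ^ 2 + s ^ 2)) := by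
      nlinarith [sq_nonneg (p + q), sq_nonneg (r + s)]
    have := pow_le_pow_left₀ (by positivity) this 2
    nlinarith [sq_nonneg (p ^ 2 + r ^ 2 - (q ^ 2 + s ^ 2))]
  have b1' := mul_le_mul_of_nonneg_left b1 hδ0
  have b2' := mul_le_mul_of_nonneg_left b2 hδ0
  constructor <;> linarith

theorem eventually_isPositive {d : ℕ} {c : Fin (d + 1) → ℝ} (hc : IsPositive c) :
    ∀ᶠ c' in 𝓝 c, IsPositive c' := by
  obtain ⟨ε, hε, hle⟩ := hc.exists_le
  have hδ : 0 < ε / (2 * (d + 1)) := by positivity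
  filter_upwards [Metric.closedBall_mem_nhds c hδ] with c' hc' v hv
  have h1 : ∀ i, |(c' - c) i| ≤ ε / (2 * (d + 1)) := fun i =>
    (norm_le_pi_norm (c' - c) i).trans (by simpa [dist_eq_norm] using hc')
  have h2 := abs_binaryForm_le h1 v
  have h3 : binaryForm c' v = binaryForm c v + binaryForm (c' - c) v := by
    rw [← binaryForm_add]; congr 1; abel
  have h4 : (0 : ℝ) < ‖v‖ ^ d := pow_pos (norm_pos_iff.2 hv) d
  have h5 : ((d : ℝ) + 1) * (ε / (2 * (d + 1)) * ‖v‖ ^ d) = ε * ‖v‖ ^ d / 2 := by field_simp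
  rw [h5] at h2
  have h6 := hle v
  have h7 := mul_pos hε h4
  rw [h3]
  have := neg_abs_le (binaryForm (c' - c) v)
  linarith

theorem isOpen_middleCone : IsOpen middleCone := by
  rw [isOpen_iff_mem_nhds]
  intro c hc
  obtain ⟨g, α, β, h0, h1, h2, he⟩ := exists_normalForm_of_mem_middleCone hc
  have hN : middleCone ∈ 𝓝 (normalForm α β) := by
    set δ := min (3 * (α - β) / 210) ((16 * α - 24 * β) / 840) with hδ
    have hδ0 : 0 < δ := by
      rw [hδ]; apply lt_min <;> apply div_pos <;> linarith
    have hδ1 : 210 * δ ≤ 3 * (α - β) := by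
      have := min_le_left (3 * (α - β) / 210) ((16 * α - 24 * β) / 840); linarith
    have hδ2 : 840 * δ ≤ 16 * α - 24 * β := by
      have := min_le_right (3 * (α - β) / 210) ((16 * α - 24 * β) / 840); linarith
    filter_upwards [eventually_isPositive (d := 4) (isPositive_normalForm (α := α) (β := β)
      (by rwa [abs_of_nonneg h0])), Metric.closedBall_mem_nhds (normalForm α β) hδ0] with c' hp hc'
    refine ⟨hp, fun k => ?_⟩
    obtain ⟨p, q, r, s, hd, rfl⟩ := exists_eq_slMk k
    rw [slMk_val]
    have a1 : ∀ i, |(c' - normalForm α β) i| ≤ δ := fun i =>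
      (norm_le_pi_norm (c' - normalForm α β) i).trans (by simpa [dist_eq_norm] using hc')
    have a2 := abs_supportForm_subst_le a1 p q r s
    have a3 := supportForm_subst_normalForm_ge (α := α) (β := β)
      (by rw [abs_of_nonneg h0]; exact h1.le) hd
    rw [abs_of_nonneg h0] at a3
    have a4 : supportForm (substMatrix 4 !![p, q; r, s] *ᵥ c') =
        supportForm (substMatrix 4 !![p, q; r, s] *ᵥ normalForm α β)
        + supportForm (substMatrix 4 !![p, q; r, s] *ᵥ (c' - normalForm α β)) := by
      rw [← supportForm_add, ← Matrix.mulVec_add]; congr 2; abel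
    have a5 := two_le_sq_add_sq hd
    set X := (p ^ 2 + r ^ 2) ^ 2 + (q ^ 2 + s ^ 2) ^ 2
    have a6 : 0 ≤ X - 2 := by nlinarith [sq_nonneg (p * q + r * s)]
    have a7 := mul_le_mul_of_nonneg_right hδ1 a6
    rw [a4]
    have := neg_abs_le (supportForm (substMatrix 4 !![p, q; r, s] *ᵥ (c' - normalForm α β)))
    linarith
  have hcont : Continuous fun c : Fin 5 → ℝ => substMatrix 4 (g⁻¹).1 *ᵥ c := by fun_prop
  have h3 : substMatrix 4 (g⁻¹).1 *ᵥ c = normalForm α β := by rw [he, substMatrix_inv_mulVec]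
  have h4 := hcont.continuousAt (x := c)
  rw [ContinuousAt, h3] at h4
  filter_upwards [h4 hN] with c' hc'
  exact (subst_mem_middleCone_iff g⁻¹).1 hc'

/-! ### Topology of projective space -/

section Projective

variable {m : ℕ}

theorem continuous_mk' :
    Continuous (Projectivization.mk' ℝ : {v : Fin m → ℝ // v ≠ 0} → ℙ ℝ (Fin m → ℝ)) :=
  continuous_quot_mk

theorem isOpen_iff_mk' {U : Set (ℙ ℝ (Fin m → ℝ))} :
    IsOpen U ↔ IsOpen ((Projectivization.mk' ℝ : {v : Fin m → ℝ // v ≠ 0} → _) ⁻¹' U) :=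
  isOpen_coinduced

theorem mk_eq_mk_iff_exists {v w : Fin m → ℝ} (hv : v ≠ 0) (hw : w ≠ 0) :
    Projectivization.mk ℝ v hv = Projectivization.mk ℝ w hw ↔ ∃ t : ℝ, t ≠ 0 ∧ v = t • w := by
  rw [Projectivization.mk_eq_mk_iff']
  constructor
  · rintro ⟨a, ha⟩
    exact ⟨a, fun h0 => hv (by rw [← ha, h0, zero_smul]), ha.symm⟩
  · rintro ⟨t, -, ht⟩
    exact ⟨t, ht.symm⟩

theorem isOpenMap_mk' :
    IsOpenMap (Projectivization.mk' ℝ : {v : Fin m → ℝ // v ≠ 0} → ℙ ℝ (Fin m → ℝ)) := by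
  intro U hU
  rw [isOpen_iff_mk']
  have e : (Projectivization.mk' ℝ : {v : Fin m → ℝ // v ≠ 0} → _) ⁻¹'
      (Projectivization.mk' ℝ '' U) = ⋃ t : {t : ℝ // t ≠ 0},
        (fun v : {v : Fin m → ℝ // v ≠ 0} =>
          (⟨t.1 • v.1, smul_ne_zero t.2 v.2⟩ : {v : Fin m → ℝ // v ≠ 0})) ⁻¹' U := by
    ext v
    simp only [Set.mem_preimage, Set.mem_image, Set.mem_iUnion]
    constructor
    · rintro ⟨w, hw, hwv⟩
      obtain ⟨t, ht, htw⟩ := (mk_eq_mk_iff_exists w.2 v.2).1 hwv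
      refine ⟨⟨t, ht⟩, ?_⟩
      convert hw
      exact htw.symm
    · rintro ⟨t, ht⟩
      exact ⟨_, ht, (mk_eq_mk_iff_exists _ v.2).2 ⟨t.1, t.2, rfl⟩⟩
  rw [e]
  refine isOpen_iUnion fun t => hU.preimage ?_
  fun_prop

/-- The cone over a set of projective points. -/
def coneOver (T : Set (ℙ ℝ (Fin m → ℝ))) : Set (Fin m → ℝ) :=
  {v | ∃ hv : v ≠ 0, Projectivization.mk ℝ v hv ∈ T}

theorem mk_mem_closure_iff {T : Set (ℙ ℝ (Fin m → ℝ))} {v : Fin m → ℝ} (hv : v ≠ 0) :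
    Projectivization.mk ℝ v hv ∈ closure T ↔ v ∈ closure (coneOver T) := by
  have h1 := isOpenMap_mk' (m := m) |>.preimage_closure_eq_closure_preimage continuous_mk' T
  have h2 : Projectivization.mk ℝ v hv ∈ closure T ↔
      (⟨v, hv⟩ : {v : Fin m → ℝ // v ≠ 0}) ∈ closure (Projectivization.mk' ℝ ⁻¹' T) := by
    rw [← h1]; rfl
  rw [h2, closure_subtype]
  have h3 : Subtype.val '' ((Projectivization.mk' ℝ : {v : Fin m → ℝ // v ≠ 0} → _) ⁻¹' T) =
      coneOver T := by
    ext w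
    constructor
    · rintro ⟨w, hw, rfl⟩
      exact ⟨w.2, hw⟩
    · rintro ⟨hw, h⟩
      exact ⟨⟨w, hw⟩, h, rfl⟩
  rw [h3]

theorem continuous_smul_projective (g : SL(m, ℝ)) :
    Continuous fun p : ℙ ℝ (Fin m → ℝ) => g • p := by
  refine continuous_quot_lift _ ?_
  refine continuous_mk'.comp (f := fun v : {v : Fin m → ℝ // v ≠ 0} =>
    (⟨g • v.1, (smul_ne_zero_iff_ne g).2 v.2⟩ : {v : Fin m → ℝ // v ≠ 0})) ?_
  refine Continuous.subtype_mk ?_ _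
  have : (fun v : {v : Fin m → ℝ // v ≠ 0} => g • v.1) = fun v => g.1 *ᵥ v.1 := rfl
  rw [this]
  fun_prop

theorem mulVec_ne_zero_of_sl (g : SL(m, ℝ)) {v : Fin m → ℝ} (hv : v ≠ 0) : g.1 *ᵥ v ≠ 0 :=
  (smul_ne_zero_iff_ne g).2 hv

theorem mk_mem_affineChart {φ : Module.Dual ℝ (Fin m → ℝ)} {v : Fin m → ℝ} (hv : v ≠ 0) :
    Projectivization.mk ℝ v hv ∈ affineChart φ ↔ φ v ≠ 0 := by
  simp [affineChart, Projectivization.submodule_mk, Submodule.span_singleton_le_iff_mem]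

end Projective

/-! ### The invariant domain -/

/-- The projectivization of `middleCone`. -/
def quarticDomain : Set (ℙ ℝ (Fin 5 → ℝ)) :=
  {p | ∃ (c : Fin 5 → ℝ) (hc : c ≠ 0), c ∈ middleCone ∧ p = Projectivization.mk ℝ c hc}

theorem neg_smul_mem {S : Set (Fin 5 → ℝ)} (hS : ∀ c ∈ S, ∀ t : ℝ, 0 < t → t • c ∈ S)
    {c : Fin 5 → ℝ} {t : ℝ} (ht : t ≠ 0) (h : t • c ∈ S) : c ∈ S ∨ -c ∈ S := by
  rcases lt_or_gt_of_ne ht with h0 | h0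
  · right
    have := hS _ h (-t)⁻¹ (by simpa using h0)
    rw [smul_smul, inv_neg, neg_mul, inv_mul_cancel₀ ht, neg_smul, one_smul] at this
    exact this
  · left
    have := hS _ h t⁻¹ (by simpa using h0)
    rwa [smul_smul, inv_mul_cancel₀ ht, one_smul] at this

theorem mk_mem_quarticDomain {c : Fin 5 → ℝ} (hc : c ≠ 0) :
    Projectivization.mk ℝ c hc ∈ quarticDomain ↔ c ∈ middleCone ∨ -c ∈ middleCone := by
  constructor
  · rintro ⟨c', hc', hK, he⟩
    obtain ⟨t, ht, rfl⟩ := (mk_eq_mk_iff_exists hc' hc).1 he.symm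
    exact neg_smul_mem (fun c hc t ht => smul_mem_middleCone hc ht) ht hK
  · rintro (h | h)
    · exact ⟨c, hc, h, rfl⟩
    · refine ⟨-c, neg_ne_zero.2 hc, h, (mk_eq_mk_iff_exists _ _).2 ⟨-1, by norm_num, by simp⟩⟩

theorem coneOver_quarticDomain : coneOver quarticDomain = middleCone ∪ -middleCone := by
  ext c
  constructor
  · rintro ⟨hc, h⟩
    exact (mk_mem_quarticDomain hc).1 h
  · intro h
    have hc : c ≠ 0 := by
      rcases h with h | h
      · exact h.1.ne_zero
      · exact neg_ne_zero.1 (IsPositive.ne_zero (d := 4) h.1)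
    exact ⟨hc, (mk_mem_quarticDomain hc).2 h⟩

theorem isOpen_quarticDomain : IsOpen quarticDomain := by
  rw [isOpen_iff_mk']
  have e : (Projectivization.mk' ℝ : {v : Fin 5 → ℝ // v ≠ 0} → _) ⁻¹' quarticDomain =
      Subtype.val ⁻¹' (middleCone ∪ -middleCone) := by
    ext v
    exact mk_mem_quarticDomain v.2
  rw [e]
  exact (isOpen_middleCone.union isOpen_middleCone.neg).preimage continuous_subtype_val

/-- The quartic `(x² + y²)²`, which serves as a base point of the cone. -/
noncomputable def baseQuartic : Fin 5 → ℝ := normalForm 1 0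

theorem baseQuartic_mem : baseQuartic ∈ middleCone := normalForm_mem_middleCone (by norm_num)

theorem closure_middleCone : closure middleCone = closedMiddleCone := by
  refine subset_antisymm (isClosed_closedMiddleCone.closure_subset_iff.2 middleCone_subset) ?_
  intro c hc
  have hlim : Tendsto (fun t : ℝ => c + t • baseQuartic) (𝓝[>] 0)
      (𝓝 (c + (0 : ℝ) • baseQuartic)) :=
    (Continuous.tendsto (by fun_prop) 0).mono_left nhdsWithin_le_nhds
  rw [zero_smul, add_zero] at hlim
  refine mem_closure_of_tendsto hlim ?_
  filter_upwards [self_mem_nhdsWithin] with t ht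
  exact closedMiddleCone_add_mem hc (smul_mem_middleCone baseQuartic_mem ht)

theorem mk_mem_closure_quarticDomain {c : Fin 5 → ℝ} (hc : c ≠ 0) :
    Projectivization.mk ℝ c hc ∈ closure quarticDomain ↔
      c ∈ closedMiddleCone ∨ -c ∈ closedMiddleCone := by
  rw [mk_mem_closure_iff, coneOver_quarticDomain, closure_union, closure_middleCone]
  have : closure (-middleCone) = -closedMiddleCone := by
    rw [← closure_middleCone]
    exact (Homeomorph.neg (Fin 5 → ℝ)).preimage_closure middleCone |>.symm
  rw [this]
  rfl

/-- On an affine chart containing the closed domain, the linear form has constant sign on the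
cone. -/
theorem exists_sign {φ : Module.Dual ℝ (Fin 5 → ℝ)} (h : closure quarticDomain ⊆ affineChart φ) :
    ∃ σ : ℝ, (σ = 1 ∨ σ = -1) ∧ ∀ c ∈ closedMiddleCone, c ≠ 0 → 0 < σ * φ c := by
  have hne : ∀ c ∈ closedMiddleCone, c ≠ 0 → φ c ≠ 0 := fun c hc h0 =>
    (mk_mem_affineChart h0).1 (h ((mk_mem_closure_quarticDomain h0).2 (Or.inl hc)))
  have hb := middleCone_subset baseQuartic_mem
  have hb0 := baseQuartic_mem.1.ne_zero
  have key : ∀ c ∈ closedMiddleCone, c ≠ 0 → 0 < φ baseQuartic * φ c := by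
    intro c hc h0
    by_contra hneg
    have hlt : φ baseQuartic * φ c < 0 :=
      lt_of_le_of_ne (not_lt.1 hneg) (mul_ne_zero (hne _ hb hb0) (hne c hc h0))
    have hm : |φ c| • baseQuartic + |φ baseQuartic| • c ∈ middleCone := by
      rw [add_comm]
      exact closedMiddleCone_add_mem (smul_mem_closedMiddleCone hc (abs_nonneg _))
        (smul_mem_middleCone baseQuartic_mem (abs_pos.2 (hne c hc h0)))
    apply hne _ (middleCone_subset hm) hm.1.ne_zero
    simp only [map_add, map_smul, smul_eq_mul]
    rcases mul_neg_iff.1 hlt with ⟨h1, h2⟩ | ⟨h1, h2⟩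
    · rw [abs_of_neg h2, abs_of_pos h1]; ring
    · rw [abs_of_pos h2, abs_of_neg h1]; ring
  rcases lt_or_gt_of_ne (hne _ hb hb0) with h0 | h0
  · refine ⟨-1, Or.inr rfl, fun c hc hc0 => ?_⟩
    have := neg_of_mul_pos_right (key c hc hc0) h0.le
    linarith
  · refine ⟨1, Or.inl rfl, fun c hc hc0 => ?_⟩
    rw [one_mul]
    exact pos_of_mul_pos_right (key c hc hc0) h0.le

theorem ne_zero_of_map_eq_one {φ : Module.Dual ℝ (Fin 5 → ℝ)} {x : Fin 5 → ℝ} (h : φ x = 1) :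
    x ≠ 0 := by
  rintro rfl
  simp at h

theorem sign_select {φ : Module.Dual ℝ (Fin 5 → ℝ)} {σ : ℝ} (hσ : σ = 1 ∨ σ = -1)
    (h : ∀ c ∈ closedMiddleCone, c ≠ 0 → 0 < σ * φ c) {S : Set (Fin 5 → ℝ)}
    (hS : S ⊆ closedMiddleCone) {x : Fin 5 → ℝ} (hx : φ x = 1) :
    (x ∈ S ∨ -x ∈ S) ↔ σ • x ∈ S := by
  have hx0 := ne_zero_of_map_eq_one hx
  rcases hσ with rfl | rfl
  · rw [one_smul]
    refine ⟨fun h' => h'.resolve_right fun hn => ?_, Or.inl⟩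
    have := h _ (hS hn) (neg_ne_zero.2 hx0)
    rw [map_neg, hx] at this
    norm_num at this
  · rw [neg_smul, one_smul]
    refine ⟨fun h' => h'.resolve_left fun hn => ?_, Or.inr⟩
    have := h _ (hS hn) hx0
    rw [hx] at this
    norm_num at this

theorem mem_affinePart_quarticDomain {φ : Module.Dual ℝ (Fin 5 → ℝ)} {σ : ℝ}
    (hσ : σ = 1 ∨ σ = -1) (h : ∀ c ∈ closedMiddleCone, c ≠ 0 → 0 < σ * φ c) {x : Fin 5 → ℝ}
    (hx : φ x = 1) : x ∈ affinePart φ quarticDomain ↔ σ • x ∈ middleCone := by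
  rw [← sign_select hσ h middleCone_subset hx, ← mk_mem_quarticDomain (ne_zero_of_map_eq_one hx)]
  exact ⟨fun h => h.2.2, fun h => ⟨hx, ne_zero_of_map_eq_one hx, h⟩⟩

theorem mem_affinePart_frontier {φ : Module.Dual ℝ (Fin 5 → ℝ)} {σ : ℝ}
    (hσ : σ = 1 ∨ σ = -1) (h : ∀ c ∈ closedMiddleCone, c ≠ 0 → 0 < σ * φ c) {x : Fin 5 → ℝ}
    (hx : φ x = 1) : x ∈ affinePart φ (frontier quarticDomain) ↔
      σ • x ∈ closedMiddleCone ∧ σ • x ∉ middleCone := by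
  have hx0 := ne_zero_of_map_eq_one hx
  rw [← sign_select hσ h middleCone_subset hx, ← sign_select hσ h subset_rfl hx,
    ← mk_mem_quarticDomain hx0, ← mk_mem_closure_quarticDomain hx0,
    frontier, isOpen_quarticDomain.interior_eq]
  exact ⟨fun h => h.2.2, fun h => ⟨hx, hx0, h⟩⟩

theorem isProperlyConvex_quarticDomain : IsProperlyConvex quarticDomain := by
  refine ⟨isOpen_quarticDomain, ⟨_, baseQuartic, baseQuartic_mem.1.ne_zero, baseQuartic_mem, rfl⟩,
    ?_⟩
  let φ : Module.Dual ℝ (Fin 5 → ℝ) :=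
    { toFun := fun c => 3 * c 0 + c 2 + 3 * c 4
      map_add' := fun c c' => by simp; ring
      map_smul' := fun t c => by simp; ring }
  have hφ : ∀ c ∈ closedMiddleCone, c ≠ 0 → 0 < φ c := by
    intro c hc h0
    by_cases hp : IsPositive (d := 4) c
    · have e := circleMean_eq c
      have h1 := hp ![1, 0] (by simp)
      have h2 := hp ![0, 1] (by simp)
      have h3 := hp ![1, 1] (by simp)
      have h4 := hp ![1, -1] (by simp)
      have : φ c = 8 * circleMean c := by simp [φ, circleMean]; ring
      rw [this, e]
      linarith
    · obtain ⟨u, hu, rfl⟩ := eq_linearPower_of_mem_closedMiddleCone hc h0 hp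
      have e : φ (linearPower 4 u) = 3 * (u 0 ^ 2 + u 1 ^ 2) ^ 2 := by
        simp [φ, linearPower_four]; ring
      rw [e]
      have : u 0 ^ 2 + u 1 ^ 2 ≠ 0 := by
        intro h0
        apply hu
        have h3 : u 0 = 0 := by nlinarith [sq_nonneg (u 0), sq_nonneg (u 1)]
        have h4 : u 1 = 0 := by nlinarith [sq_nonneg (u 0), sq_nonneg (u 1)]
        ext i; fin_cases i <;> simp [h3, h4]
      positivity
  have hsub : closure quarticDomain ⊆ affineChart φ := by
    intro p
    induction p using Projectivization.ind with
    | h c hc =>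
      rw [mk_mem_closure_quarticDomain, mk_mem_affineChart]
      rintro (h | h)
      · exact (hφ c h hc).ne'
      · have := hφ _ h (neg_ne_zero.2 hc)
        rw [map_neg] at this
        intro h0
        rw [h0] at this
        simp at this
  refine ⟨φ, hsub, ?_⟩
  have hsgn : ∀ c ∈ closedMiddleCone, c ≠ 0 → 0 < 1 * φ c := fun c hc h0 => by
    rw [one_mul]; exact hφ c hc h0
  intro x hx y hy a b ha hb hab
  have hxφ := hx.1
  have hyφ := hy.1
  rw [mem_affinePart_quarticDomain (Or.inl rfl) hsgn hxφ, one_smul] at hx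
  rw [mem_affinePart_quarticDomain (Or.inl rfl) hsgn hyφ, one_smul] at hy
  have h1 : φ (a • x + b • y) = 1 := by
    rw [map_add, map_smul, map_smul, hxφ, hyφ]; simpa using hab
  rw [mem_affinePart_quarticDomain (Or.inl rfl) hsgn h1, one_smul]
  rcases hb.eq_or_lt with rfl | hb
  · have : a = 1 := by simpa using hab
    simpa [this] using hx
  · exact closedMiddleCone_add_mem (smul_mem_closedMiddleCone (middleCone_subset hx) ha)
      (smul_mem_middleCone hy hb)

/-! ### Strict convexity -/

/-- The quartics of the closed cone on which `supportForm` vanishes form a ray. -/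
theorem eq_normalForm_of_supportForm_eq_zero {c : Fin 5 → ℝ} (hc : c ∈ closedMiddleCone)
    (h0 : c ≠ 0) (h : supportForm c ≤ 0) : ∃ k : ℝ, 0 < k ∧ c = normalForm (3 * k) (2 * k) := by
  by_cases hp : IsPositive (d := 4) c
  · obtain ⟨g, α, β, hβ, hβα, h3, rfl⟩ := exists_normalForm_of_mem_closedMiddleCone hc hp
    have h1 := supportForm_subst_ge (α := α) (β := β) (by rw [abs_of_nonneg hβ]; exact hβα.le) g
    rw [abs_of_nonneg hβ] at h1
    have e : 2 * α = 3 * β := by linarith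
    have hβ0 : 0 < β := by linarith
    refine ⟨β / 2, by linarith, ?_⟩
    rw [subst_normalForm_eq_of_supportForm_le hβ0 hβα g (by linarith)]
    congr 1 <;> linarith
  · obtain ⟨u, hu, rfl⟩ := eq_linearPower_of_mem_closedMiddleCone hc h0 hp
    exfalso
    rw [linearPower_four] at h
    simp [supportForm] at h
    apply hu
    have h1 : u 0 ^ 4 = 0 := by
      nlinarith [sq_nonneg (u 0 * u 1), sq_nonneg (u 0 ^ 2), sq_nonneg (u 1 ^ 2)]
    have h2 : u 1 ^ 4 = 0 := by
      nlinarith [sq_nonneg (u 0 * u 1), sq_nonneg (u 0 ^ 2), sq_nonneg (u 1 ^ 2)]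
    have h3 : u 0 = 0 := pow_eq_zero_iff (by norm_num) |>.1 h1
    have h4 : u 1 = 0 := pow_eq_zero_iff (by norm_num) |>.1 h2
    ext i; fin_cases i <;> simp [h3, h4]

/-- Two boundary points whose sum is on the boundary are proportional. -/
theorem proportional_of_add_notMem {x y : Fin 5 → ℝ} (hx : x ∈ closedMiddleCone)
    (hy : y ∈ closedMiddleCone) (hx0 : x ≠ 0) (hy0 : y ≠ 0) (h : x + y ∉ middleCone) :
    ∃ t : ℝ, x = t • y := by
  have hxy := closedMiddleCone_add hx hy
  by_cases hp : IsPositive (d := 4) (x + y)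
  · obtain ⟨g, α, β, hβ, hβα, h3, he⟩ := exists_normalForm_of_mem_closedMiddleCone hxy hp
    have h4 : 2 * α ≤ 3 * β := by
      by_contra hc
      push Not at hc
      apply h
      rw [he, subst_mem_middleCone_iff]
      apply normalForm_mem_middleCone
      rwa [abs_of_nonneg hβ]
    have hx' := subst_mem_closedMiddleCone hx g⁻¹
    have hy' := subst_mem_closedMiddleCone hy g⁻¹
    have hsum : supportForm (substMatrix 4 (g⁻¹).1 *ᵥ x) +
        supportForm (substMatrix 4 (g⁻¹).1 *ᵥ y) = 16 * α - 24 * β := by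
      rw [← supportForm_add, ← Matrix.mulVec_add, he, substMatrix_inv_mulVec,
        supportForm_normalForm]
    have hsx := hx'.2 1
    have hsy := hy'.2 1
    rw [Matrix.SpecialLinearGroup.coe_one, substMatrix_one, Matrix.one_mulVec] at hsx hsy
    have hne : ∀ z : Fin 5 → ℝ, z ≠ 0 → substMatrix 4 (g⁻¹).1 *ᵥ z ≠ 0 := fun z hz h0 => hz (by
      rw [← substMatrix_mulVec_inv g z, h0, Matrix.mulVec_zero])
    obtain ⟨k, hk, hkx⟩ := eq_normalForm_of_supportForm_eq_zero hx' (hne x hx0) (by linarith)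
    obtain ⟨l, hl, hly⟩ := eq_normalForm_of_supportForm_eq_zero hy' (hne y hy0) (by linarith)
    refine ⟨k / l, ?_⟩
    rw [← substMatrix_mulVec_inv g x, ← substMatrix_mulVec_inv g y, hkx, hly, ← Matrix.mulVec_smul,
      normalForm_smul]
    congr 2 <;> field_simp
  · have hpx : ¬ IsPositive (d := 4) x := fun h => hp fun v hv => by
      rw [binaryForm_add]; exact add_pos_of_pos_of_nonneg (h v hv) (hy.1 v)
    have hpy : ¬ IsPositive (d := 4) y := fun h => hp fun v hv => by
      rw [binaryForm_add]; exact add_pos_of_nonneg_of_pos (hx.1 v) (h v hv)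
    obtain ⟨u, hu, rfl⟩ := eq_linearPower_of_mem_closedMiddleCone hx hx0 hpx
    obtain ⟨w, hw, rfl⟩ := eq_linearPower_of_mem_closedMiddleCone hy hy0 hpy
    by_cases hd : u 0 * w 1 - u 1 * w 0 = 0
    · obtain ⟨t, ht⟩ : ∃ t : ℝ, u = t • w := by
        by_cases hw0 : w 0 = 0
        · have hw1 : w 1 ≠ 0 := fun h1 => hw (by ext i; fin_cases i <;> simp [hw0, h1])
          have hu0 : u 0 = 0 := by
            rw [hw0, mul_zero, sub_zero] at hd
            exact (mul_eq_zero.1 hd).resolve_right hw1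
          refine ⟨u 1 / w 1, ?_⟩
          ext i; fin_cases i
          · simp [hw0, hu0]
          · simp [hw1]
        · refine ⟨u 0 / w 0, ?_⟩
          ext i; fin_cases i
          · simp [hw0]
          · simp; field_simp; linarith
      exact ⟨t ^ 4, by rw [ht, linearPower_smul]⟩
    · exact absurd (linearPower_add_mem_middleCone hd) h

theorem hasStrictlyConvexBoundary_quarticDomain : HasStrictlyConvexBoundary quarticDomain := by
  intro φ hφ x hx y hy hseg
  obtain ⟨σ, hσ, hpos⟩ := exists_sign hφ
  have hm : (1 / 2 : ℝ) • x + (1 / 2 : ℝ) • y ∈ segment ℝ x y :=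
    ⟨1 / 2, 1 / 2, by norm_num, by norm_num, by norm_num, rfl⟩
  have hm' := hseg hm
  have hxφ := hx.1
  have hyφ := hy.1
  have hmφ := hm'.1
  have hx0 := ne_zero_of_map_eq_one hxφ
  have hy0 := ne_zero_of_map_eq_one hyφ
  have hσ0 : σ ≠ 0 := by rcases hσ with rfl | rfl <;> norm_num
  rw [mem_affinePart_frontier hσ hpos hxφ] at hx
  rw [mem_affinePart_frontier hσ hpos hyφ] at hy
  rw [mem_affinePart_frontier hσ hpos hmφ] at hm'
  obtain ⟨t, ht⟩ := proportional_of_add_notMem hx.1 hy.1 (smul_ne_zero hσ0 hx0)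
    (smul_ne_zero hσ0 hy0) fun hmem => hm'.2 (by
      have := smul_mem_middleCone hmem (t := 1 / 2) (by norm_num)
      convert this using 1
      simp only [smul_add]
      rw [smul_comm σ, smul_comm σ])
  rw [smul_comm] at ht
  have ht' := smul_right_injective _ hσ0 ht
  have h1 : t = 1 := by
    have := congrArg φ ht'
    rw [map_smul, hxφ, hyφ, smul_eq_mul, mul_one] at this
    exact this.symm
  rw [ht', h1, one_smul]

/-! ### Regularity of the boundary -/

/-- A maximum of linear forms over a compact set is `C¹` wherever the maximizer is unique. -/
theorem contDiffOn_max_of_unique {E : Type*} [NormedAddCommGroup E] [NormedSpace ℝ E]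
    {S : Set (E →L[ℝ] ℝ)} (hS : IsCompact S) {L : E → E →L[ℝ] ℝ} (hL : ∀ y, L y ∈ S)
    (hmax : ∀ y, ∀ l ∈ S, l y ≤ L y y) {U : Set E} (hU : IsOpen U)
    (huniq : ∀ y ∈ U, ∀ l ∈ S, (∀ l' ∈ S, l' y ≤ l y) → l = L y) :
    ContDiffOn ℝ 1 (fun y => L y y) U ∧ ∀ y ∈ U, fderiv ℝ (fun y => L y y) y = L y := by
  have hcont : ∀ y ∈ U, Tendsto L (𝓝 y) (𝓝 (L y)) := by
    intro y hy
    refine hS.tendsto_nhds_of_unique_mapClusterPt (Eventually.of_forall hL) fun l hl hcl => ?_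
    refine huniq y hy l hl fun l' hl' => ?_
    obtain ⟨F, hF, hFl⟩ := mapClusterPt_iff_ultrafilter.1 hcl
    have h1 : Tendsto (fun z => l' z) F (𝓝 (l' y)) := (l'.continuous.tendsto y).mono_left hF
    have h2 : Tendsto (fun z => L z z) F (𝓝 (l y)) :=
      (isBoundedBilinearMap_apply.continuous.tendsto (l, y)).comp
        (hFl.prodMk_nhds (tendsto_id.mono_left hF))
    exact le_of_tendsto_of_tendsto h1 h2 (Eventually.of_forall fun z => hmax z l' hl')
  have hder : ∀ y ∈ U, HasFDerivAt (fun y => L y y) (L y) y := by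
    intro y hy
    rw [hasFDerivAt_iff_isLittleO]
    have hb : ∀ z, ‖L z z - L y y - L y (z - y)‖ ≤ ‖L z - L y‖ * ‖z - y‖ := by
      intro z
      have h1 := hmax z (L y) (hL y)
      have h2 := hmax y (L z) (hL z)
      have h3 := (L z - L y).le_opNorm (z - y)
      rw [Real.norm_eq_abs, abs_le] at h3
      simp only [sub_apply, map_sub] at h3
      rw [Real.norm_eq_abs, abs_le, map_sub]
      constructor <;> linarith [norm_nonneg (L z - L y), norm_nonneg (z - y)]
    rw [Asymptotics.isLittleO_iff]
    intro ε hε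
    have h4 := (hcont y hy).eventually (Metric.ball_mem_nhds (L y) hε)
    filter_upwards [h4] with z hz
    rw [dist_eq_norm] at hz
    exact (hb z).trans (mul_le_mul_of_nonneg_right hz.le (norm_nonneg _))
  refine ⟨?_, fun y hy => (hder y hy).fderiv⟩
  rw [show (1 : WithTop ℕ∞) = 0 + 1 from (zero_add 1).symm, contDiffOn_succ_iff_fderiv_of_isOpen hU]
  refine ⟨fun y hy => (hder y hy).differentiableAt.differentiableWithinAt, by simp,
    contDiffOn_zero.2 fun y hy => ?_⟩
  refine ContinuousAt.continuousWithinAt ?_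
  have h5 : fderiv ℝ (fun y => L y y) =ᶠ[𝓝 y] L := by
    filter_upwards [hU.mem_nhds hy] with z hz using (hder z hz).fderiv
  rw [ContinuousAt, h5.self_of_nhds]
  exact (hcont y hy).congr' h5.symm

/-- A linear form in terms of its values on the monomials. -/
theorem linearMap_five_apply (l : (Fin 5 → ℝ) →ₗ[ℝ] ℝ) (c : Fin 5 → ℝ) :
    l c = c 0 * l (Pi.single 0 1) + c 1 * l (Pi.single 1 1) + c 2 * l (Pi.single 2 1)
      + c 3 * l (Pi.single 3 1) + c 4 * l (Pi.single 4 1) := by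
  have h := LinearMap.pi_apply_eq_sum_univ l c
  have e : ∀ i : Fin 5, (fun j : Fin 5 => if i = j then (1 : ℝ) else 0) = Pi.single i 1 :=
    fun i => by ext j; simp [Pi.single_apply, eq_comm]
  simp only [e] at h
  simpa [Fin.sum_univ_five] using h

/-- Substitution by an element of `SL₂(ℝ)` as a linear map. -/
noncomputable def substLin (g : SL(2, ℝ)) : (Fin 5 → ℝ) →ₗ[ℝ] (Fin 5 → ℝ) :=
  (substMatrix 4 g.1).mulVecLin

theorem substLin_apply (g : SL(2, ℝ)) (c : Fin 5 → ℝ) :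
    substLin g c = substMatrix 4 g.1 *ᵥ c := rfl

/-- The supporting linear forms at `x` are proportional. -/
def HasUniqueSupport (x : Fin 5 → ℝ) : Prop :=
  ∃ m : (Fin 5 → ℝ) →ₗ[ℝ] ℝ, ∀ l : (Fin 5 → ℝ) →ₗ[ℝ] ℝ,
    (∀ c ∈ closedMiddleCone, 0 ≤ l c) → l x = 0 → ∃ t : ℝ, l = t • m

theorem HasUniqueSupport.subst {x : Fin 5 → ℝ} (h : HasUniqueSupport x) (g : SL(2, ℝ)) :
    HasUniqueSupport (substMatrix 4 g.1 *ᵥ x) := by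
  obtain ⟨m, hm⟩ := h
  refine ⟨m ∘ₗ substLin g⁻¹, fun l hl hx => ?_⟩
  obtain ⟨t, ht⟩ := hm (l ∘ₗ substLin g) (fun c hc => hl _ (subst_mem_closedMiddleCone hc g)) hx
  refine ⟨t, LinearMap.ext fun c => ?_⟩
  have := LinearMap.congr_fun ht (substLin g⁻¹ c)
  simp only [LinearMap.comp_apply, LinearMap.smul_apply, substLin_apply] at this ⊢
  rwa [substMatrix_mulVec_inv] at this

/-- Uniqueness at the fourth power `x⁴`: nonnegativity on the other fourth powers and on the
boundary points `normalForm 3 2 ∘ diag (σ⁻¹, σ)`, which approach `x⁴` tangentially. -/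
theorem hasUniqueSupport_linearPower {u : Fin 2 → ℝ} (hu : u ≠ 0) :
    HasUniqueSupport (linearPower 4 u) := by
  obtain ⟨g, rfl⟩ := exists_slMk_column hu
  have e : linearPower 4 (g.1 *ᵥ ![1, 0]) =
      substMatrix 4 (g.transpose).1 *ᵥ linearPower 4 ![1, 0] := by
    rw [subst_linearPower, Matrix.SpecialLinearGroup.coe_transpose, Matrix.transpose_transpose]
  rw [e]
  refine HasUniqueSupport.subst ⟨LinearMap.proj 0, fun l hl hx => ?_⟩ _
  have h4 : l (Pi.single 4 1) = 0 := by
    rw [linearMap_five_apply l, linearPower_four] at hx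
    simpa using hx
  have hpow : ∀ t : ℝ, 0 ≤ 4 * l (Pi.single 3 1) * t + 6 * l (Pi.single 2 1) * t ^ 2
      + 4 * l (Pi.single 1 1) * t ^ 3 + l (Pi.single 0 1) * t ^ 4 := fun t => by
    have := hl _ (linearPower_mem_closedMiddleCone ![1, t])
    rw [linearMap_five_apply l, linearPower_four, h4] at this
    simp at this
    linarith
  have h3 : l (Pi.single 3 1) = 0 := by
    have := linear_coeff_eq_zero hpow
    linarith
  have h2 : l (Pi.single 2 1) ≤ 0 := by
    have key : ∀ σ : ℝ, 0 < σ → 6 * l (Pi.single 2 1) ≤ 5 * l (Pi.single 0 1) * σ ^ 4 := by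
      intro σ hσ
      obtain ⟨τ, hτ⟩ : ∃ τ : ℝ, τ * σ = 1 := ⟨σ⁻¹, inv_mul_cancel₀ hσ.ne'⟩
      have := hl _ (subst_mem_closedMiddleCone (normalForm_mem_closedMiddleCone (α := 3) (β := 2)
        (by norm_num) (by norm_num)) (slMk τ 0 0 σ (by linarith)))
      rw [slMk_val, linearMap_five_apply l, substMatrix_four_mulVec, h4, h3] at this
      simp [normalForm] at this
      have e : τ ^ 2 * σ ^ 2 = 1 := by rw [← mul_pow, hτ]; norm_num
      rw [e] at this
      linarith
    have hlim : Tendsto (fun σ : ℝ => 5 * l (Pi.single 0 1) * σ ^ 4) (𝓝[>] 0)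
        (𝓝 (5 * l (Pi.single 0 1) * 0 ^ 4)) :=
      (Continuous.tendsto (by fun_prop) 0).mono_left nhdsWithin_le_nhds
    have := ge_of_tendsto hlim (by filter_upwards [self_mem_nhdsWithin] with σ hσ using key σ hσ)
    simp at this
    linarith
  obtain ⟨h2', h1, -⟩ := quadratic_coeff_eq_zero (a := 6 * l (Pi.single 2 1))
    (b := 4 * l (Pi.single 1 1)) (c := l (Pi.single 0 1)) (fun t => by
      have := hl _ (linearPower_mem_closedMiddleCone ![t, 1])
      rw [linearMap_five_apply l, linearPower_four, h4, h3] at this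
      simp at this
      linarith) (by linarith)
  refine ⟨l (Pi.single 0 1), LinearMap.ext fun c => ?_⟩
  rw [linearMap_five_apply l, h4, h3, show l (Pi.single 2 1) = 0 by linarith,
    show l (Pi.single 1 1) = 0 by linarith]
  simp
  ring

/-- Uniqueness at `normalForm 3 2`: a supporting form vanishes on the tangent space of the orbit. -/
theorem hasUniqueSupport_normalForm : HasUniqueSupport (normalForm 3 2) := by
  have hmem := normalForm_mem_closedMiddleCone (α := 3) (β := 2) (by norm_num) (by norm_num)
  refine ⟨⟨⟨supportForm, supportForm_add⟩, supportForm_smul⟩, fun l hl hx => ?_⟩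
  have horb : ∀ g : SL(2, ℝ), 0 ≤ l (substMatrix 4 g.1 *ᵥ normalForm 3 2) := fun g =>
    hl _ (subst_mem_closedMiddleCone hmem g)
  have hx' := hx
  rw [linearMap_five_apply l] at hx'
  simp [normalForm] at hx'
  have hup := linear_coeff_eq_zero (a := 20 * l (Pi.single 3 1) - 12 * l (Pi.single 1 1))
    (b := 30 * l (Pi.single 2 1) - 6 * l (Pi.single 0 1)) (c := 20 * l (Pi.single 1 1))
    (d := 5 * l (Pi.single 0 1)) fun t => by
      have := horb (slMk 1 t 0 1 (by ring))
      rw [slMk_val, substMatrix_four_mulVec, linearMap_five_apply l] at this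
      simp [normalForm] at this
      linarith
  have hlow := linear_coeff_eq_zero (a := 20 * l (Pi.single 1 1) - 12 * l (Pi.single 3 1))
    (b := 30 * l (Pi.single 2 1) - 6 * l (Pi.single 4 1)) (c := 20 * l (Pi.single 3 1))
    (d := 5 * l (Pi.single 4 1)) fun t => by
      have := horb (slMk 1 0 t 1 (by ring))
      rw [slMk_val, substMatrix_four_mulVec, linearMap_five_apply l] at this
      simp [normalForm] at this
      linarith
  have hdiag : l (Pi.single 0 1) = l (Pi.single 4 1) := by
    refine eq_of_forall_le_exp fun t => ?_
    have := horb (slMk (Real.exp t) 0 0 (Real.exp (-t)) (by rw [← Real.exp_add]; simp))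
    rw [slMk_val, substMatrix_four_mulVec, linearMap_five_apply l] at this
    have e3 : Real.exp t ^ 2 * Real.exp (-t) ^ 2 = 1 := by
      rw [← mul_pow, ← Real.exp_add]; simp
    simp only [normalForm, Matrix.cons_val] at this
    simp only [e3] at this
    linarith
  refine ⟨l (Pi.single 0 1) / 3, LinearMap.ext fun c => ?_⟩
  rw [linearMap_five_apply l, show l (Pi.single 1 1) = 0 by linarith,
    show l (Pi.single 3 1) = 0 by linarith,
    show l (Pi.single 2 1) = 5 / 3 * l (Pi.single 0 1) by linarith, ← hdiag]
  simp [supportForm]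
  ring

theorem eq_zero_of_support_interior {x : Fin 5 → ℝ} (hx : x ∈ middleCone)
    {l : (Fin 5 → ℝ) →ₗ[ℝ] ℝ} (hl : ∀ c ∈ closedMiddleCone, 0 ≤ l c) (h0 : l x = 0) : l = 0 := by
  have key : ∀ v : Fin 5 → ℝ, 0 ≤ l v := by
    intro v
    have hlim : Tendsto (fun t : ℝ => x + t • v) (𝓝[>] 0) (𝓝 (x + (0 : ℝ) • v)) :=
      (Continuous.tendsto (by fun_prop) 0).mono_left nhdsWithin_le_nhds
    rw [zero_smul, add_zero] at hlim
    obtain ⟨t, ht, htm⟩ := ((hlim.eventually (isOpen_middleCone.mem_nhds hx)).and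
      (self_mem_nhdsWithin (s := Set.Ioi (0 : ℝ)))).exists
    have := hl _ (middleCone_subset ht)
    rw [map_add, map_smul, h0, zero_add, smul_eq_mul] at this
    exact nonneg_of_mul_nonneg_right this htm
  refine LinearMap.ext fun v => ?_
  have h1 := key v
  have h2 := key (-v)
  rw [map_neg] at h2
  simp only [LinearMap.zero_apply]
  linarith

theorem hasUniqueSupport_of_mem {x : Fin 5 → ℝ} (hx : x ∈ closedMiddleCone) (h0 : x ≠ 0) :
    HasUniqueSupport x := by
  by_cases hm : x ∈ middleCone
  · exact ⟨0, fun l hl hlx => ⟨0, by rw [eq_zero_of_support_interior hm hl hlx, smul_zero]⟩⟩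
  by_cases hp : IsPositive (d := 4) x
  · obtain ⟨g, α, β, hβ, hβα, h3, rfl⟩ := exists_normalForm_of_mem_closedMiddleCone hx hp
    refine HasUniqueSupport.subst ?_ g
    rw [subst_mem_middleCone_iff] at hm
    have h4 : 2 * α ≤ 3 * β := by
      by_contra hc
      exact hm (normalForm_mem_middleCone (by rw [abs_of_nonneg hβ]; linarith))
    obtain ⟨m, hm⟩ := hasUniqueSupport_normalForm
    refine ⟨m, fun l hl hlx => hm l hl ?_⟩
    have e : normalForm α β = (β / 2) • normalForm 3 2 := by
      rw [normalForm_smul]; congr 1 <;> linarith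
    rw [e, map_smul, smul_eq_mul] at hlx
    exact (mul_eq_zero.1 hlx).resolve_left (by linarith)
  · obtain ⟨u, hu, rfl⟩ := eq_linearPower_of_mem_closedMiddleCone hx h0 hp
    exact hasUniqueSupport_linearPower hu

/-- The linear forms which are nonpositive on the cone and equal to `-1` at the base point. -/
def normalizedForms : Set ((Fin 5 → ℝ) →L[ℝ] ℝ) :=
  {l | (∀ c ∈ middleCone, l c ≤ 0) ∧ l baseQuartic = -1}

theorem isCompact_normalizedForms : IsCompact normalizedForms := by
  have hclosed : IsClosed normalizedForms := by
    have e : normalizedForms = (⋂ c ∈ middleCone, {l : (Fin 5 → ℝ) →L[ℝ] ℝ | l c ≤ 0}) ∩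
        {l | l baseQuartic = -1} := by
      ext l; simp [normalizedForms]
    rw [e]
    refine (isClosed_biInter fun c _ => isClosed_le ?_ continuous_const).inter
      (isClosed_eq ?_ continuous_const) <;> fun_prop
  obtain ⟨r, hr, hball⟩ := Metric.isOpen_iff.1 isOpen_middleCone _ baseQuartic_mem
  refine Metric.isCompact_of_isClosed_isBounded hclosed
    ((Metric.isBounded_iff_subset_closedBall 0).2 ⟨2 / r, fun l hl => ?_⟩)
  rw [mem_closedBall_zero_iff]
  have key : ∀ v : Fin 5 → ℝ, l v ≤ 2 / r * ‖v‖ := by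
    intro v
    by_cases hv : v = 0
    · simp [hv]
    have hv' : 0 < ‖v‖ := norm_pos_iff.2 hv
    have h1 := hl.1 (baseQuartic + (r / (2 * ‖v‖)) • v) (hball (by
      rw [Metric.mem_ball, dist_eq_norm, add_sub_cancel_left, norm_smul, Real.norm_eq_abs,
        abs_of_pos (by positivity)]
      have : r / (2 * ‖v‖) * ‖v‖ = r / 2 := by field_simp
      linarith))
    rw [map_add, map_smul, hl.2, smul_eq_mul] at h1
    have h2 : l v = 2 / r * ‖v‖ * (r / (2 * ‖v‖) * l v) := by field_simp
    rw [h2]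
    have : 0 ≤ 2 / r * ‖v‖ := by positivity
    nlinarith
  refine l.opNorm_le_bound (by positivity) fun v => ?_
  rw [Real.norm_eq_abs, abs_le]
  have h1 := key v
  have h2 := key (-v)
  rw [map_neg, norm_neg] at h2
  constructor <;> linarith

theorem normalizedForms_nonpos {l : (Fin 5 → ℝ) →L[ℝ] ℝ} (hl : l ∈ normalizedForms)
    {c : Fin 5 → ℝ} (hc : c ∈ closedMiddleCone) : l c ≤ 0 := by
  rw [← closure_middleCone] at hc
  have : closure middleCone ⊆ {c | l c ≤ 0} :=
    (isClosed_le l.continuous continuous_const).closure_subset_iff.2 hl.1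
  exact this hc

/-- Normalizing a linear form which is positive on the open cone. -/
theorem exists_normalizedForm (m : (Fin 5 → ℝ) →ₗ[ℝ] ℝ) (hm : ∀ c ∈ middleCone, 0 < m c) :
    ∃ k : ℝ, 0 < k ∧ (-k) • m.toContinuousLinearMap ∈ normalizedForms := by
  have h0 := hm _ baseQuartic_mem
  refine ⟨(m baseQuartic)⁻¹, by positivity, fun c hc => ?_, ?_⟩
  · have := hm c hc
    have : 0 ≤ (m baseQuartic)⁻¹ * m c := by positivity
    simpa using this
  · simp [h0.ne']

/-- Evaluation at `v`, as a linear form on quartics. -/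
noncomputable def evalForm (v : Fin 2 → ℝ) : (Fin 5 → ℝ) →ₗ[ℝ] ℝ :=
  ⟨⟨fun c => binaryForm (d := 4) c v, fun c c' => binaryForm_add c c' v⟩,
    fun t c => binaryForm_const_smul t c v⟩

/-- The translates of `supportForm`, as linear maps. -/
noncomputable def supportLin (g : SL(2, ℝ)) : (Fin 5 → ℝ) →ₗ[ℝ] ℝ :=
  ⟨⟨fun c => supportForm (substMatrix 4 g.1 *ᵥ c), fun c c' => by
    rw [Matrix.mulVec_add, supportForm_add]⟩, fun t c => by
    simp only [Matrix.mulVec_smul, supportForm_smul, RingHom.id_apply, smul_eq_mul]⟩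

theorem mem_middleCone_of_normalizedForms {y : Fin 5 → ℝ}
    (h : ∀ l ∈ normalizedForms, l y < 0) : y ∈ middleCone := by
  have key : ∀ m : (Fin 5 → ℝ) →ₗ[ℝ] ℝ, (∀ c ∈ middleCone, 0 < m c) → 0 < m y := by
    intro m hm
    obtain ⟨k, hk, hl⟩ := exists_normalizedForm m hm
    have := h _ hl
    simp at this
    exact (mul_pos_iff_of_pos_left hk).1 this
  exact ⟨fun v hv => key (evalForm v) fun c hc => hc.1 v hv,
    fun g => key (supportLin g) fun c hc => hc.2 g⟩

theorem mem_closedMiddleCone_of_normalizedForms {y : Fin 5 → ℝ}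
    (h : ∀ l ∈ normalizedForms, l y ≤ 0) : y ∈ closedMiddleCone := by
  have key : ∀ m : (Fin 5 → ℝ) →ₗ[ℝ] ℝ, (∀ c ∈ middleCone, 0 < m c) → 0 ≤ m y := by
    intro m hm
    obtain ⟨k, hk, hl⟩ := exists_normalizedForm m hm
    have := h _ hl
    simp at this
    exact (mul_nonneg_iff_of_pos_left hk).1 this
  refine ⟨fun v => ?_, fun g => key (supportLin g) fun c hc => hc.2 g⟩
  by_cases hv : v = 0
  · rw [hv, binaryForm_zero_right (by norm_num)]
  · exact key (evalForm v) fun c hc => hc.1 v hv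

/-- The cone is the negative set of a function which is `C¹` away from a line. -/
theorem exists_defining_function : ∃ f : (Fin 5 → ℝ) → ℝ, (∀ y, y ∈ middleCone ↔ f y < 0) ∧
    ContDiffOn ℝ 1 f {y | y ∉ Submodule.span ℝ {baseQuartic}} ∧
    ∀ x ∈ closedMiddleCone, x ∉ middleCone →
      fderiv ℝ f x baseQuartic = -1 ∧ fderiv ℝ f x x = 0 ∨
        x ∈ Submodule.span ℝ {baseQuartic} := by
  have hne : normalizedForms.Nonempty := by
    obtain ⟨k, -, hk⟩ := exists_normalizedForm (supportLin 1) fun c hc => hc.2 1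
    exact ⟨_, hk⟩
  have hex : ∀ y : Fin 5 → ℝ, ∃ l ∈ normalizedForms, ∀ l' ∈ normalizedForms, l' y ≤ l y := by
    intro y
    have hc : Continuous fun l : (Fin 5 → ℝ) →L[ℝ] ℝ => l y := by fun_prop
    obtain ⟨l, hl, hmax⟩ := isCompact_normalizedForms.exists_isMaxOn hne hc.continuousOn
    exact ⟨l, hl, fun l' hl' => hmax hl'⟩
  choose L hL hmax using hex
  have hU : IsOpen {y : Fin 5 → ℝ | y ∉ Submodule.span ℝ {baseQuartic}} :=
    (Submodule.closed_of_finiteDimensional (Submodule.span ℝ {baseQuartic})).isOpen_compl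
  have huniq : ∀ y ∈ {y : Fin 5 → ℝ | y ∉ Submodule.span ℝ {baseQuartic}},
      ∀ l ∈ normalizedForms, (∀ l' ∈ normalizedForms, l' y ≤ l y) → l = L y := by
    intro y hy l hl hlmax
    have hval : l y = L y y := le_antisymm (hmax y l hl) (hlmax _ (hL y))
    -- the projection of `y` to the boundary along the base point
    set x := y + (L y y) • baseQuartic with hx
    have happ : ∀ l' ∈ normalizedForms, l' x = l' y - L y y := fun l' hl' => by
      rw [hx, map_add, map_smul, hl'.2, smul_eq_mul]; ring
    have hxm : x ∈ closedMiddleCone := mem_closedMiddleCone_of_normalizedForms fun l' hl' => by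
      rw [happ l' hl']; linarith [hmax y l' hl']
    have hx0 : x ≠ 0 := by
      intro h0
      apply hy
      rw [Submodule.mem_span_singleton]
      exact ⟨-L y y, by rw [neg_smul]; exact (eq_neg_of_add_eq_zero_left h0).symm⟩
    obtain ⟨m, hm⟩ := hasUniqueSupport_of_mem hxm hx0
    have hprop : ∀ l' ∈ normalizedForms, l' y = L y y →
        ∃ t : ℝ, -(l' : (Fin 5 → ℝ) →ₗ[ℝ] ℝ) = t • m := fun l' hl' h' => by
      refine hm _ (fun c hc => ?_) ?_
      · simpa using normalizedForms_nonpos hl' hc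
      · have := happ l' hl'
        rw [h', sub_self] at this
        simpa using this
    obtain ⟨t, ht⟩ := hprop l hl hval
    obtain ⟨s, hs⟩ := hprop _ (hL y) rfl
    have h1 := LinearMap.congr_fun ht baseQuartic
    have h2 := LinearMap.congr_fun hs baseQuartic
    simp only [LinearMap.neg_apply, ContinuousLinearMap.coe_coe, LinearMap.smul_apply,
      smul_eq_mul, hl.2, (hL y).2] at h1 h2
    have hts : t = s := by
      have h3 : m baseQuartic ≠ 0 := by
        intro h0; rw [h0] at h1; norm_num at h1
      exact mul_right_cancel₀ h3 (h1.symm.trans h2)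
    ext c
    have h3 := LinearMap.congr_fun ht c
    have h4 := LinearMap.congr_fun hs c
    rw [hts, ← h4] at h3
    simpa using h3
  obtain ⟨hC, hD⟩ := contDiffOn_max_of_unique isCompact_normalizedForms hL hmax hU huniq
  have hiff : ∀ y, y ∈ middleCone ↔ L y y < 0 := by
    intro y
    constructor
    · intro hy
      have hlim : Tendsto (fun t : ℝ => y - t • baseQuartic) (𝓝[>] 0)
          (𝓝 (y - (0 : ℝ) • baseQuartic)) :=
        (Continuous.tendsto (by fun_prop) 0).mono_left nhdsWithin_le_nhds
      rw [zero_smul, sub_zero] at hlim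
      obtain ⟨t, ht, htm⟩ := ((hlim.eventually (isOpen_middleCone.mem_nhds hy)).and
        (self_mem_nhdsWithin (s := Set.Ioi (0 : ℝ)))).exists
      have := (hL y).1 _ ht
      rw [map_sub, map_smul, (hL y).2, smul_eq_mul] at this
      have h0 : 0 < t := htm
      linarith
    · intro hy
      exact mem_middleCone_of_normalizedForms fun l hl => (hmax y l hl).trans_lt hy
  refine ⟨fun y => L y y, hiff, hC, fun x hx hxm => ?_⟩
  by_cases hsp : x ∈ Submodule.span ℝ {baseQuartic}
  · exact Or.inr hsp
  · left
    rw [hD x hsp]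
    refine ⟨(hL x).2, le_antisymm (normalizedForms_nonpos (hL x) hx) ?_⟩
    rw [hiff] at hxm
    exact not_lt.1 hxm

theorem hasC1Boundary_quarticDomain : HasC1Boundary quarticDomain := by
  intro φ hφ x hx
  obtain ⟨σ, hσ, hpos⟩ := exists_sign hφ
  obtain ⟨f, hf, hC, hd⟩ := exists_defining_function
  have hxφ := hx.1
  rw [mem_affinePart_frontier hσ hpos hxφ] at hx
  have hσ0 : σ ≠ 0 := by rcases hσ with rfl | rfl <;> norm_num
  have hspan : σ • x ∉ Submodule.span ℝ {baseQuartic} := by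
    intro h
    obtain ⟨t, ht⟩ := Submodule.mem_span_singleton.1 h
    have h1 := hpos _ hx.1 (smul_ne_zero hσ0 (ne_zero_of_map_eq_one hxφ))
    have h2 := hpos _ (middleCone_subset baseQuartic_mem) baseQuartic_mem.1.ne_zero
    rw [← ht, map_smul, smul_eq_mul, mul_left_comm] at h1
    apply hx.2
    rw [← ht]
    exact smul_mem_middleCone baseQuartic_mem (pos_of_mul_pos_left h1 h2.le)
  have hU : IsOpen {y : Fin 5 → ℝ | y ∉ Submodule.span ℝ {baseQuartic}} :=
    (Submodule.closed_of_finiteDimensional (Submodule.span ℝ {baseQuartic})).isOpen_compl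
  have hlin : ContDiff ℝ 1 fun y : Fin 5 → ℝ => σ • y := by fun_prop
  refine ⟨(fun y => σ • y) ⁻¹' {y | y ∉ Submodule.span ℝ {baseQuartic}},
    hU.preimage (by fun_prop), hspan, fun y => f (σ • y), ?_, ?_, ?_⟩
  · exact hC.comp hlin.contDiffOn fun y hy => hy
  · have hder : fderiv ℝ (fun y => f (σ • y)) x = σ • fderiv ℝ f (σ • x) := by
      have h1 : DifferentiableAt ℝ f (σ • x) :=
        (hC.contDiffAt (hU.mem_nhds hspan)).differentiableAt (by norm_num)
      have h2 : HasFDerivAt (fun y : Fin 5 → ℝ => σ • y)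
          (σ • ContinuousLinearMap.id ℝ (Fin 5 → ℝ)) x :=
        (hasFDerivAt_id x).const_smul σ
      have h3 : HasFDerivAt (fun y => f (σ • y)) _ x := h1.hasFDerivAt.comp x h2
      rw [h3.fderiv]
      ext v
      simp
    obtain ⟨h1, h2⟩ := (hd _ hx.1 hx.2).resolve_right hspan
    -- the base point moved into the direction of the chart
    refine ⟨baseQuartic - φ baseQuartic • x, by simp [hxφ], ?_⟩
    rw [map_smul, smul_eq_mul] at h2
    have h3 := (mul_eq_zero.1 h2).resolve_left hσ0
    rw [hder]
    simp [h1, h3, hσ0]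
  · intro y _ hy
    rw [mem_affinePart_quarticDomain hσ hpos hy, hf]

/-! ### Discreteness and orbits of positive forms -/

theorem finite_inter_slBox (Γ : Subgroup SL(2, ℝ)) [DiscreteTopology Γ] (R : ℝ) :
    {g : SL(2, ℝ) | g ∈ Γ ∧ ∀ i j, |g.1 i j| ≤ R}.Finite := by
  have h := Subgroup.tendsto_coe_cofinite_of_discrete Γ
  have h1 := h ⟨inferInstance⟩ (isCompact_slBox R).compl_mem_cocompact
  rw [mem_map, mem_cofinite] at h1
  refine (h1.image Subtype.val).subset ?_
  rintro g ⟨hg, hR⟩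
  exact ⟨⟨g, hg⟩, fun hn => hn hR, rfl⟩

theorem abs_entry_le {d : ℕ} (hd : d ≠ 0) {c : Fin (d + 1) → ℝ} {ε δ : ℝ}
    (h : ∀ v : Fin 2 → ℝ, ε * ‖v‖ ^ d ≤ binaryForm c v) (hε : 0 < ε)
    (A : Matrix (Fin 2) (Fin 2) ℝ) (hA : ∀ i, |(substMatrix d A *ᵥ c) i| ≤ δ) (i j : Fin 2) :
    |A i j| ≤ 1 + (d + 1) * δ / ε := by
  have hδ : 0 ≤ δ := (abs_nonneg _).trans (hA 0)
  have h1 := abs_entry_pow_le h hε A i j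
  have h2 := (le_abs_self _).trans (abs_binaryForm_le hA (Pi.single j 1))
  have h3 : ‖(Pi.single j 1 : Fin 2 → ℝ)‖ ≤ 1 := by
    rw [pi_norm_le_iff_of_nonneg zero_le_one]
    intro k
    rw [Pi.single_apply]
    split_ifs <;> simp
  have h4 : δ * ‖(Pi.single j 1 : Fin 2 → ℝ)‖ ^ d ≤ δ :=
    mul_le_of_le_one_right hδ (pow_le_one₀ (norm_nonneg _) h3)
  have h5 : |A i j| ^ d ≤ (d + 1) * δ / ε := by
    refine h1.trans (div_le_div_of_nonneg_right (h2.trans ?_) hε.le)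
    exact mul_le_mul_of_nonneg_left h4 (by positivity)
  by_cases h6 : |A i j| ≤ 1
  · have : 0 ≤ (d + 1) * δ / ε := by positivity
    linarith
  · have := le_self_pow₀ (not_le.1 h6).le hd
    linarith

/-- The image of a discrete subgroup under `ρ₄` is discrete. -/
theorem discreteTopology_map_rho (Γ : Subgroup SL(2, ℝ)) [DiscreteTopology Γ] :
    DiscreteTopology (Γ.map (rho 4)) := by
  obtain ⟨ε, hε, hle⟩ := baseQuartic_mem.1.exists_le
  set R := 1 + ((4 : ℕ) + 1 : ℝ) * 8 / ε with hR
  have hfin := (finite_inter_slBox Γ R).image fun g => rho 4 g⁻¹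
  set V : Set SL(5, ℝ) := {g | ∀ i j, |g.1 i j| < 2} with hV
  have hVo : IsOpen V := by
    have : V = ⋂ i, ⋂ j, {g : SL(5, ℝ) | |g.1 i j| < 2} := by ext; simp [hV]
    rw [this]
    refine isOpen_iInter_of_finite fun i => isOpen_iInter_of_finite fun j =>
      isOpen_lt ?_ continuous_const
    have h1 : Continuous fun g : SL(5, ℝ) => g.1 :=
      Matrix.SpecialLinearGroup.isClosedEmbedding_val.continuous
    exact (h1.matrix_elem i j).abs
  have hV1 : (1 : SL(5, ℝ)) ∈ V := fun i j => by
    rw [Matrix.SpecialLinearGroup.coe_one, Matrix.one_apply]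
    split_ifs <;> norm_num
  refine discreteTopology_of_isOpen_singleton_one ?_
  have hW : IsOpen (V \ (((fun g => rho 4 g⁻¹) '' {g | g ∈ Γ ∧ ∀ i j, |g.1 i j| ≤ R}) \ {1})) :=
    hVo.sdiff (hfin.subset Set.sdiff_subset).isClosed
  convert hW.preimage (continuous_subtype_val (p := fun g => g ∈ Γ.map (rho 4))) using 1
  ext ⟨x, hx⟩
  simp only [Set.mem_singleton_iff, Set.mem_preimage]
  constructor
  · intro h
    have h' : x = 1 := congrArg Subtype.val h
    subst h'
    exact ⟨hV1, fun h => h.2 rfl⟩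
  · rintro ⟨hxV, hn⟩
    by_contra hne
    apply hn
    refine ⟨?_, fun h => hne (Subtype.ext h)⟩
    obtain ⟨g, hg, rfl⟩ := hx
    refine ⟨g⁻¹, ⟨Γ.inv_mem hg, ?_⟩, by simp⟩
    refine abs_entry_le (by norm_num) hle hε _ fun i => ?_
    have h1 : ∀ j, |substMatrix 4 (g⁻¹).1 i j| < 2 := fun j => hxV i j
    have e : (substMatrix 4 (g⁻¹).1 *ᵥ baseQuartic) i =
        substMatrix 4 (g⁻¹).1 i 0 + 2 * substMatrix 4 (g⁻¹).1 i 2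
          + substMatrix 4 (g⁻¹).1 i 4 := by
      simp [Matrix.mulVec, dotProduct, Fin.sum_univ_five, baseQuartic, normalForm]
      ring
    rw [e]
    have a0 := h1 0
    have a2 := h1 2
    have a4 := h1 4
    rw [abs_lt] at a0 a2 a4
    rw [abs_le]
    constructor <;> linarith

/-- Discrete subgroups have closed orbits on positive forms. -/
theorem exists_eq_subst_of_tendsto {d : ℕ} (hd : d ≠ 0) (Γ : Subgroup SL(2, ℝ))
    [DiscreteTopology Γ] {c P : Fin (d + 1) → ℝ} (hc : IsPositive c) {γ : ℕ → SL(2, ℝ)}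
    (hγ : ∀ n, γ n ∈ Γ) (h : Tendsto (fun n => substMatrix d (γ n).1 *ᵥ c) atTop (𝓝 P)) :
    ∃ g ∈ Γ, P = substMatrix d g.1 *ᵥ c := by
  obtain ⟨ε, hε, hle⟩ := hc.exists_le
  obtain ⟨δ, hδ⟩ := (Metric.isBounded_range_of_tendsto _ h).exists_norm_le
  have hfin := (finite_inter_slBox Γ (1 + (d + 1) * δ / ε)).image
    fun g => substMatrix d g.1 *ᵥ c
  have hmem := hfin.isClosed.mem_of_tendsto h (Eventually.of_forall fun n =>
    ⟨γ n, ⟨hγ n, abs_entry_le hd hle hε _ fun i =>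
      (norm_le_pi_norm (substMatrix d (γ n).1 *ᵥ c) i).trans (hδ _ ⟨n, rfl⟩)⟩, rfl⟩)
  obtain ⟨g, ⟨hg, -⟩, rfl⟩ := hmem
  exact ⟨g, hg, rfl⟩

/-! ### Limit sets -/

theorem rho_smul_mk {d : ℕ} (g : SL(2, ℝ)) {c : Fin (d + 1) → ℝ} (hc : c ≠ 0) :
    ∃ h : substMatrix d (g⁻¹).1 *ᵥ c ≠ 0,
      rho d g • Projectivization.mk ℝ c hc = Projectivization.mk ℝ _ h :=
  ⟨mulVec_ne_zero_of_sl (rho d g) hc, rfl⟩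

theorem subst_ne_zero {d : ℕ} (g : SL(2, ℝ)) {c : Fin (d + 1) → ℝ} (hc : c ≠ 0) :
    substMatrix d g.1 *ᵥ c ≠ 0 := by
  obtain ⟨h, -⟩ := rho_smul_mk g⁻¹ hc
  rwa [inv_inv] at h

theorem mem_orbit_map_rho {d : ℕ} (Γ : Subgroup SL(2, ℝ)) {c v : Fin (d + 1) → ℝ} (hc : c ≠ 0)
    (hv : v ≠ 0) : Projectivization.mk ℝ v hv ∈
      MulAction.orbit (Γ.map (rho d)) (Projectivization.mk ℝ c hc) ↔
        ∃ g ∈ Γ, ∃ t : ℝ, t ≠ 0 ∧ v = t • (substMatrix d g.1 *ᵥ c) := by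
  constructor
  · rintro ⟨⟨_, g, hg, rfl⟩, hgv⟩
    obtain ⟨h, he⟩ := rho_smul_mk g hc
    have : Projectivization.mk ℝ v hv = Projectivization.mk ℝ _ h := by
      rw [← he]; exact hgv.symm
    obtain ⟨t, ht, htv⟩ := (mk_eq_mk_iff_exists _ _).1 this
    exact ⟨g⁻¹, Γ.inv_mem hg, t, ht, htv⟩
  · rintro ⟨g, hg, t, ht, htv⟩
    refine ⟨⟨rho d g⁻¹, g⁻¹, Γ.inv_mem hg, rfl⟩, ?_⟩
    obtain ⟨h, he⟩ := rho_smul_mk g⁻¹ hc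
    change rho d g⁻¹ • Projectivization.mk ℝ c hc = _
    rw [he]
    rw [mk_eq_mk_iff_exists]
    refine ⟨t⁻¹, inv_ne_zero ht, ?_⟩
    rw [htv, smul_smul, inv_mul_cancel₀ ht, one_smul, inv_inv]

/-- A limit point is the limit of a sequence of positive multiples of translates of a positive
form. -/
theorem exists_seq_of_mem_limitSet {d : ℕ} {Γ : Subgroup SL(2, ℝ)}
    {Ω : Set (ℙ ℝ (Fin (d + 1) → ℝ))}
    (hΩ : ∀ q ∈ Ω, ∃ (c : Fin (d + 1) → ℝ) (hc : c ≠ 0), IsPositive c ∧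
      q = Projectivization.mk ℝ c hc) {p : ℙ ℝ (Fin (d + 1) → ℝ)}
    (hp : p ∈ limitSet Ω (Γ.map (rho d))) :
    ∃ (c P : Fin (d + 1) → ℝ) (hP : P ≠ 0), IsPositive c ∧ p = Projectivization.mk ℝ P hP ∧
      (∃ hc : c ≠ 0, Projectivization.mk ℝ c hc ∈ Ω) ∧
      (∀ g ∈ Γ, ∀ t : ℝ, P ≠ t • (substMatrix d g.1 *ᵥ c)) ∧
      ∃ (t : ℕ → ℝ) (γ : ℕ → SL(2, ℝ)), (∀ n, 0 < t n) ∧ (∀ n, γ n ∈ Γ) ∧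
        Tendsto (fun n => t n • (substMatrix d (γ n).1 *ᵥ c)) atTop (𝓝 P) := by
  obtain ⟨x, hx, hcl, hno⟩ := hp
  obtain ⟨c, hc0, hc, rfl⟩ := hΩ x hx
  induction p using Projectivization.ind with
  | h P0 hP0 =>
  rw [mk_mem_closure_iff] at hcl
  rw [mem_orbit_map_rho Γ hc0 hP0] at hno
  set S : Set (Fin (d + 1) → ℝ) :=
    {v | ∃ t : ℝ, 0 < t ∧ ∃ g ∈ Γ, v = t • (substMatrix d g.1 *ᵥ c)} with hS
  have hsub : coneOver (MulAction.orbit (Γ.map (rho d)) (Projectivization.mk ℝ c hc0)) ⊆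
      S ∪ -S := by
    rintro v ⟨hv, hvo⟩
    obtain ⟨g, hg, t, ht, htv⟩ := (mem_orbit_map_rho Γ hc0 hv).1 hvo
    rcases lt_or_gt_of_ne ht with h0 | h0
    · exact Or.inr ⟨-t, by linarith, g, hg, by rw [htv, neg_smul]⟩
    · exact Or.inl ⟨t, h0, g, hg, htv⟩
  have hcl' := closure_mono hsub hcl
  rw [closure_union] at hcl'
  have hneg : closure (-S) = -closure S :=
    ((Homeomorph.neg (Fin (d + 1) → ℝ)).preimage_closure S).symm
  rw [hneg] at hcl'
  obtain ⟨P, hP, he, hPS⟩ : ∃ (P : Fin (d + 1) → ℝ), P ≠ 0 ∧ (P = P0 ∨ P = -P0) ∧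
      P ∈ closure S := by
    rcases hcl' with h | h
    · exact ⟨P0, hP0, Or.inl rfl, h⟩
    · exact ⟨-P0, neg_ne_zero.2 hP0, Or.inr rfl, h⟩
  have hPP : Projectivization.mk ℝ P0 hP0 = Projectivization.mk ℝ P hP := by
    rw [mk_eq_mk_iff_exists]
    rcases he with rfl | rfl
    · exact ⟨1, one_ne_zero, by simp⟩
    · exact ⟨-1, by norm_num, by simp⟩
  obtain ⟨x, hxS, hxP⟩ := mem_closure_iff_seq_limit.1 hPS
  choose t ht γ hγ hx' using hxS
  refine ⟨c, P, hP, hc, hPP, ⟨hc0, hx⟩, fun g hg s hs => ?_, t, γ, ht, hγ, ?_⟩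
  · have hs0 : s ≠ 0 := fun h0 => hP (by rw [hs, h0, zero_smul])
    apply hno
    rcases he with rfl | rfl
    · exact ⟨g, hg, s, hs0, hs⟩
    · exact ⟨g, hg, -s, neg_ne_zero.2 hs0, by rw [neg_smul, ← hs, neg_neg]⟩
  · exact hxP.congr hx'

/-- A quadratic invariant which is positive on positive forms detects that limit points are
not positive, and that the multiplicative factors tend to zero on its zero set. -/
theorem limit_not_isPositive {d : ℕ} (hd : d ≠ 0) {Γ : Subgroup SL(2, ℝ)} [DiscreteTopology Γ]
    {Q : (Fin (d + 1) → ℝ) → ℝ} (hQc : Continuous Q) (hQs : ∀ t c, Q (t • c) = t ^ 2 * Q c)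
    (hQi : ∀ (g : SL(2, ℝ)) c, Q (substMatrix d g.1 *ᵥ c) = Q c)
    {c P : Fin (d + 1) → ℝ} (hc : IsPositive c) (hQ : 0 < Q c)
    (hP : ∀ g ∈ Γ, ∀ t : ℝ, P ≠ t • (substMatrix d g.1 *ᵥ c)) {t : ℕ → ℝ} {γ : ℕ → SL(2, ℝ)}
    (ht : ∀ n, 0 < t n) (hγ : ∀ n, γ n ∈ Γ)
    (hlim : Tendsto (fun n => t n • (substMatrix d (γ n).1 *ᵥ c)) atTop (𝓝 P)) :
    Q P = 0 ∧ Tendsto t atTop (𝓝 0) := by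
  have h1 : Tendsto (fun n => t n ^ 2 * Q c) atTop (𝓝 (Q P)) := by
    have := (hQc.tendsto P).comp hlim
    refine this.congr fun n => ?_
    rw [Function.comp_apply, hQs, hQi]
  have h2 : Tendsto (fun n => t n ^ 2) atTop (𝓝 (Q P / Q c)) := by
    have := h1.div_const (Q c)
    refine this.congr fun n => ?_
    field_simp
  have h3 : Tendsto t atTop (𝓝 (√(Q P / Q c))) := by
    have := (Real.continuous_sqrt.tendsto _).comp h2
    refine this.congr fun n => ?_
    rw [Function.comp_apply, Real.sqrt_sq (ht n).le]
  have h4 : 0 ≤ Q P / Q c := ge_of_tendsto' h2 fun n => sq_nonneg _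
  rcases h4.eq_or_lt with h5 | h5
  · rw [← h5, Real.sqrt_zero] at h3
    exact ⟨(div_eq_zero_iff.1 h5.symm).resolve_right hQ.ne', h3⟩
  · exfalso
    set s := √(Q P / Q c) with hs
    have hs0 : 0 < s := Real.sqrt_pos.2 h5
    have h6 : Tendsto (fun n => substMatrix d (γ n).1 *ᵥ c) atTop (𝓝 (s⁻¹ • P)) := by
      have := (h3.inv₀ hs0.ne').smul hlim
      refine this.congr fun n => ?_
      rw [smul_smul, inv_mul_cancel₀ (ht n).ne', one_smul]
    obtain ⟨g, hg, he⟩ := exists_eq_subst_of_tendsto hd Γ hc hγ h6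
    refine hP g hg s ?_
    rw [← he, smul_smul, mul_inv_cancel₀ hs0.ne', one_smul]

/-- The quadratic invariant of binary quartics. -/
noncomputable def invI (c : Fin 5 → ℝ) : ℝ := c 0 * c 4 - c 1 * c 3 / 4 + c 2 ^ 2 / 12

/-- The cubic invariant of binary quartics, the Hankel determinant. -/
noncomputable def invJ (c : Fin 5 → ℝ) : ℝ :=
  c 0 * c 2 * c 4 / 6 + c 1 * c 2 * c 3 / 48 - c 0 * c 3 ^ 2 / 16 - c 1 ^ 2 * c 4 / 16
    - c 2 ^ 3 / 216

theorem invI_subst (p q r s : ℝ) (c : Fin 5 → ℝ) :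
    invI (substMatrix 4 !![p, q; r, s] *ᵥ c) = (p * s - q * r) ^ 4 * invI c := by
  rw [substMatrix_four_mulVec]
  simp [invI]
  ring

theorem invJ_subst (p q r s : ℝ) (c : Fin 5 → ℝ) :
    invJ (substMatrix 4 !![p, q; r, s] *ᵥ c) = (p * s - q * r) ^ 6 * invJ c := by
  rw [substMatrix_four_mulVec]
  simp [invJ]
  ring

theorem invI_subst_sl (g : SL(2, ℝ)) (c : Fin 5 → ℝ) : invI (substMatrix 4 g.1 *ᵥ c) = invI c := by
  obtain ⟨p, q, r, s, hd, rfl⟩ := exists_eq_slMk g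
  rw [slMk_val, invI_subst, hd]
  ring

theorem invI_pos {c : Fin 5 → ℝ} (hc : IsPositive (d := 4) c) : 0 < invI c := by
  obtain ⟨g, α, β, h0, h1, rfl⟩ := hc.exists_normalForm
  rw [invI_subst_sl]
  have e : invI (normalForm α β) = 4 / 3 * α ^ 2 + 4 * β ^ 2 := by
    simp [invI, normalForm]; ring
  rw [e]
  have : 0 < α := by linarith
  positivity

/-- The discriminant of binary quadratic forms. -/
noncomputable def quadDisc (c : Fin 3 → ℝ) : ℝ := c 0 * c 2 - c 1 ^ 2 / 4

theorem quadDisc_subst_sl (g : SL(2, ℝ)) (c : Fin 3 → ℝ) :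
    quadDisc (substMatrix 2 g.1 *ᵥ c) = quadDisc c := by
  obtain ⟨p, q, r, s, hd, rfl⟩ := exists_eq_slMk g
  rw [slMk_val, substMatrix_two_mulVec]
  have h2 : (p * s - q * r) ^ 2 = 1 := by rw [hd]; norm_num
  simp [quadDisc]
  linear_combination (c 0 * c 2 - c 1 ^ 2 / 4) * h2

theorem quadDisc_pos {c : Fin 3 → ℝ} (hc : IsPositive (d := 2) c) : 0 < quadDisc c := by
  have h1 := hc ![1, 0] (by simp)
  have h2 := hc ![-c 1, 2 * c 2] (by
    intro h
    have := congrFun h 1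
    rw [binaryForm_two] at h1
    simp at this h1
    linarith)
  rw [binaryForm_two] at h1 h2
  simp at h1 h2
  have : 0 < 4 * c 2 * quadDisc c := by rw [quadDisc]; nlinarith
  exact pos_of_mul_pos_right this (by linarith)

theorem mem_hyperbolicPlane {q : ℙ ℝ (Fin 3 → ℝ)} (hq : q ∈ hyperbolicPlane) :
    ∃ (c : Fin (2 + 1) → ℝ) (hc : c ≠ 0), IsPositive c ∧ q = Projectivization.mk ℝ c hc := by
  obtain ⟨c, hc, he, hp⟩ := hq
  exact ⟨c, hc, hp, he⟩

theorem mem_quarticDomain_pos {q : ℙ ℝ (Fin 5 → ℝ)} (hq : q ∈ quarticDomain) :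
    ∃ (c : Fin (4 + 1) → ℝ) (hc : c ≠ 0), IsPositive c ∧ q = Projectivization.mk ℝ c hc := by
  obtain ⟨c, hc, hp, he⟩ := hq
  exact ⟨c, hc, hp.1, he⟩

/-- A nonnegative quadratic form with a nontrivial zero is a multiple of a square. -/
theorem eq_smul_linearPower_two {c : Fin 3 → ℝ} (hc : ∀ v, 0 ≤ binaryForm (d := 2) c v)
    {u : Fin 2 → ℝ} (hu : u ≠ 0) (h0 : binaryForm (d := 2) c ![u 1, -u 0] = 0) :
    ∃ k : ℝ, c = k • linearPower 2 u := by
  have hn : u 0 ^ 2 + u 1 ^ 2 ≠ 0 := by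
    intro h0
    apply hu
    have h3 : u 0 = 0 := by nlinarith [sq_nonneg (u 0), sq_nonneg (u 1)]
    have h4 : u 1 = 0 := by nlinarith [sq_nonneg (u 0), sq_nonneg (u 1)]
    ext i; fin_cases i <;> simp [h3, h4]
  have h0' := h0
  rw [binaryForm_two] at h0'
  simp at h0'
  have h1 : 2 * c 2 * u 1 - c 1 * u 0 = 0 :=
    linear_coeff_eq_zero (b := c 2) (c := 0) (d := 0) fun t => by
      have := hc ![u 1 + t, -u 0]
      rw [binaryForm_two] at this
      simp at this
      nlinarith
  have h2 : c 1 * u 1 - 2 * c 0 * u 0 = 0 :=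
    linear_coeff_eq_zero (b := c 0) (c := 0) (d := 0) fun t => by
      have := hc ![u 1, -u 0 + t]
      rw [binaryForm_two] at this
      simp at this
      nlinarith
  refine ⟨(c 0 + c 2) / (u 0 ^ 2 + u 1 ^ 2), ?_⟩
  rw [linearPower_two]
  ext i
  fin_cases i
  · simp
    field_simp
    linear_combination (-u 0 / 2) * h2 - (u 1 / 2) * h1
  · simp
    field_simp
    linear_combination u 1 * h2 - u 0 * h1
  · simp
    field_simp
    linear_combination (u 0 / 2) * h2 + (u 1 / 2) * h1

/-- The quadratic form `x² + y²`. -/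
def baseQuadratic : Fin 3 → ℝ := ![1, 0, 1]

theorem isPositive_baseQuadratic : IsPositive (d := 2) baseQuadratic := by
  intro v hv
  rw [binaryForm_two]
  simp [baseQuadratic]
  by_contra hc
  apply hv
  have h3 : v 0 = 0 := by nlinarith [sq_nonneg (v 0), sq_nonneg (v 1)]
  have h4 : v 1 = 0 := by nlinarith [sq_nonneg (v 0), sq_nonneg (v 1)]
  ext i; fin_cases i <;> simp [h3, h4]

/-- A limit point in the quartic domain is a fourth power of a linear form, and the square of that
linear form is a limit point in the hyperbolic plane: the fourth power dominates
`(x² + y²)²` along the sequence. -/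
theorem limitSet_quarticDomain {Γ : Subgroup SL(2, ℝ)} [DiscreteTopology Γ]
    {p : ℙ ℝ (Fin 5 → ℝ)} (hp : p ∈ limitSet quarticDomain (Γ.map (rho 4))) :
    ∃ (u : Fin 2 → ℝ) (hu : u ≠ 0), p = Projectivization.mk ℝ _ (linearPower_ne_zero (d := 4) hu) ∧
      Projectivization.mk ℝ _ (linearPower_ne_zero (d := 2) hu) ∈
        limitSet hyperbolicPlane (Γ.map (rho 2)) := by
  obtain ⟨c, P, hP, hc, rfl, ⟨hc0, hcΩ⟩, hno, t, γ, ht, hγ, hlim⟩ :=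
    exists_seq_of_mem_limitSet (d := 4) (fun q hq => mem_quarticDomain_pos hq) hp
  have hcK : c ∈ middleCone := by
    refine ((mk_mem_quarticDomain hc0).1 hcΩ).resolve_right fun h => ?_
    exact hc0 (eq_zero_of_nonneg_of_neg_nonneg (IsPositive.nonneg hc) (IsPositive.nonneg h.1))
  have hPmem : P ∈ closedMiddleCone := isClosed_closedMiddleCone.mem_of_tendsto hlim
    (Eventually.of_forall fun n => middleCone_subset
      (smul_mem_middleCone (subst_mem_middleCone hcK (γ n)) (ht n)))
  have hPnot : ¬ IsPositive (d := 4) P := fun hPp => by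
    have := (limit_not_isPositive (d := 4) (by norm_num) (Q := invI) (by unfold invI; fun_prop)
      (fun t c => by simp [invI]; ring) invI_subst_sl hc (invI_pos hc) hno ht hγ hlim).1
    exact (invI_pos hPp).ne' this
  obtain ⟨u, hu, rfl⟩ := eq_linearPower_of_mem_closedMiddleCone hPmem hP hPnot
  refine ⟨u, hu, rfl, ?_⟩
  obtain ⟨ε, hε, hle⟩ := hc.exists_le
  have hpt : ∀ v : Fin 2 → ℝ, Tendsto (fun n => t n * binaryForm (d := 4) c ((γ n).1 *ᵥ v)) atTop
      (𝓝 ((u 0 * v 0 + u 1 * v 1) ^ 4)) := fun v => by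
    have := ((continuous_binaryForm_coeff (d := 4) v).tendsto _).comp hlim
    rw [binaryForm_linearPower] at this
    refine this.congr fun n => ?_
    rw [Function.comp_apply, binaryForm_const_smul, binaryForm_subst]
  set q : ℕ → Fin 3 → ℝ := fun n => √(t n) • (substMatrix 2 (γ n).1 *ᵥ baseQuadratic) with hq
  have hqv : ∀ n v, binaryForm (d := 2) (q n) v =
      √(t n) * binaryForm (d := 2) baseQuadratic ((γ n).1 *ᵥ v) := fun n v => by
    rw [hq, binaryForm_const_smul, binaryForm_subst]
  have hbase : ∀ v : Fin 2 → ℝ, binaryForm (d := 2) baseQuadratic v = v 0 ^ 2 + v 1 ^ 2 :=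
    fun v => by rw [binaryForm_two]; simp [baseQuadratic]; ring
  have hq0 : ∀ n v, 0 ≤ binaryForm (d := 2) (q n) v := fun n v => by
    rw [hqv, hbase]; positivity
  have hbase2 : ∀ v : Fin 2 → ℝ, v 0 ^ 2 + v 1 ^ 2 ≤ 2 * ‖v‖ ^ 2 := fun v => by
    have h0 : |v 0| ≤ ‖v‖ := norm_le_pi_norm v 0
    have h1 : |v 1| ≤ ‖v‖ := norm_le_pi_norm v 1
    have := pow_le_pow_left₀ (abs_nonneg _) h0 2
    have := pow_le_pow_left₀ (abs_nonneg _) h1 2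
    rw [sq_abs] at *
    linarith
  have hup : ∀ n v, binaryForm (d := 2) (q n) v ^ 2 ≤
      4 / ε * (t n * binaryForm (d := 4) c ((γ n).1 *ᵥ v)) := fun n v => by
    rw [hqv, mul_pow, Real.sq_sqrt (ht n).le, hbase]
    have h1 := pow_le_pow_left₀ (by positivity) (hbase2 ((γ n).1 *ᵥ v)) 2
    have h2 := hle ((γ n).1 *ᵥ v)
    have h3 : (((γ n).1 *ᵥ v) 0 ^ 2 + ((γ n).1 *ᵥ v) 1 ^ 2) ^ 2 ≤
        4 / ε * binaryForm (d := 4) c ((γ n).1 *ᵥ v) := by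
      rw [div_mul_eq_mul_div, le_div_iff₀ hε]
      nlinarith
    have := mul_le_mul_of_nonneg_left h3 (ht n).le
    linarith
  obtain ⟨C, hC⟩ : ∃ C, ∀ i, |c i| ≤ C := ⟨‖c‖, fun i => norm_le_pi_norm c i⟩
  have hlow : ∀ n v, t n * binaryForm (d := 4) c ((γ n).1 *ᵥ v) ≤
      5 * C * binaryForm (d := 2) (q n) v ^ 2 := fun n v => by
    rw [hqv, mul_pow, Real.sq_sqrt (ht n).le, hbase]
    have h1 := (le_abs_self _).trans (abs_binaryForm_le hC ((γ n).1 *ᵥ v))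
    have h2 := pow_le_pow_left₀ (by positivity) (norm_sq_le ((γ n).1 *ᵥ v)) 2
    have h3 := mul_le_mul_of_nonneg_left h2 ((abs_nonneg _).trans (hC 0))
    push_cast at h1
    have h4 : binaryForm (d := 4) c ((γ n).1 *ᵥ v) ≤
        5 * C * (((γ n).1 *ᵥ v) 0 ^ 2 + ((γ n).1 *ᵥ v) 1 ^ 2) ^ 2 := by nlinarith
    have := mul_le_mul_of_nonneg_left h4 (ht n).le
    linarith
  -- the quadratic forms stay bounded
  have hbd : ∀ v : Fin 2 → ℝ, ∃ M, ∀ n, |binaryForm (d := 2) (q n) v| ≤ M := fun v => by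
    obtain ⟨M, hM⟩ := (Metric.isBounded_range_of_tendsto _ (hpt v)).exists_norm_le
    have hM0 : 0 ≤ M := (norm_nonneg _).trans (hM _ ⟨0, rfl⟩)
    refine ⟨√(4 / ε * M), fun n => Real.abs_le_sqrt ((hup n v).trans ?_)⟩
    exact mul_le_mul_of_nonneg_left ((le_abs_self _).trans (hM _ ⟨n, rfl⟩)) (by positivity)
  obtain ⟨M1, hM1⟩ := hbd ![1, 0]
  obtain ⟨M2, hM2⟩ := hbd ![0, 1]
  obtain ⟨M3, hM3⟩ := hbd ![1, 1]
  have hM1' : 0 ≤ M1 := (abs_nonneg _).trans (hM1 0)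
  have hM2' : 0 ≤ M2 := (abs_nonneg _).trans (hM2 0)
  have hM3' : 0 ≤ M3 := (abs_nonneg _).trans (hM3 0)
  have hqb : ∀ n, q n ∈ Metric.closedBall (0 : Fin 3 → ℝ) (M1 + M2 + M3) := fun n => by
    rw [mem_closedBall_zero_iff, pi_norm_le_iff_of_nonneg (by positivity)]
    have h1 := hM1 n
    have h2 := hM2 n
    have h3 := hM3 n
    rw [binaryForm_two] at h1 h2 h3
    simp at h1 h2 h3
    rw [abs_le] at h1 h2 h3
    intro i
    rw [Real.norm_eq_abs, abs_le]
    fin_cases i <;> constructor <;> simp <;> linarith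
  obtain ⟨Q, -, φ, hφ, hQ⟩ := tendsto_subseq_of_bounded Metric.isBounded_closedBall hqb
  have hQv : ∀ v, Tendsto (fun n => binaryForm (d := 2) (q (φ n)) v) atTop
      (𝓝 (binaryForm (d := 2) Q v)) := fun v =>
    ((continuous_binaryForm_coeff (d := 2) v).tendsto _).comp hQ
  have hQ0 : ∀ v, 0 ≤ binaryForm (d := 2) Q v := fun v =>
    ge_of_tendsto' (hQv v) fun n => hq0 _ _
  have hptφ := fun v => (hpt v).comp hφ.tendsto_atTop
  have hQz : binaryForm (d := 2) Q ![u 1, -u 0] = 0 := by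
    have h1 := le_of_tendsto_of_tendsto' ((hQv ![u 1, -u 0]).pow 2)
      ((hptφ ![u 1, -u 0]).const_mul (4 / ε)) fun n => hup (φ n) _
    have e : u 0 * ![u 1, -u 0] 0 + u 1 * ![u 1, -u 0] 1 = 0 := by simp; ring
    rw [e] at h1
    have h2 : binaryForm (d := 2) Q ![u 1, -u 0] ^ 2 ≤ 0 := by simpa using h1
    exact pow_eq_zero_iff two_ne_zero |>.1 (le_antisymm h2 (sq_nonneg _))
  obtain ⟨k, hk⟩ := eq_smul_linearPower_two hQ0 hu hQz
  have hk0 : k ≠ 0 := by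
    rintro rfl
    have h1 := le_of_tendsto_of_tendsto' (hptφ u) (((hQv u).pow 2).const_mul (5 * C))
      fun n => hlow (φ n) _
    rw [hk, zero_smul] at h1
    have e : binaryForm (d := 2) 0 u = 0 := by simp [binaryForm]
    rw [e] at h1
    have h2 : (u 0 * u 0 + u 1 * u 1) ^ 4 ≤ 0 := by simpa using h1
    have h3 : u 0 * u 0 + u 1 * u 1 = 0 :=
      pow_eq_zero_iff (by norm_num) |>.1 (le_antisymm h2 (by positivity))
    apply hu
    have h3 : u 0 = 0 := by nlinarith [mul_self_nonneg (u 0), mul_self_nonneg (u 1)]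
    have h4 : u 1 = 0 := by nlinarith [mul_self_nonneg (u 0), mul_self_nonneg (u 1)]
    ext i; fin_cases i <;> simp [h3, h4]
  have hb0 : baseQuadratic ≠ 0 := isPositive_baseQuadratic.ne_zero (d := 2)
  refine ⟨Projectivization.mk ℝ baseQuadratic hb0,
    ⟨_, hb0, rfl, isPositive_baseQuadratic⟩, ?_, ?_⟩
  · rw [mk_mem_closure_iff]
    have hlim2 : Tendsto (fun n => k⁻¹ • q (φ n)) atTop (𝓝 (linearPower 2 u)) := by
      have := hQ.const_smul k⁻¹
      rw [hk, smul_smul, inv_mul_cancel₀ hk0, one_smul] at this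
      exact this
    refine mem_closure_of_tendsto hlim2 (Eventually.of_forall fun n => ?_)
    have hsq : √(t (φ n)) ≠ 0 := (Real.sqrt_pos.2 (ht _)).ne'
    have hne : k⁻¹ • q (φ n) ≠ 0 :=
      smul_ne_zero (inv_ne_zero hk0) (smul_ne_zero hsq (subst_ne_zero (d := 2) _ hb0))
    refine ⟨hne, (mem_orbit_map_rho (d := 2) Γ hb0 hne).2 ⟨γ (φ n), hγ _, k⁻¹ * √(t (φ n)),
      mul_ne_zero (inv_ne_zero hk0) hsq, ?_⟩⟩
    rw [hq, smul_smul]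
  · rw [mem_orbit_map_rho (d := 2)]
    rintro ⟨g, -, s, hs, he⟩
    have h1 := binaryForm_linearPower 2 u ![u 1, -u 0]
    have e : u 0 * ![u 1, -u 0] 0 + u 1 * ![u 1, -u 0] 1 = 0 := by simp; ring
    rw [e, he, binaryForm_const_smul] at h1
    have hw : (![u 1, -u 0] : Fin 2 → ℝ) ≠ 0 := by
      intro h0
      apply hu
      have h1 := congrFun h0 0
      have h2 := congrFun h0 1
      simp at h1 h2
      ext i; fin_cases i <;> simp [h1, h2]
    have h2 := IsPositive.subst (d := 2) isPositive_baseQuadratic g _ hw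
    rw [zero_pow two_ne_zero] at h1
    rcases mul_eq_zero.1 h1 with h3 | h3
    · exact hs h3
    · exact h2.ne' h3

/-! ### Convex cores -/

section Invariance

variable {m : ℕ} {Ω : Set (ℙ ℝ (Fin m → ℝ))} {Γ : Subgroup SL(m, ℝ)}

theorem smul_mem_limitSet {g : SL(m, ℝ)} (hg : g ∈ Γ) {p : ℙ ℝ (Fin m → ℝ)}
    (hp : p ∈ limitSet Ω Γ) : g • p ∈ limitSet Ω Γ := by
  obtain ⟨x, hx, hcl, hno⟩ := hp
  have horb : ∀ h ∈ Γ, ∀ q ∈ MulAction.orbit Γ x, h • q ∈ MulAction.orbit Γ x := by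
    intro h hh q hq
    obtain ⟨k, hk⟩ := MulAction.mem_orbit_iff.1 hq
    refine MulAction.mem_orbit_iff.2 ⟨⟨h, hh⟩ * k, ?_⟩
    rw [← hk, Subgroup.smul_def, Subgroup.smul_def, Subgroup.coe_mul, mul_smul]
  refine ⟨x, hx, map_mem_closure (continuous_smul_projective g) hcl (horb g hg), fun h => hno ?_⟩
  have := horb g⁻¹ (Γ.inv_mem hg) _ h
  rwa [inv_smul_smul] at this

theorem smul_mem_hull (hΩ : ∀ g ∈ Γ, ∀ q ∈ Ω, g • q ∈ Ω) {g : SL(m, ℝ)} (hg : g ∈ Γ)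
    {p : ℙ ℝ (Fin m → ℝ)} (hp : p ∈ hull Ω (limitSet Ω Γ)) :
    g • p ∈ hull Ω (limitSet Ω Γ) := by
  obtain ⟨φ, hφ, x, hx0, hx, rfl⟩ := hp
  set L : (Fin m → ℝ) →ₗ[ℝ] (Fin m → ℝ) := g.1.mulVecLin with hL
  have hinv : ∀ v : Fin m → ℝ, (g⁻¹).1 *ᵥ (g.1 *ᵥ v) = v := fun v => by
    rw [Matrix.mulVec_mulVec, ← Matrix.SpecialLinearGroup.coe_mul, inv_mul_cancel]
    simp
  refine ⟨φ ∘ₗ (g⁻¹).1.mulVecLin, fun q hq => ?_, L x, mulVec_ne_zero_of_sl g hx0, ?_, rfl⟩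
  · have h1 : g⁻¹ • q ∈ closure Ω :=
      map_mem_closure (continuous_smul_projective g⁻¹) hq (hΩ _ (Γ.inv_mem hg))
    have h2 := hφ h1
    induction q using Projectivization.ind with
    | h v hv =>
    rw [mk_mem_affineChart]
    exact (mk_mem_affineChart (mulVec_ne_zero_of_sl g⁻¹ hv)).1 h2
  · have h1 : L x ∈ L '' convexHull ℝ (affinePart φ (limitSet Ω Γ)) := ⟨x, hx, rfl⟩
    rw [LinearMap.image_convexHull] at h1
    refine convexHull_mono ?_ h1
    rintro _ ⟨y, ⟨hy1, hy0, hy⟩, rfl⟩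
    refine ⟨?_, mulVec_ne_zero_of_sl g hy0, smul_mem_limitSet hg hy⟩
    change φ ((g⁻¹).1 *ᵥ (g.1 *ᵥ y)) = 1
    rw [hinv, hy1]

theorem smul_mem_closure_hull (hΩ : ∀ g ∈ Γ, ∀ q ∈ Ω, g • q ∈ Ω) {g : SL(m, ℝ)} (hg : g ∈ Γ)
    {p : ℙ ℝ (Fin m → ℝ)} (hp : p ∈ closure (hull Ω (limitSet Ω Γ))) :
    g • p ∈ closure (hull Ω (limitSet Ω Γ)) :=
  map_mem_closure (continuous_smul_projective g) hp fun _ hq => smul_mem_hull hΩ hg hq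

theorem quotient_mk_smul {g : SL(m, ℝ)} (hg : g ∈ Γ) (p : ℙ ℝ (Fin m → ℝ)) :
    (Quotient.mk (MulAction.orbitRel Γ (ℙ ℝ (Fin m → ℝ))) (g • p)) = Quotient.mk _ p :=
  Quotient.sound ⟨⟨g, hg⟩, rfl⟩

end Invariance

theorem smul_mem_quarticDomain (g : SL(2, ℝ)) {q : ℙ ℝ (Fin 5 → ℝ)} (hq : q ∈ quarticDomain) :
    rho 4 g • q ∈ quarticDomain := by
  obtain ⟨c, hc, hK, rfl⟩ := hq
  obtain ⟨h, he⟩ := rho_smul_mk (d := 4) g hc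
  rw [he]
  exact ⟨_, h, subst_mem_middleCone hK g⁻¹, rfl⟩

theorem map_rho_le_aut (Γ : Subgroup SL(2, ℝ)) : Γ.map (rho 4) ≤ Aut quarticDomain := by
  rintro _ ⟨g, -, rfl⟩
  rw [Aut, MulAction.mem_stabilizer_iff]
  refine subset_antisymm ?_ fun q hq => ?_
  · rintro _ ⟨q, hq, rfl⟩
    exact smul_mem_quarticDomain g hq
  · refine ⟨rho 4 g⁻¹ • q, smul_mem_quarticDomain g⁻¹ hq, ?_⟩
    change rho 4 g • rho 4 g⁻¹ • q = q
    rw [← mul_smul, ← map_mul, mul_inv_cancel, map_one, one_smul]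

/-- The closed convex hull of the limit set lies in every closed convex cone which contains the
fourth powers representing the limit points. -/
theorem exists_mem_of_mem_closure_hull {Γ : Subgroup SL(2, ℝ)} [DiscreteTopology Γ]
    {M : Set (Fin 5 → ℝ)} (hM : IsClosed M) (hadd : ∀ x ∈ M, ∀ y ∈ M, x + y ∈ M)
    (hsmul : ∀ x ∈ M, ∀ t : ℝ, 0 ≤ t → t • x ∈ M)
    (hlim : ∀ (u : Fin 2 → ℝ) (hu : u ≠ 0), Projectivization.mk ℝ _
      (linearPower_ne_zero (d := 2) hu) ∈ limitSet hyperbolicPlane (Γ.map (rho 2)) →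
        linearPower 4 u ∈ M) {c : Fin 5 → ℝ} (hc : c ≠ 0)
    (hp : Projectivization.mk ℝ c hc ∈
      closure (hull quarticDomain (limitSet quarticDomain (Γ.map (rho 4))))) :
    c ∈ M ∨ -c ∈ M := by
  rw [mk_mem_closure_iff] at hp
  have hcl : IsClosed (M ∪ -M) := hM.union (hM.preimage continuous_neg)
  refine (hcl.closure_subset_iff.2 ?_) hp
  rintro v ⟨hv, φ, hφ, x, hx0, hx, he⟩
  obtain ⟨σ, hσ, hpos⟩ := exists_sign hφ
  have hconv : Convex ℝ ((fun y : Fin 5 → ℝ => σ • y) ⁻¹' M) := by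
    have h1 : Convex ℝ M := fun x hx y hy a b ha hb _ =>
      hadd _ (hsmul x hx a ha) _ (hsmul y hy b hb)
    exact h1.linear_preimage (σ • LinearMap.id)
  have hsub : affinePart φ (limitSet quarticDomain (Γ.map (rho 4))) ⊆
      (fun y : Fin 5 → ℝ => σ • y) ⁻¹' M := by
    rintro y ⟨hy1, hy0, hy⟩
    obtain ⟨u, hu, hyu, hlu⟩ := limitSet_quarticDomain hy
    obtain ⟨t, ht, rfl⟩ := (mk_eq_mk_iff_exists _ _).1 hyu
    have h1 := hpos _ (linearPower_mem_closedMiddleCone u) (linearPower_ne_zero hu)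
    rw [map_smul, smul_eq_mul] at hy1
    have h2 : 0 ≤ σ * t := by
      have h3 : 0 < (σ * φ (linearPower 4 u)) * t ^ 2 := mul_pos h1 (by positivity)
      have h4 : (σ * φ (linearPower 4 u)) * t ^ 2 = σ * t := by
        linear_combination σ * t * hy1
      rw [h4] at h3
      exact h3.le
    rw [Set.mem_preimage, smul_smul]
    exact hsmul _ (hlim u hu hlu) _ h2
  have hxM : σ • x ∈ M := convexHull_min hsub hconv hx
  obtain ⟨t, ht, rfl⟩ := (mk_eq_mk_iff_exists _ _).1 he
  have hσ2 : σ * σ = 1 := by rcases hσ with rfl | rfl <;> norm_num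
  have e : t • x = (t * σ) • σ • x := by rw [smul_smul, mul_assoc, hσ2, mul_one]
  rw [e]
  rcases le_total 0 (t * σ) with h | h
  · exact Or.inl (hsmul _ hxM _ h)
  · refine Or.inr ?_
    have := hsmul _ hxM (-(t * σ)) (by linarith)
    rwa [neg_smul] at this

/-- The map from quartics to quadratic forms which is one twelfth of the Laplacian. It sends
`ℓ ^ 4` to `‖ℓ‖² ℓ ^ 2`. -/
noncomputable def laplace (c : Fin 5 → ℝ) : Fin 3 → ℝ :=
  ![c 0 + c 2 / 6, (c 1 + c 3) / 2, c 4 + c 2 / 6]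

theorem laplace_linearPower (u : Fin 2 → ℝ) :
    laplace (linearPower 4 u) = (u 0 ^ 2 + u 1 ^ 2) • linearPower 2 u := by
  rw [linearPower_four, linearPower_two]
  ext i
  fin_cases i <;> simp [laplace] <;> ring

theorem laplace_normalForm (α β : ℝ) :
    laplace (normalForm α β) = (4 / 3 * α) • baseQuadratic := by
  ext i
  fin_cases i <;> simp [laplace, normalForm, baseQuadratic] <;> ring

theorem laplace_add (c c' : Fin 5 → ℝ) : laplace (c + c') = laplace c + laplace c' := by
  ext i
  fin_cases i <;> simp [laplace] <;> ring

theorem laplace_smul (t : ℝ) (c : Fin 5 → ℝ) : laplace (t • c) = t • laplace c := by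
  ext i
  fin_cases i <;> simp [laplace] <;> ring

theorem continuous_laplace : Continuous laplace := by
  refine continuous_pi fun i => ?_
  fin_cases i <;> simp [laplace] <;> fun_prop

/-- If `N(α, β) ∘ g` lies in the closed convex hull of the limit set, then `3β ≤ α`, and
`(x² + y²) ∘ g` lies in every closed convex cone containing the squares which represent
limit points in the hyperbolic plane. -/
theorem normalForm_of_mem_closure_hull {Γ : Subgroup SL(2, ℝ)} [DiscreteTopology Γ]
    {D : Set (Fin 3 → ℝ)} (hD : IsClosed D) (hadd : ∀ x ∈ D, ∀ y ∈ D, x + y ∈ D)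
    (hsmul : ∀ x ∈ D, ∀ t : ℝ, 0 ≤ t → t • x ∈ D)
    (hlim : ∀ (u : Fin 2 → ℝ) (hu : u ≠ 0), Projectivization.mk ℝ _
      (linearPower_ne_zero (d := 2) hu) ∈ limitSet hyperbolicPlane (Γ.map (rho 2)) →
        linearPower 2 u ∈ D) {g : SL(2, ℝ)} {α β : ℝ} (hβ : 0 ≤ β) (hβα : β < α)
    (h0 : substMatrix 4 g.1 *ᵥ normalForm α β ≠ 0)
    (hp : Projectivization.mk ℝ (substMatrix 4 g.1 *ᵥ normalForm α β) h0 ∈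
      closure (hull quarticDomain (limitSet quarticDomain (Γ.map (rho 4))))) :
    3 * β ≤ α ∧ substMatrix 2 g.1 *ᵥ baseQuadratic ∈ D := by
  set M : Set (Fin 5 → ℝ) := {c | (∀ v, 0 ≤ binaryForm (d := 4) c v) ∧
    (∀ k : SL(2, ℝ), 0 ≤ (substMatrix 4 k.1 *ᵥ c) 2) ∧
    ∀ k : SL(2, ℝ), substMatrix 2 (k⁻¹).1 *ᵥ laplace (substMatrix 4 k.1 *ᵥ c) ∈ D} with hM
  have hMc : IsClosed M := by
    have e : M = ((⋂ v, {c | 0 ≤ binaryForm (d := 4) c v}) ∩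
        ⋂ k : SL(2, ℝ), {c | 0 ≤ (substMatrix 4 k.1 *ᵥ c) 2}) ∩
        ⋂ k : SL(2, ℝ), (fun c => substMatrix 2 (k⁻¹).1 *ᵥ laplace (substMatrix 4 k.1 *ᵥ c)) ⁻¹'
          D := by
      ext c
      simp [hM, and_assoc]
    rw [e]
    refine ((isClosed_iInter fun v => isClosed_le continuous_const
      (continuous_binaryForm_coeff v)).inter (isClosed_iInter fun k =>
        isClosed_le continuous_const ?_)).inter (isClosed_iInter fun k => hD.preimage ?_)
    · fun_prop
    · have := continuous_laplace
      fun_prop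
  have hmem := exists_mem_of_mem_closure_hull (Γ := Γ) hMc ?_ ?_ ?_ h0 hp
  · have hpos : IsPositive (d := 4) (substMatrix 4 g.1 *ᵥ normalForm α β) :=
      (isPositive_normalForm (by rwa [abs_of_nonneg hβ])).subst g
    have hmem' := hmem.resolve_right fun hn => h0 (eq_zero_of_nonneg_of_neg_nonneg hpos.nonneg hn.1)
    obtain ⟨-, h2, h3⟩ := hmem'
    constructor
    · have := h2 g⁻¹
      rw [substMatrix_inv_mulVec] at this
      simp [normalForm] at this
      linarith
    · have h4 := h3 g⁻¹
      rw [substMatrix_inv_mulVec, laplace_normalForm, Matrix.mulVec_smul, inv_inv] at h4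
      have hα : 0 < 4 / 3 * α := by linarith
      have := hsmul _ h4 (4 / 3 * α)⁻¹ (by positivity)
      rwa [smul_smul, inv_mul_cancel₀ hα.ne', one_smul] at this
  · rintro x ⟨hx1, hx2, hx3⟩ y ⟨hy1, hy2, hy3⟩
    refine ⟨fun v => ?_, fun k => ?_, fun k => ?_⟩
    · rw [binaryForm_add]; exact add_nonneg (hx1 v) (hy1 v)
    · rw [Matrix.mulVec_add]; exact add_nonneg (hx2 k) (hy2 k)
    · rw [Matrix.mulVec_add, laplace_add, Matrix.mulVec_add]; exact hadd _ (hx3 k) _ (hy3 k)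
  · rintro x ⟨hx1, hx2, hx3⟩ t ht
    refine ⟨fun v => ?_, fun k => ?_, fun k => ?_⟩
    · rw [binaryForm_const_smul]; exact mul_nonneg ht (hx1 v)
    · rw [Matrix.mulVec_smul]; exact mul_nonneg ht (hx2 k)
    · rw [Matrix.mulVec_smul, laplace_smul, Matrix.mulVec_smul]; exact hsmul _ (hx3 k) t ht
  · intro u hu hl
    refine ⟨fun v => ?_, fun k => ?_, fun k => ?_⟩
    · rw [binaryForm_linearPower]; positivity
    · rw [subst_linearPower, linearPower_four]
      simp
      positivity
    · rw [subst_linearPower, laplace_linearPower, Matrix.mulVec_smul, ← subst_linearPower,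
        substMatrix_inv_mulVec]
      exact hsmul _ (hlim u hu hl) _ (by positivity)

/-- Bounded representatives modulo `Γ` for the normal forms in the convex core give convex
cocompactness. -/
theorem actsConvexCocompactly_of_bounded {Γ : Subgroup SL(2, ℝ)} {R : ℝ}
    (h : ∀ (g : SL(2, ℝ)) (α β : ℝ), 0 ≤ β → β < α →
      ∀ h0 : substMatrix 4 g.1 *ᵥ normalForm α β ≠ 0,
      Projectivization.mk ℝ (substMatrix 4 g.1 *ᵥ normalForm α β) h0 ∈
        closure (hull quarticDomain (limitSet quarticDomain (Γ.map (rho 4)))) →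
      3 * β ≤ α ∧ ∃ γ ∈ Γ, ∀ i j, |(g * γ).1 i j| ≤ R) :
    ActsConvexCocompactly quarticDomain (Γ.map (rho 4)) := by
  have hΩ : ∀ g ∈ Γ.map (rho 4), ∀ q ∈ quarticDomain, g • q ∈ quarticDomain := by
    rintro _ ⟨g, -, rfl⟩ q hq
    exact smul_mem_quarticDomain g hq
  set H := closure (hull quarticDomain (limitSet quarticDomain (Γ.map (rho 4)))) with hH
  have hN : ∀ β : ℝ, normalForm 1 β ≠ 0 := fun β h0 => by
    have h1 := congrFun h0 0
    have h2 := congrFun h0 2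
    simp [normalForm] at h1 h2
    linarith
  set Ψ : SL(2, ℝ) × ℝ → ℙ ℝ (Fin 5 → ℝ) := fun x =>
    Projectivization.mk ℝ _ (subst_ne_zero (d := 4) x.1 (hN x.2)) with hΨ
  have hΨc : Continuous Ψ := by
    have h1 : Continuous fun x : SL(2, ℝ) × ℝ => substMatrix 4 x.1.1 *ᵥ normalForm 1 x.2 := by
      have e : (fun x : SL(2, ℝ) × ℝ => substMatrix 4 x.1.1 *ᵥ normalForm 1 x.2) =
          fun x => substMatrix 4 x.1.1 *ᵥ normalForm 1 0
            + x.2 • (substMatrix 4 x.1.1 *ᵥ normalForm 0 1) := by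
        funext x
        rw [← Matrix.mulVec_smul, normalForm_smul, ← Matrix.mulVec_add, normalForm_add]
        simp
      rw [e]
      have h2 := (continuous_substMatrix_four_mulVec (normalForm 1 0)).comp
        (continuous_slVal.comp (continuous_fst (X := SL(2, ℝ)) (Y := ℝ)))
      have h3 := (continuous_substMatrix_four_mulVec (normalForm 0 1)).comp
        (continuous_slVal.comp (continuous_fst (X := SL(2, ℝ)) (Y := ℝ)))
      exact h2.add (continuous_snd.smul h3)
    exact continuous_mk'.comp (h1.subtype_mk _)
  have hC : IsCompact (({g : SL(2, ℝ) | ∀ i j, |g.1 i j| ≤ R} ×ˢ Set.Icc (0 : ℝ) (1 / 3)) ∩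
      Ψ ⁻¹' H) :=
    ((isCompact_slBox R).prod isCompact_Icc).inter_right (isClosed_closure.preimage hΨc)
  have hcont : Continuous fun x =>
      (Quotient.mk (MulAction.orbitRel (Γ.map (rho 4)) (ℙ ℝ (Fin 5 → ℝ))) (Ψ x)) :=
    continuous_quot_mk.comp hΨc
  unfold ActsConvexCocompactly
  convert hC.image hcont using 1
  refine subset_antisymm ?_ ?_
  · rintro _ ⟨p, ⟨⟨c, hc, hK, rfl⟩, hpH⟩, rfl⟩
    obtain ⟨g, α, β, hβ, hβα, h3, rfl⟩ := exists_normalForm_of_mem_middleCone hK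
    obtain ⟨hb, γ, hγ, hR⟩ := h g α β hβ hβα hc hpH
    have hα : 0 < α := by linarith
    obtain ⟨hne, he⟩ := rho_smul_mk (d := 4) γ⁻¹ hc
    have hγ' : rho 4 γ⁻¹ ∈ Γ.map (rho 4) := ⟨γ⁻¹, Γ.inv_mem hγ, rfl⟩
    have hΨe : Ψ (g * γ, β / α) = rho 4 γ⁻¹ • Projectivization.mk ℝ _ hc := by
      rw [he, hΨ, mk_eq_mk_iff_exists]
      refine ⟨α⁻¹, inv_ne_zero hα.ne', ?_⟩
      change substMatrix 4 (g * γ).1 *ᵥ normalForm 1 (β / α) = _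
      rw [inv_inv, ← substMatrix_coe_mul_mulVec, ← Matrix.mulVec_smul, normalForm_smul,
        inv_mul_cancel₀ hα.ne']
      congr 2
      rw [div_eq_inv_mul]
    refine ⟨(g * γ, β / α), ⟨⟨hR, by positivity, ?_⟩, ?_⟩, ?_⟩
    · rw [div_le_div_iff₀ hα (by norm_num)]; linarith
    · rw [Set.mem_preimage, hΨe]
      exact smul_mem_closure_hull hΩ hγ' hpH
    · simp only [hΨe]
      exact quotient_mk_smul hγ' _
  · rintro _ ⟨⟨g, β⟩, ⟨⟨-, hβ0, hβ1⟩, hpH⟩, rfl⟩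
    refine ⟨Ψ (g, β), ⟨⟨_, _, subst_mem_middleCone (normalForm_mem_middleCone ?_) g, rfl⟩, hpH⟩,
      rfl⟩
    rw [abs_of_nonneg hβ0]
    simp only at hβ1
    linarith

/-! ### Cocompact lattices and convex-cocompact groups -/

theorem exists_bound_of_compactSpace {Γ : Subgroup SL(2, ℝ)} (h : CompactSpace (SL(2, ℝ) ⧸ Γ)) :
    ∃ R : ℝ, ∀ g : SL(2, ℝ), ∃ γ ∈ Γ, ∀ i j, |(g * γ).1 i j| ≤ R := by
  set U : ℕ → Set (SL(2, ℝ) ⧸ Γ) := fun n =>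
    (QuotientGroup.mk : SL(2, ℝ) → SL(2, ℝ) ⧸ Γ) '' {g | ∀ i j, |g.1 i j| < n} with hU
  have hopen : ∀ n, IsOpen (U n) := fun n => by
    refine QuotientGroup.isOpenMap_coe _ ?_
    have : {g : SL(2, ℝ) | ∀ i j, |g.1 i j| < n} =
        ⋂ i, ⋂ j, {g : SL(2, ℝ) | |g.1 i j| < (n : ℝ)} := by ext; simp
    rw [this]
    exact isOpen_iInter_of_finite fun i => isOpen_iInter_of_finite fun j =>
      isOpen_lt (continuous_slVal.matrix_elem i j).abs continuous_const
  have hmono : Monotone U := fun n k hnk => Set.image_mono fun g hg i j =>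
    (hg i j).trans_le (by exact_mod_cast hnk)
  have hcov : Set.univ ⊆ ⋃ n, U n := by
    intro x _
    obtain ⟨g, rfl⟩ := QuotientGroup.mk_surjective x
    obtain ⟨n, hn⟩ := exists_nat_gt (|g.1 0 0| + |g.1 0 1| + |g.1 1 0| + |g.1 1 1|)
    refine Set.mem_iUnion.2 ⟨n, g, fun i j => ?_, rfl⟩
    have a := abs_nonneg (g.1 0 0)
    have b := abs_nonneg (g.1 0 1)
    have c := abs_nonneg (g.1 1 0)
    have d := abs_nonneg (g.1 1 1)
    fin_cases i <;> fin_cases j <;> simp <;> linarith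
  obtain ⟨n, hn⟩ := isCompact_univ.elim_directed_cover U hopen hcov hmono.directed_le
  refine ⟨n, fun g => ?_⟩
  obtain ⟨k, hk, hkg⟩ := hn (Set.mem_univ (g : SL(2, ℝ) ⧸ Γ))
  refine ⟨g⁻¹ * k, QuotientGroup.eq.1 hkg.symm, fun i j => ?_⟩
  rw [mul_inv_cancel_left]
  exact (hk i j).le

theorem actsConvexCocompactly_of_compactSpace {Γ : Subgroup SL(2, ℝ)} [DiscreteTopology Γ]
    (h : CompactSpace (SL(2, ℝ) ⧸ Γ)) :
    ActsConvexCocompactly quarticDomain (Γ.map (rho 4)) := by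
  obtain ⟨R, hR⟩ := exists_bound_of_compactSpace h
  refine actsConvexCocompactly_of_bounded (R := R) fun g α β hβ hβα h0 hp => ⟨?_, hR g⟩
  exact (normalForm_of_mem_closure_hull (D := Set.univ) isClosed_univ (fun _ _ _ _ => trivial)
    (fun _ _ _ _ => trivial) (fun _ _ _ => trivial) hβ hβα h0 hp).1

/-- The trace of a quadratic form, as a linear form. -/
def quadTrace : Module.Dual ℝ (Fin 3 → ℝ) where
  toFun c := c 0 + c 2
  map_add' c c' := by simp; ring
  map_smul' t c := by simp; ring

theorem quadTrace_apply (c : Fin 3 → ℝ) : quadTrace c = c 0 + c 2 := rfl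

theorem quadTrace_subst (p q r s : ℝ) :
    quadTrace (substMatrix 2 !![p, q; r, s] *ᵥ baseQuadratic) =
      p ^ 2 + q ^ 2 + r ^ 2 + s ^ 2 := by
  rw [substMatrix_two_mulVec, quadTrace_apply]
  simp [baseQuadratic]
  ring

theorem closure_hyperbolicPlane_subset : closure hyperbolicPlane ⊆ affineChart quadTrace := by
  intro p
  induction p using Projectivization.ind with
  | h c hc =>
  rw [mk_mem_closure_iff, mk_mem_affineChart]
  intro h h0
  have hcl : ∀ w : Fin 2 → ℝ, IsClosed {c : Fin 3 → ℝ | 0 ≤ binaryForm (d := 2) c w} := fun w =>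
    isClosed_le continuous_const (continuous_binaryForm_coeff w)
  have hcl' : ∀ w : Fin 2 → ℝ, IsClosed {c : Fin 3 → ℝ | binaryForm (d := 2) c w ≤ 0} := fun w =>
    isClosed_le (continuous_binaryForm_coeff w) continuous_const
  have hC : IsClosed ((⋂ w, {c : Fin 3 → ℝ | 0 ≤ binaryForm (d := 2) c w}) ∪
      ⋂ w, {c : Fin 3 → ℝ | binaryForm (d := 2) c w ≤ 0}) :=
    (isClosed_iInter hcl).union (isClosed_iInter hcl')
  have hmem := (hC.closure_subset_iff.2 ?_) h
  · rw [quadTrace_apply] at h0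
    rcases hmem with hmem | hmem
    · rw [Set.mem_iInter] at hmem
      have h1 := hmem ![1, 0]
      have h2 := hmem ![0, 1]
      have h3 := hmem ![1, 1]
      have h4 := hmem ![1, -1]
      simp [binaryForm_two] at h1 h2 h3 h4
      apply hc
      ext i; fin_cases i <;> simp <;> linarith
    · rw [Set.mem_iInter] at hmem
      have h1 := hmem ![1, 0]
      have h2 := hmem ![0, 1]
      have h3 := hmem ![1, 1]
      have h4 := hmem ![1, -1]
      simp [binaryForm_two] at h1 h2 h3 h4
      apply hc
      ext i; fin_cases i <;> simp <;> linarith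
  · rintro v ⟨hv, q, hq, he, hpos⟩
    obtain ⟨t, ht, rfl⟩ := (mk_eq_mk_iff_exists _ _).1 he
    have hq0 : ∀ w, 0 ≤ binaryForm (d := 2) q w := fun w => by
      by_cases hw : w = 0
      · rw [hw, binaryForm_zero_right (by norm_num)]
      · exact (hpos w hw).le
    rcases le_total 0 t with h | h
    · refine Or.inl (Set.mem_iInter.2 fun w => ?_)
      change 0 ≤ binaryForm (d := 2) (t • q) w
      rw [binaryForm_const_smul]
      exact mul_nonneg h (hq0 w)
    · refine Or.inr (Set.mem_iInter.2 fun w => ?_)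
      change binaryForm (d := 2) (t • q) w ≤ 0
      rw [binaryForm_const_smul]
      exact mul_nonpos_of_nonpos_of_nonneg h (hq0 w)

/-- The closed convex cone spanned by the squares which represent limit points, defined by
duality. -/
def limitCone (Γ : Subgroup SL(2, ℝ)) : Set (Fin 3 → ℝ) :=
  {q | ∀ m : (Fin 3 → ℝ) →L[ℝ] ℝ, (∀ (u : Fin 2 → ℝ) (hu : u ≠ 0), Projectivization.mk ℝ _
    (linearPower_ne_zero (d := 2) hu) ∈ limitSet hyperbolicPlane (Γ.map (rho 2)) →
      0 ≤ m (linearPower 2 u)) → 0 ≤ m q}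

theorem isClosed_limitCone (Γ : Subgroup SL(2, ℝ)) : IsClosed (limitCone Γ) := by
  have : limitCone Γ = ⋂ m : (Fin 3 → ℝ) →L[ℝ] ℝ, ⋂ _ : (∀ (u : Fin 2 → ℝ) (hu : u ≠ 0),
      Projectivization.mk ℝ _ (linearPower_ne_zero (d := 2) hu) ∈
        limitSet hyperbolicPlane (Γ.map (rho 2)) → 0 ≤ m (linearPower 2 u)), {q | 0 ≤ m q} := by
    ext q
    simp only [Set.mem_iInter]
    rfl
  rw [this]
  exact isClosed_iInter fun m => isClosed_iInter fun _ => isClosed_le continuous_const m.continuous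

/-- Limit points in the hyperbolic plane are squares of linear forms, and arise from rescaled
translates of a positive form with scaling factors tending to zero. -/
theorem limitSet_hyperbolicPlane {Γ : Subgroup SL(2, ℝ)} [DiscreteTopology Γ]
    {p : ℙ ℝ (Fin 3 → ℝ)} (hp : p ∈ limitSet hyperbolicPlane (Γ.map (rho 2))) :
    ∃ (u : Fin 2 → ℝ) (hu : u ≠ 0) (c : Fin 3 → ℝ) (t : ℕ → ℝ) (γ : ℕ → SL(2, ℝ)),
      p = Projectivization.mk ℝ _ (linearPower_ne_zero (d := 2) hu) ∧ IsPositive (d := 2) c ∧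
      (∀ n, 0 < t n) ∧ (∀ n, γ n ∈ Γ) ∧ Tendsto t atTop (𝓝 0) ∧
      Tendsto (fun n => t n • (substMatrix 2 (γ n).1 *ᵥ c)) atTop (𝓝 (linearPower 2 u)) := by
  obtain ⟨c, P, hP, hc, rfl, -, hno, t, γ, ht, hγ, hlim⟩ :=
    exists_seq_of_mem_limitSet (d := 2) (fun q hq => mem_hyperbolicPlane hq) hp
  obtain ⟨hdisc, ht0⟩ := limit_not_isPositive (d := 2) (by norm_num) (Q := quadDisc)
    (by unfold quadDisc; fun_prop) (fun t c => by simp [quadDisc]; ring) quadDisc_subst_sl hc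
    (quadDisc_pos hc) hno ht hγ hlim
  have hP0 : ∀ v, 0 ≤ binaryForm (d := 2) P v := fun v => by
    refine ge_of_tendsto' (((continuous_binaryForm_coeff (d := 2) v).tendsto _).comp hlim)
      fun n => ?_
    rw [Function.comp_apply, binaryForm_const_smul, binaryForm_subst]
    refine mul_nonneg (ht n).le ?_
    by_cases hv : (γ n).1 *ᵥ v = 0
    · rw [hv, binaryForm_zero_right (by norm_num)]
    · exact (hc _ hv).le
  have h1 := hP0 ![1, 0]
  have h2 := hP0 ![0, 1]
  simp [binaryForm_two] at h1 h2
  have key : ∃ u : Fin 2 → ℝ, P = linearPower 2 u := by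
    have e0 := Real.sq_sqrt h1
    have e1 := Real.sq_sqrt h2
    have e2 : √(P 0) * √(P 2) = |P 1| / 2 := by
      rw [← Real.sqrt_mul h2, show P 0 * P 2 = (P 1 / 2) ^ 2 by rw [quadDisc] at hdisc; linarith,
        Real.sqrt_sq_eq_abs, abs_div]
      norm_num
    rcases le_total 0 (P 1) with h | h
    · refine ⟨![√(P 2), √(P 0)], ?_⟩
      rw [abs_of_nonneg h] at e2
      rw [linearPower_two]
      ext i; fin_cases i
      · simp [e1]
      · simp; linarith
      · simp [e0]
    · refine ⟨![√(P 2), -√(P 0)], ?_⟩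
      rw [abs_of_nonpos h] at e2
      rw [linearPower_two]
      ext i; fin_cases i
      · simp [e1]
      · simp; linarith
      · simp [e0]
  obtain ⟨u, rfl⟩ := key
  have hu : u ≠ 0 := by
    rintro rfl
    apply hP
    rw [linearPower_two]
    ext i; fin_cases i <;> simp
  exact ⟨u, hu, c, t, γ, rfl, hc, ht, hγ, ht0, hlim⟩

theorem mk_mem_closure_hull_of_mem_limitCone {Γ : Subgroup SL(2, ℝ)} [DiscreteTopology Γ]
    {q : Fin 3 → ℝ} (hq0 : q ≠ 0) (htr : 0 < quadTrace q) (hq : q ∈ limitCone Γ) :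
    Projectivization.mk ℝ q hq0 ∈
      closure (hull hyperbolicPlane (limitSet hyperbolicPlane (Γ.map (rho 2)))) := by
  set Λ := limitSet hyperbolicPlane (Γ.map (rho 2)) with hΛ
  set q' := (quadTrace q)⁻¹ • q with hq'
  have hq'0 : q' ≠ 0 := smul_ne_zero (inv_ne_zero htr.ne') hq0
  have he : Projectivization.mk ℝ q hq0 = Projectivization.mk ℝ q' hq'0 := by
    rw [mk_eq_mk_iff_exists]
    exact ⟨quadTrace q, htr.ne', by rw [hq', smul_smul, mul_inv_cancel₀ htr.ne', one_smul]⟩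
  have hmem : q' ∈ closure (convexHull ℝ (affinePart quadTrace Λ)) := by
    by_contra hn
    obtain ⟨f, a, hf1, hf2⟩ := geometric_hahn_banach_point_closed
      (convex_convexHull ℝ (affinePart quadTrace Λ)).closure isClosed_closure hn
    have htr' : quadTrace q' = 1 := by
      rw [hq', map_smul, smul_eq_mul, inv_mul_cancel₀ htr.ne']
    have h1 := hq (f - a • quadTrace.toContinuousLinearMap) fun u hu hl => ?_
    · have h2 : 0 ≤ (f - a • quadTrace.toContinuousLinearMap) q' := by
        rw [hq', map_smul]
        exact mul_nonneg (by positivity) h1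
      have h3 : (f - a • quadTrace.toContinuousLinearMap) q' = f q' - a * quadTrace q' := rfl
      rw [h3, htr'] at h2
      linarith
    · have hn : 0 < quadTrace (linearPower 2 u) := by
        rw [linearPower_two, quadTrace_apply]
        simp
        have : u 0 ^ 2 + u 1 ^ 2 ≠ 0 := by
          intro h0
          apply hu
          have h3 : u 0 = 0 := by nlinarith [sq_nonneg (u 0), sq_nonneg (u 1)]
          have h4 : u 1 = 0 := by nlinarith [sq_nonneg (u 0), sq_nonneg (u 1)]
          ext i; fin_cases i <;> simp [h3, h4]
        have : 0 < u 0 ^ 2 + u 1 ^ 2 := by positivity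
        linarith
      set w := (quadTrace (linearPower 2 u))⁻¹ • linearPower 2 u with hw
      have hw0 : w ≠ 0 := smul_ne_zero (inv_ne_zero hn.ne') (linearPower_ne_zero hu)
      have hwm : w ∈ affinePart quadTrace Λ := by
        refine ⟨by rw [hw, map_smul, smul_eq_mul, inv_mul_cancel₀ hn.ne'], hw0, ?_⟩
        have : Projectivization.mk ℝ w hw0 =
            Projectivization.mk ℝ _ (linearPower_ne_zero (d := 2) hu) := by
          rw [mk_eq_mk_iff_exists]
          exact ⟨_, inv_ne_zero hn.ne', hw⟩
        rw [this]
        exact hl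
      have h2 := hf2 w (subset_closure (subset_convexHull ℝ _ hwm))
      have h3 : f w = (quadTrace (linearPower 2 u))⁻¹ * f (linearPower 2 u) := by
        rw [hw, map_smul, smul_eq_mul]
      have h4 : f (linearPower 2 u) = quadTrace (linearPower 2 u) * f w := by
        rw [h3, mul_inv_cancel_left₀ hn.ne']
      have h5 : (f - a • quadTrace.toContinuousLinearMap) (linearPower 2 u) =
        f (linearPower 2 u) - a * quadTrace (linearPower 2 u) := rfl
      rw [h5, h4]
      nlinarith
  rw [he, mk_mem_closure_iff]
  refine closure_mono (fun x hx => ?_) hmem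
  have hxt : quadTrace x = 1 := by
    have hc : Convex ℝ {x : Fin 3 → ℝ | quadTrace x = 1} :=
      convex_hyperplane quadTrace.isLinear 1
    exact convexHull_min (fun y hy => hy.1) hc hx
  have hx0 : x ≠ 0 := by
    rintro rfl
    simp at hxt
  exact ⟨hx0, quadTrace, closure_hyperbolicPlane_subset, x, hx0, hx, rfl⟩

/-- A compact convex core in the hyperbolic plane has representatives with bounded
distortion. -/
theorem exists_bound_of_actsConvexCocompactly {Γ : Subgroup SL(2, ℝ)}
    (h : ActsConvexCocompactly hyperbolicPlane (Γ.map (rho 2))) :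
    ∃ n : ℕ, ∀ (q : Fin 3 → ℝ) (hq0 : q ≠ 0), IsPositive (d := 2) q → Projectivization.mk ℝ q hq0 ∈
      convexCore hyperbolicPlane (Γ.map (rho 2)) →
        ∃ γ ∈ Γ, quadTrace (substMatrix 2 γ.1 *ᵥ q) ^ 2 < n * quadDisc q := by
  set V : ℕ → Set (ℙ ℝ (Fin 3 → ℝ)) := fun n => {p | ∃ (q : Fin 3 → ℝ) (hq : q ≠ 0),
    quadTrace q ^ 2 < n * quadDisc q ∧ p = Projectivization.mk ℝ q hq} with hV
  have hiff : ∀ (n : ℕ) (q : Fin 3 → ℝ) (hq : q ≠ 0), Projectivization.mk ℝ q hq ∈ V n ↔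
      quadTrace q ^ 2 < n * quadDisc q := by
    intro n q hq
    refine ⟨?_, fun h => ⟨q, hq, h, rfl⟩⟩
    rintro ⟨q', hq', h', he⟩
    obtain ⟨t, ht, rfl⟩ := (mk_eq_mk_iff_exists _ _).1 he
    have e : quadDisc (t • q') = t ^ 2 * quadDisc q' := by simp [quadDisc]; ring
    rw [map_smul, smul_eq_mul, mul_pow, e, mul_left_comm]
    exact mul_lt_mul_of_pos_left h' (by positivity)
  have hVo : ∀ n, IsOpen (V n) := fun n => by
    rw [isOpen_iff_mk']
    have e : (Projectivization.mk' ℝ : {v : Fin 3 → ℝ // v ≠ 0} → _) ⁻¹' V n =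
        Subtype.val ⁻¹' {q : Fin 3 → ℝ | quadTrace q ^ 2 < n * quadDisc q} := by
      ext q
      exact hiff n q.1 q.2
    rw [e]
    refine IsOpen.preimage continuous_subtype_val (isOpen_lt ?_ ?_)
    · simp only [quadTrace_apply]; fun_prop
    · unfold quadDisc; fun_prop
  set U := fun n => (fun p => (Quotient.mk (MulAction.orbitRel (Γ.map (rho 2))
    (ℙ ℝ (Fin 3 → ℝ))) p)) '' V n with hU
  have : ContinuousConstSMul (Γ.map (rho 2)) (ℙ ℝ (Fin 3 → ℝ)) :=
    ⟨fun g => continuous_smul_projective g.1⟩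
  have hUo : ∀ n, IsOpen (U n) := fun n =>
    (MulAction.isOpenQuotientMap_quotientMk (Γ := Γ.map (rho 2))).isOpenMap _ (hVo n)
  have hmono : Monotone U := by
    intro n k hnk
    refine Set.image_mono ?_
    rintro _ ⟨q, hq, h', rfl⟩
    refine ⟨q, hq, h'.trans_le ?_, rfl⟩
    have h1 : 0 ≤ quadDisc q := by
      by_contra hneg
      have : (n : ℝ) * quadDisc q ≤ 0 :=
        mul_nonpos_of_nonneg_of_nonpos (Nat.cast_nonneg n) (not_le.1 hneg).le
      nlinarith [sq_nonneg (quadTrace q)]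
    exact mul_le_mul_of_nonneg_right (by exact_mod_cast hnk) h1
  obtain ⟨n, hn⟩ := h.elim_directed_cover U hUo (by
    rintro _ ⟨p, ⟨hp, -⟩, rfl⟩
    obtain ⟨q, hq0, hq, rfl⟩ := mem_hyperbolicPlane hp
    obtain ⟨n, hn⟩ := exists_nat_gt (quadTrace q ^ 2 / quadDisc q)
    rw [div_lt_iff₀ (quadDisc_pos hq)] at hn
    exact Set.mem_iUnion.2 ⟨n, _, ⟨q, hq0, hn, rfl⟩, rfl⟩) hmono.directed_le
  refine ⟨n, fun q hq0 hq hp => ?_⟩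
  obtain ⟨p, hpV, hpe⟩ := hn ⟨_, hp, rfl⟩
  obtain ⟨⟨_, g, hg, rfl⟩, hgp⟩ := Quotient.exact hpe
  refine ⟨g⁻¹, Γ.inv_mem hg, ?_⟩
  obtain ⟨hne, he⟩ := rho_smul_mk (d := 2) g hq0
  have h1 : rho 2 g • Projectivization.mk ℝ q hq0 = p := hgp
  rw [he] at h1
  rw [← h1, hiff] at hpV
  rwa [quadDisc_subst_sl] at hpV

theorem actsConvexCocompactly_of_hyperbolicPlane {Γ : Subgroup SL(2, ℝ)} [DiscreteTopology Γ]
    (h : ActsConvexCocompactly hyperbolicPlane (Γ.map (rho 2))) :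
    ActsConvexCocompactly quarticDomain (Γ.map (rho 4)) := by
  obtain ⟨n, hn⟩ := exists_bound_of_actsConvexCocompactly h
  refine actsConvexCocompactly_of_bounded (R := n + 1) fun g α β hβ hβα h0 hp => ?_
  obtain ⟨h3, hD⟩ := normalForm_of_mem_closure_hull (isClosed_limitCone Γ)
    (fun x hx y hy m hm => by rw [map_add]; exact add_nonneg (hx m hm) (hy m hm))
    (fun x hx t ht m hm => by rw [map_smul]; exact mul_nonneg ht (hx m hm))
    (fun u hu hl m hm => hm u hu hl) hβ hβα h0 hp
  refine ⟨h3, ?_⟩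
  have hpos := isPositive_baseQuadratic.subst (d := 2) g
  have hne := hpos.ne_zero
  have htr : 0 < quadTrace (substMatrix 2 g.1 *ᵥ baseQuadratic) := by
    have h1 := hpos ![1, 0] (by simp)
    have h2 := hpos ![0, 1] (by simp)
    rw [quadTrace_apply]
    rw [binaryForm_two] at h1 h2
    simp only [Matrix.cons_val_zero, Matrix.cons_val_one] at h1 h2
    norm_num at h1 h2
    linarith
  obtain ⟨γ, hγ, hlt⟩ := hn _ hne hpos
    ⟨⟨_, hne, rfl, hpos⟩, mk_mem_closure_hull_of_mem_limitCone hne htr hD⟩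
  refine ⟨γ, hγ, ?_⟩
  rw [← substMatrix_coe_mul_mulVec, quadDisc_subst_sl] at hlt
  obtain ⟨p, q, r, s, hd, he⟩ := exists_eq_slMk (g * γ)
  rw [he] at hlt ⊢
  rw [slMk_val, quadTrace_subst] at hlt
  have e : quadDisc baseQuadratic = 1 := by simp [quadDisc, baseQuadratic]
  rw [e, mul_one] at hlt
  have key : ∀ x : ℝ, x ^ 2 ≤ p ^ 2 + q ^ 2 + r ^ 2 + s ^ 2 → |x| ≤ n + 1 := fun x hx => by
    have h5 : (x ^ 2) ^ 2 < n := (pow_le_pow_left₀ (sq_nonneg x) hx 2).trans_lt hlt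
    have hn0 : (0 : ℝ) ≤ n := Nat.cast_nonneg n
    refine abs_le_of_sq_le_sq' ?_ (by linarith) |> abs_le.2
    nlinarith [sq_nonneg (x ^ 2 - 1)]
  intro i j
  fin_cases i <;> fin_cases j <;> simp <;> apply key <;>
    nlinarith [sq_nonneg p, sq_nonneg q, sq_nonneg r, sq_nonneg s]

/-! ### The stabilizer of the invariants of binary quartics -/

/-- The matrices which preserve both invariants of binary quartics. -/
def PreservesInvariants (H : Matrix (Fin 5) (Fin 5) ℝ) : Prop :=
  ∀ c, invI (H *ᵥ c) = invI c ∧ invJ (H *ᵥ c) = invJ c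

theorem PreservesInvariants.mul {H K : Matrix (Fin 5) (Fin 5) ℝ} (hH : PreservesInvariants H)
    (hK : PreservesInvariants K) : PreservesInvariants (H * K) := fun c => by
  rw [← Matrix.mulVec_mulVec, (hH _).1, (hH _).2]
  exact hK c

theorem preservesInvariants_subst {A : Matrix (Fin 2) (Fin 2) ℝ} (hA : A.det = 1 ∨ A.det = -1) :
    PreservesInvariants (substMatrix 4 A) := fun c => by
  rw [Matrix.eta_fin_two A, invI_subst, invJ_subst, ← Matrix.det_fin_two]
  rcases hA with h | h <;> rw [h] <;> norm_num

/-- A quartic at which the quadratic invariant and the gradient of the cubic invariant vanish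
is a multiple of a fourth power: the Hankel matrix of its normalized coefficients has rank one. -/
theorem exists_eq_smul_linearPower {Q : Fin 5 → ℝ} (hQ : Q ≠ 0) (hI : invI Q = 0)
    (hJ : ∀ v, invJ (v + Q) + invJ (v - Q) = 2 * invJ v) :
    ∃ (k : ℝ) (u : Fin 2 → ℝ), k ≠ 0 ∧ u ≠ 0 ∧ Q = k • linearPower 4 u := by
  have h0 := hJ ![1, 0, 0, 0, 0]
  have h1 := hJ ![0, 1, 0, 0, 0]
  have h2 := hJ ![0, 0, 1, 0, 0]
  have h3 := hJ ![0, 0, 0, 1, 0]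
  have h4 := hJ ![0, 0, 0, 0, 1]
  simp [invJ] at h0 h1 h2 h3 h4
  rw [invI] at hI
  have m0 : Q 2 * Q 4 / 6 = Q 3 ^ 2 / 16 := by linear_combination h0 / 2
  have m1 : Q 2 * Q 3 / 6 = Q 1 * Q 4 := by linear_combination 4 * h1
  have m3 : Q 1 * Q 2 / 6 = Q 0 * Q 3 := by linear_combination 4 * h3
  have m4 : Q 0 * Q 2 / 6 = Q 1 ^ 2 / 16 := by linear_combination h4 / 2
  have m2 : Q 1 * Q 3 / 16 = Q 2 ^ 2 / 36 := by linear_combination h2 / 2 - hI / 6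
  have m5 : Q 0 * Q 4 = Q 2 ^ 2 / 36 := by linear_combination 4 * m2 + hI
  by_cases hq : Q 0 = 0
  · have e1 : Q 1 = 0 := by
      rw [hq] at m4
      have : Q 1 ^ 2 = 0 := by linarith
      simpa using this
    have e2 : Q 2 = 0 := by
      rw [e1] at m2
      have : Q 2 ^ 2 = 0 := by linarith
      simpa using this
    have e3 : Q 3 = 0 := by
      rw [e2] at m0
      have : Q 3 ^ 2 = 0 := by linarith
      simpa using this
    refine ⟨Q 4, ![1, 0], fun h => hQ ?_, by simp, ?_⟩
    · ext i; fin_cases i <;> simp [hq, e1, e2, e3, h]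
    · rw [linearPower_four]
      ext i; fin_cases i <;> simp [hq, e1, e2, e3]
  · refine ⟨1 / Q 0 ^ 3, ![Q 1 / 4, Q 0], by positivity, by simp [hq], ?_⟩
    have e2 : Q 2 = 6 * (Q 1 ^ 2 / 16) / Q 0 := by
      field_simp
      linear_combination 96 * m4
    have e3 : Q 3 = Q 1 ^ 3 / 16 / Q 0 ^ 2 := by
      have : Q 3 = Q 1 * Q 2 / 6 / Q 0 := by field_simp; linear_combination -6 * m3
      rw [this, e2]
      field_simp
    have e4 : Q 4 = Q 1 ^ 4 / 256 / Q 0 ^ 3 := by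
      have : Q 4 = Q 2 ^ 2 / 36 / Q 0 := by field_simp; linear_combination 36 * m5
      rw [this, e2]
      field_simp
      norm_num
      ring
    rw [linearPower_four]
    ext i
    fin_cases i
    · simp; field_simp
    · simp; field_simp
    · simp [e2]; field_simp; norm_num
    · simp [e3]; field_simp; norm_num
    · simp [e4]; field_simp; norm_num

theorem PreservesInvariants.map_linearPower {H H' : Matrix (Fin 5) (Fin 5) ℝ}
    (hH : PreservesInvariants H) (h1 : H * H' = 1) (h2 : H' * H = 1) {c : Fin 5 → ℝ} (hc : c ≠ 0)
    (hI : invI c = 0) (hJ : ∀ v, invJ (v + c) + invJ (v - c) = 2 * invJ v) :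
    ∃ (k : ℝ) (u : Fin 2 → ℝ), k ≠ 0 ∧ u ≠ 0 ∧ H *ᵥ c = k • linearPower 4 u := by
  refine exists_eq_smul_linearPower (fun h => hc ?_) ?_ fun v => ?_
  · rw [← Matrix.one_mulVec c, ← h2, ← Matrix.mulVec_mulVec, h, Matrix.mulVec_zero]
  · rw [(hH c).1, hI]
  · obtain ⟨w, rfl⟩ : ∃ w, H *ᵥ w = v := ⟨H' *ᵥ v, by rw [Matrix.mulVec_mulVec, h1]; simp⟩
    rw [← Matrix.mulVec_add, ← Matrix.mulVec_sub, (hH _).2, (hH _).2, (hH _).2, hJ]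

/-- Invariant-preserving matrices which fix the lines of `x⁴` and `y⁴` are diagonal. The tangent
spaces of the cone of fourth powers at these lines, which are the radicals of the derivatives of
the cubic invariant, and their orthogonals for the quadratic invariant are then preserved. -/
theorem PreservesInvariants.eq_subst_of_fixed {H : Matrix (Fin 5) (Fin 5) ℝ}
    (hH : PreservesInvariants H) {k k' : ℝ} (h4 : H *ᵥ ![0, 0, 0, 0, 1] = k • ![0, 0, 0, 0, 1])
    (h0 : H *ᵥ ![1, 0, 0, 0, 0] = k' • ![1, 0, 0, 0, 0]) :
    ∃ A : Matrix (Fin 2) (Fin 2) ℝ, (A.det = 1 ∨ A.det = -1) ∧ H = substMatrix 4 A := by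
  have hkk : k * k' = 1 := by
    have := (hH (![0, 0, 0, 0, 1] + ![1, 0, 0, 0, 0])).1
    rw [Matrix.mulVec_add, h4, h0] at this
    simp [invI] at this
    linarith
  have hk : k ≠ 0 := left_ne_zero_of_mul_eq_one hkk
  have r0 : ∀ c, k * (H *ᵥ c) 0 = c 0 := fun c => by
    have e1 := (hH (c + ![0, 0, 0, 0, 1])).1
    have e2 := (hH c).1
    rw [Matrix.mulVec_add, h4] at e1
    simp [invI] at e1 e2
    linarith
  have r4 : ∀ c, k' * (H *ᵥ c) 4 = c 4 := fun c => by
    have e1 := (hH (c + ![1, 0, 0, 0, 0])).1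
    have e2 := (hH c).1
    rw [Matrix.mulVec_add, h0] at e1
    simp [invI] at e1 e2
    linarith
  have q4 : ∀ c, k * ((H *ᵥ c) 0 * (H *ᵥ c) 2 / 6 - (H *ᵥ c) 1 ^ 2 / 16) =
      c 0 * c 2 / 6 - c 1 ^ 2 / 16 := fun c => by
    have e1 := (hH (c + ![0, 0, 0, 0, 1])).2
    have e2 := (hH c).2
    rw [Matrix.mulVec_add, h4] at e1
    simp [invJ] at e1 e2
    linarith
  have q0 : ∀ c, k' * ((H *ᵥ c) 2 * (H *ᵥ c) 4 / 6 - (H *ᵥ c) 3 ^ 2 / 16) =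
      c 2 * c 4 / 6 - c 3 ^ 2 / 16 := fun c => by
    have e1 := (hH (c + ![1, 0, 0, 0, 0])).2
    have e2 := (hH c).2
    rw [Matrix.mulVec_add, h0] at e1
    simp [invJ] at e1 e2
    linarith
  have e0 : H *ᵥ ![1, 0, 0, 0, 0] = fun i => H i 0 := by
    ext i; simp [Matrix.mulVec, dotProduct, Fin.sum_univ_five]
  have e1 : H *ᵥ ![0, 1, 0, 0, 0] = fun i => H i 1 := by
    ext i; simp [Matrix.mulVec, dotProduct, Fin.sum_univ_five]
  have e2 : H *ᵥ ![0, 0, 1, 0, 0] = fun i => H i 2 := by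
    ext i; simp [Matrix.mulVec, dotProduct, Fin.sum_univ_five]
  have e3 : H *ᵥ ![0, 0, 0, 1, 0] = fun i => H i 3 := by
    ext i; simp [Matrix.mulVec, dotProduct, Fin.sum_univ_five]
  have e4 : H *ᵥ ![0, 0, 0, 0, 1] = fun i => H i 4 := by
    ext i; simp [Matrix.mulVec, dotProduct, Fin.sum_univ_five]
  have a0 : ∀ i, H i 0 = k' * (![1, 0, 0, 0, 0] : Fin 5 → ℝ) i := fun i => by
    have := congrFun (e0.symm.trans h0) i
    simpa using this
  have a4 : ∀ i, H i 4 = k * (![0, 0, 0, 0, 1] : Fin 5 → ℝ) i := fun i => by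
    have := congrFun (e4.symm.trans h4) i
    simpa using this
  have hk' : k' ≠ 0 := right_ne_zero_of_mul_eq_one hkk
  have b01 := r0 ![0, 1, 0, 0, 0]
  have b02 := r0 ![0, 0, 1, 0, 0]
  have b03 := r0 ![0, 0, 0, 1, 0]
  have b41 := r4 ![0, 1, 0, 0, 0]
  have b42 := r4 ![0, 0, 1, 0, 0]
  have b43 := r4 ![0, 0, 0, 1, 0]
  have c1 := q4 ![0, 1, 0, 0, 0]
  have c2 := q4 ![0, 0, 1, 0, 0]
  have c3 := q4 ![0, 0, 0, 1, 0]
  have d1 := q0 ![0, 1, 0, 0, 0]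
  have d2 := q0 ![0, 0, 1, 0, 0]
  have d3 := q0 ![0, 0, 0, 1, 0]
  rw [e1] at b01 b41 c1 d1
  rw [e2] at b02 b42 c2 d2
  rw [e3] at b03 b43 c3 d3
  simp [hk, hk'] at b01 b02 b03 b41 b42 b43
  simp [b01, b41, hk'] at c1 d1
  simp [b02, b42, hk, hk'] at c2 d2
  simp [b03, b43, hk] at c3 d3
  have f1 := q4 (![1, 0, 0, 0, 0] + ![0, 1, 0, 0, 0])
  have f2 := q4 (![1, 0, 0, 0, 0] + ![0, 0, 1, 0, 0])
  have f3 := q4 (![1, 0, 0, 0, 0] + ![0, 0, 0, 1, 0])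
  rw [Matrix.mulVec_add, e0, e1] at f1
  rw [Matrix.mulVec_add, e0, e2] at f2
  rw [Matrix.mulVec_add, e0, e3] at f3
  have hsum := (hH (![0, 1, 0, 0, 0] + ![0, 0, 0, 1, 0])).1
  rw [Matrix.mulVec_add, e1, e3] at hsum
  simp [a0, b01, b02, b03, b41, b43, c2, c3, d1, invI] at f1 f2 f3 hsum
  have g21 : H 2 1 = 0 := by linear_combination 6 * f1 + 6 * c1 - H 2 1 * hkk
  have g22 : H 2 2 = 1 := by linear_combination 6 * f2 - H 2 2 * hkk
  have g23 : H 2 3 = 0 := (f3.resolve_left hk).resolve_left hk'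
  rw [g21, g23] at hsum
  have hs : H 1 1 * H 3 3 = 1 := by linarith
  have h3 : H 3 3 ≠ 0 := right_ne_zero_of_mul_eq_one hs
  have hks : k = H 3 3 ^ 2 := by linear_combination (-16 * k) * d3 + H 3 3 ^ 2 * hkk
  have hk's : k' = H 1 1 ^ 2 := by linear_combination (-16 * k') * c1 + H 1 1 ^ 2 * hkk
  set σ := √|H 3 3| with hσ
  have hσ2 : σ ^ 2 = |H 3 3| := Real.sq_sqrt (abs_nonneg _)
  have hσ0 : σ ≠ 0 := (Real.sqrt_pos.2 (abs_pos.2 h3)).ne'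
  have h11 : H 1 1 = 1 / H 3 3 := by field_simp; exact hs
  -- The substitution `x ↦ σ x`, `y ↦ (ε / σ) y` with `ε` the sign of `H 3 3` and `σ ^ 2 = ε H 3 3`.
  obtain ⟨ε, hε, hεs⟩ : ∃ ε : ℝ, (ε = 1 ∨ ε = -1) ∧ H 3 3 = ε * σ ^ 2 := by
    rw [hσ2]
    rcases le_total 0 (H 3 3) with h | h
    · exact ⟨1, Or.inl rfl, by rw [abs_of_nonneg h, one_mul]⟩
    · exact ⟨-1, Or.inr rfl, by rw [abs_of_nonpos h]; ring⟩
  clear_value σ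
  have hε2 : ε ^ 2 = 1 := by rcases hε with h | h <;> rw [h] <;> norm_num
  have hε0 : ε ≠ 0 := fun h => by rw [h] at hε2; norm_num at hε2
  refine ⟨!![σ, 0; 0, ε / σ], ?_, ?_⟩
  · rw [Matrix.det_fin_two_of]
    have : σ * (ε / σ) - 0 * 0 = ε := by field_simp; ring
    rwa [this]
  · refine Matrix.mulVec_injective (funext fun c => ?_)
    rw [substMatrix_four_mulVec]
    have hε3 : ε ^ 3 = ε := by rw [pow_succ, hε2, one_mul]
    have hε4 : ε ^ 4 = 1 := by rw [show 4 = 2 * 2 from rfl, pow_mul, hε2, one_pow]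
    ext i
    fin_cases i
    · simp [Matrix.mulVec, dotProduct, Fin.sum_univ_five, a0, a4, b01, b02, b03]
      rw [hk's, h11, hεs, div_pow (1 : ℝ), mul_pow, hε2, div_pow ε, hε4]
      ring
    · simp [Matrix.mulVec, dotProduct, Fin.sum_univ_five, a0, a4, c2, c3]
      rw [h11, hεs, div_pow, hε3]
      field_simp
      rw [hε2, one_mul]
    · simp [Matrix.mulVec, dotProduct, Fin.sum_univ_five, a0, a4, g21, g22, g23]
      rw [div_pow, hε2]
      field_simp
    · simp [Matrix.mulVec, dotProduct, Fin.sum_univ_five, a0, a4, d1, d2]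
      rw [hεs]
      field_simp
    · simp [Matrix.mulVec, dotProduct, Fin.sum_univ_five, a0, a4, b41, b42, b43]
      rw [hks, hεs, mul_pow, hε2]
      ring

/-- A matrix preserving both invariants of binary quartics is a substitution. -/
theorem PreservesInvariants.exists_eq_subst {H : Matrix (Fin 5) (Fin 5) ℝ}
    (hH : PreservesInvariants H) {H' : Matrix (Fin 5) (Fin 5) ℝ} (h1 : H * H' = 1)
    (h2 : H' * H = 1) :
    ∃ A : Matrix (Fin 2) (Fin 2) ℝ, (A.det = 1 ∨ A.det = -1) ∧ H = substMatrix 4 A := by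
  obtain ⟨k, u, hk, hu, hx⟩ := hH.map_linearPower h1 h2 (c := ![0, 0, 0, 0, 1])
    (fun h => by simpa using congrFun h 4) (by simp [invI]) (fun v => by simp [invJ]; ring)
  obtain ⟨k', w, hk', hw, hy⟩ := hH.map_linearPower h1 h2 (c := ![1, 0, 0, 0, 0])
    (fun h => by simpa using congrFun h 0) (by simp [invI]) (fun v => by simp [invJ]; ring)
  have hinj : ∀ c c' : Fin 5 → ℝ, H *ᵥ c = H *ᵥ c' → c = c' := fun c c' h => by
    have := congrArg (H' *ᵥ ·) h
    simpa [Matrix.mulVec_mulVec, h2] using this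
  set δ := u 0 * w 1 - u 1 * w 0 with hδ
  have hδ0 : δ ≠ 0 := by
    intro h0
    obtain ⟨t, ht⟩ : ∃ t : ℝ, w = t • u := by
      by_cases hu0 : u 0 = 0
      · have hu1 : u 1 ≠ 0 := fun h => hu (by ext i; fin_cases i <;> simp [hu0, h])
        refine ⟨w 1 / u 1, ?_⟩
        have : w 0 = 0 := by
          rw [hδ, hu0] at h0
          simpa [hu1] using h0
        ext i; fin_cases i <;> simp [hu0, this, hu1]
      · refine ⟨w 0 / u 0, ?_⟩
        ext i; fin_cases i
        · simp [hu0]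
        · simp
          field_simp
          linarith
    have := hinj (![1, 0, 0, 0, 0]) ((k' * t ^ 4 / k) • ![0, 0, 0, 0, 1]) (by
      rw [Matrix.mulVec_smul, hx, hy, ht, linearPower_smul, smul_smul, smul_smul]
      congr 1
      field_simp)
    simpa using congrFun this 0
  set B : SL(2, ℝ) := slMk (u 0) (u 1) (w 0 / δ) (w 1 / δ) (by field_simp; rw [hδ]) with hB
  have hBx : substMatrix 4 B.1 *ᵥ ![0, 0, 0, 0, 1] = linearPower 4 u := by
    rw [hB, slMk_val, substMatrix_four_mulVec, linearPower_four]
    ext i; fin_cases i <;> simp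
  have hBy : substMatrix 4 B.1 *ᵥ ![1, 0, 0, 0, 0] = (1 / δ ^ 4) • linearPower 4 w := by
    rw [hB, slMk_val, substMatrix_four_mulVec, linearPower_four]
    ext i; fin_cases i <;> simp <;> field_simp
  obtain ⟨A, hA, he⟩ := ((preservesInvariants_subst (Or.inl (B⁻¹).2)).mul hH).eq_subst_of_fixed
    (k := k) (k' := k' * δ ^ 4) (by
      rw [← Matrix.mulVec_mulVec, hx, ← hBx, Matrix.mulVec_smul, substMatrix_inv_mulVec]) (by
      have e : linearPower 4 w = δ ^ 4 • (substMatrix 4 B.1 *ᵥ ![1, 0, 0, 0, 0]) := by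
        rw [hBy, smul_smul]
        field_simp
        simp
      rw [← Matrix.mulVec_mulVec, hy, e, Matrix.mulVec_smul, Matrix.mulVec_smul,
        substMatrix_inv_mulVec, smul_smul])
  refine ⟨A * B.1, ?_, ?_⟩
  · rw [Matrix.det_mul, B.2, mul_one]; exact hA
  · rw [substMatrix_mul, ← he]
    refine Matrix.mulVec_injective (funext fun c => ?_)
    rw [← Matrix.mulVec_mulVec, ← Matrix.mulVec_mulVec, substMatrix_mulVec_inv]

/-! ### The Zariski closure: upper bound -/

open MvPolynomial in
theorem exists_eq_subst_of_mem_zariskiClosure {Γ : Subgroup SL(2, ℝ)} {g : SL(5, ℝ)}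
    (hg : g ∈ zariskiClosure (Γ.map (rho 4) : Set SL(5, ℝ))) :
    ∃ A : Matrix (Fin 2) (Fin 2) ℝ, (A.det = 1 ∨ A.det = -1) ∧ g.1 = substMatrix 4 A := by
  have h1 : g.1 * (g⁻¹).1 = 1 := congrArg Subtype.val (mul_inv_cancel g)
  have h2 : (g⁻¹).1 * g.1 = 1 := congrArg Subtype.val (inv_mul_cancel g)
  refine PreservesInvariants.exists_eq_subst (fun c => ?_) h1 h2
  -- the coordinates of the image of `c`, as polynomials in the matrix entries
  set y : Fin 5 → MvPolynomial (Fin 5 × Fin 5) ℝ := fun i => ∑ j, X (i, j) * C (c j) with hy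
  have hev : ∀ (s : SL(5, ℝ)) i, eval (fun ij => s.1 ij.1 ij.2) (y i) = (s.1 *ᵥ c) i :=
    fun s i => by simp [hy, Matrix.mulVec, dotProduct]
  have hI : ∀ s : SL(5, ℝ), eval (fun ij => s.1 ij.1 ij.2)
      (y 0 * y 4 - C (1 / 4) * y 1 * y 3 + C (1 / 12) * y 2 ^ 2 - C (invI c)) =
      invI (s.1 *ᵥ c) - invI c := fun s => by
    simp only [map_sub, map_add, map_mul, map_pow, hev, eval_C]
    rw [invI, invI]
    ring
  have hJ : ∀ s : SL(5, ℝ), eval (fun ij => s.1 ij.1 ij.2)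
      (C (1 / 6) * y 0 * y 2 * y 4 + C (1 / 48) * y 1 * y 2 * y 3 - C (1 / 16) * y 0 * y 3 ^ 2
        - C (1 / 16) * y 1 ^ 2 * y 4 - C (1 / 216) * y 2 ^ 3 - C (invJ c)) =
      invJ (s.1 *ᵥ c) - invJ c := fun s => by
    simp only [map_sub, map_add, map_mul, map_pow, hev, eval_C]
    rw [invJ, invJ]
    ring
  have hΓ : ∀ s ∈ (Γ.map (rho 4) : Set SL(5, ℝ)),
      invI (s.1 *ᵥ c) = invI c ∧ invJ (s.1 *ᵥ c) = invJ c := by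
    rintro _ ⟨γ, -, rfl⟩
    exact preservesInvariants_subst (Or.inl (γ⁻¹).2) c
  constructor
  · have := hg _ fun s hs => by rw [hI, (hΓ s hs).1, sub_self]
    rw [hI] at this
    linarith
  · have := hg _ fun s hs => by rw [hJ, (hΓ s hs).2, sub_self]
    rw [hJ] at this
    linarith

/-! ### Laurent polynomial functions -/

open Polynomial in
/-- The functions which agree away from `0` with a Laurent polynomial. -/
def IsLaurent (f : ℝ → ℝ) : Prop :=
  ∃ (N : ℕ) (p : ℝ[X]), ∀ t, t ≠ 0 → t ^ N * f t = p.eval t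

namespace IsLaurent

open Polynomial

theorem const (a : ℝ) : IsLaurent fun _ => a := ⟨0, C a, fun t _ => by simp⟩

theorem id : IsLaurent fun t => t := ⟨0, X, fun t _ => by simp⟩

theorem inv : IsLaurent fun t => t⁻¹ := ⟨1, 1, fun t ht => by simp [ht]⟩

theorem add {f g : ℝ → ℝ} (hf : IsLaurent f) (hg : IsLaurent g) :
    IsLaurent fun t => f t + g t := by
  obtain ⟨N, p, hp⟩ := hf
  obtain ⟨M, q, hq⟩ := hg
  refine ⟨N + M, X ^ M * p + X ^ N * q, fun t ht => ?_⟩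
  rw [eval_add, eval_mul, eval_mul, ← hp t ht, ← hq t ht, eval_pow, eval_pow, eval_X]
  ring

theorem mul {f g : ℝ → ℝ} (hf : IsLaurent f) (hg : IsLaurent g) :
    IsLaurent fun t => f t * g t := by
  obtain ⟨N, p, hp⟩ := hf
  obtain ⟨M, q, hq⟩ := hg
  refine ⟨N + M, p * q, fun t ht => ?_⟩
  rw [eval_mul, ← hp t ht, ← hq t ht]
  ring

theorem sum {ι : Type*} {s : Finset ι} {f : ι → ℝ → ℝ} (hf : ∀ i ∈ s, IsLaurent (f i)) :
    IsLaurent fun t => ∑ i ∈ s, f i t := by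
  classical
  induction s using Finset.induction_on with
  | empty => simpa using const 0
  | insert a s ha ih =>
    simp only [Finset.sum_insert ha]
    exact (hf a (Finset.mem_insert_self a s)).add
      (ih fun i hi => hf i (Finset.mem_insert_of_mem hi))

theorem eval_mvPolynomial {σ : Type*} (P : MvPolynomial σ ℝ) {f : σ → ℝ → ℝ}
    (hf : ∀ i, IsLaurent (f i)) : IsLaurent fun t => MvPolynomial.eval (fun i => f i t) P := by
  induction P using MvPolynomial.induction_on with
  | C a => simpa using const a
  | add p q hp hq => simpa using hp.add hq
  | mul_X p i hp => simpa using hp.mul (hf i)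

theorem eq_zero_of_infinite {f : ℝ → ℝ} (hf : IsLaurent f) {S : Set ℝ} (hS : S.Infinite)
    (h : ∀ t ∈ S, f t = 0) {t : ℝ} (ht : t ≠ 0) : f t = 0 := by
  obtain ⟨N, p, hp⟩ := hf
  have hp0 : p = 0 := by
    refine Polynomial.eq_zero_of_infinite_isRoot p ((hS.sdiff (Set.finite_singleton 0)).mono ?_)
    rintro s ⟨hs, hs0⟩
    have := hp s hs0
    rw [h s hs, mul_zero] at this
    exact this.symm
  have := hp t ht
  rw [hp0, eval_zero] at this
  exact (mul_eq_zero.1 this).resolve_left (pow_ne_zero _ ht)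

theorem matrix_mul {m n k : Type*} [Fintype n] {M : ℝ → Matrix m n ℝ} {N : ℝ → Matrix n k ℝ}
    (hM : ∀ i j, IsLaurent fun t => M t i j) (hN : ∀ i j, IsLaurent fun t => N t i j) (i : m)
    (j : k) : IsLaurent fun t => (M t * N t) i j := by
  simp only [Matrix.mul_apply]
  exact sum fun l _ => (hM i l).mul (hN l j)

theorem coeff_mul {p q : ℝ → ℝ[X]} (hp : ∀ i, IsLaurent fun t => (p t).coeff i)
    (hq : ∀ i, IsLaurent fun t => (q t).coeff i) (i : ℕ) :
    IsLaurent fun t => (p t * q t).coeff i := by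
  simp only [Polynomial.coeff_mul]
  exact sum fun x _ => (hp x.1).mul (hq x.2)

theorem coeff_pow {p : ℝ → ℝ[X]} (hp : ∀ i, IsLaurent fun t => (p t).coeff i) (k : ℕ) (i : ℕ) :
    IsLaurent fun t => (p t ^ k).coeff i := by
  induction k generalizing i with
  | zero => simpa using const _
  | succ k ih => simpa only [pow_succ] using coeff_mul ih hp i

theorem substMatrix {d : ℕ} {M : ℝ → Matrix (Fin 2) (Fin 2) ℝ}
    (hM : ∀ i j, IsLaurent fun t => M t i j) (i j : Fin (d + 1)) :
    IsLaurent fun t => HilbertGeometry.substMatrix d (M t) i j := by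
  have hlin : ∀ k i, IsLaurent fun t => (C (M t k 0) * X + C (M t k 1)).coeff i := by
    intro k i
    simp only [coeff_add, coeff_C_mul, coeff_C]
    refine ((hM k 0).mul (const _)).add ?_
    split_ifs
    · exact hM k 1
    · exact const 0
  exact coeff_mul (coeff_pow (hlin 0) _) (coeff_pow (hlin 1) _) i

end IsLaurent

/-! ### Zariski density -/

/-- Continuous functions on matrices which are Laurent along curves with Laurent entries. -/
def IsRegular (F : Matrix (Fin 2) (Fin 2) ℝ → ℝ) : Prop :=
  Continuous F ∧ ∀ M : ℝ → Matrix (Fin 2) (Fin 2) ℝ, (∀ i j, IsLaurent fun t => M t i j) →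
    IsLaurent fun t => F (M t)

theorem IsRegular.conj {F : Matrix (Fin 2) (Fin 2) ℝ → ℝ} (hF : IsRegular F)
    (A B : Matrix (Fin 2) (Fin 2) ℝ) : IsRegular fun M => F (A * M * B) :=
  ⟨hF.1.comp (by fun_prop), fun _ hM => hF.2 _ (IsLaurent.matrix_mul
    (IsLaurent.matrix_mul (fun _ _ => IsLaurent.const _) hM) fun _ _ => IsLaurent.const _)⟩

theorem isRegular_eval_substMatrix (P : MvPolynomial (Fin 5 × Fin 5) ℝ) :
    IsRegular fun M => MvPolynomial.eval (fun ij => substMatrix 4 M ij.1 ij.2) P := by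
  refine ⟨?_, fun M hM => IsLaurent.eval_mvPolynomial P
    (f := fun ij t => substMatrix 4 (M t) ij.1 ij.2) fun ij => IsLaurent.substMatrix hM _ _⟩
  refine (MvPolynomial.continuous_eval P).comp (continuous_pi fun ij => ?_)
  have h := (continuous_apply ij.1).comp (continuous_substMatrix_four_mulVec (Pi.single ij.2 1))
  simpa [Function.comp_def, Matrix.mulVec_single_one] using h

/-- The diagonal matrix with entries `t` and `1 / t`. -/
noncomputable def diagMatrix (t : ℝ) : Matrix (Fin 2) (Fin 2) ℝ := !![t, 0; 0, t⁻¹]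

theorem isLaurent_diagMatrix (i j : Fin 2) : IsLaurent fun t => diagMatrix t i j := by
  fin_cases i <;> fin_cases j <;> simp [diagMatrix, IsLaurent.id, IsLaurent.inv, IsLaurent.const]

theorem eq_zero_of_forall_ne {f : ℝ → ℝ} (hf : Continuous f) (h : ∀ t, t ≠ 0 → f t = 0) (t : ℝ) :
    f t = 0 := by
  have : f = fun _ => 0 := Continuous.ext_on (dense_compl_singleton (0 : ℝ)) hf continuous_const
    fun t ht => h t ht
  rw [this]

theorem matrix_fin_two_congr {R : Type*} {a b c d a' b' c' d' : R} (ha : a = a') (hb : b = b')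
    (hc : c = c') (hd : d = d') : !![a, b; c, d] = !![a', b'; c', d'] := by
  rw [ha, hb, hc, hd]

/-- A regular function which vanishes on the products of three tori, the middle one being conjugated
by a matrix without zero entries, vanishes on `SL₂(ℝ)`. -/
theorem IsRegular.eq_zero_of_tori {F : Matrix (Fin 2) (Fin 2) ℝ → ℝ} (hF : IsRegular F)
    {p q r s : ℝ} (hd : p * s - q * r = 1) (hp : p ≠ 0) (hq : q ≠ 0) (hr : r ≠ 0) (hs : s ≠ 0)
    (h : ∀ t u v : ℝ, t ≠ 0 → u ≠ 0 → v ≠ 0 →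
      F (diagMatrix t * (!![p, q; r, s] * diagMatrix u * !![s, -q; -r, p]) * diagMatrix v) = 0)
    {a b c d : ℝ} (habcd : a * d - b * c = 1) : F !![a, b; c, d] = 0 := by
  set x : ℝ → ℝ := fun u => p * s * u - q * r * u⁻¹ with hx
  set y : ℝ → ℝ := fun u => -(p * q) * (u - u⁻¹) with hy
  set z : ℝ → ℝ := fun u => r * s * (u - u⁻¹) with hz
  set w : ℝ → ℝ := fun u => p * s * u⁻¹ - q * r * u with hw
  have hmid : ∀ t u v, diagMatrix t * (!![p, q; r, s] * diagMatrix u * !![s, -q; -r, p]) *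
      diagMatrix v = !![t * x u * v, t * y u * v⁻¹; t⁻¹ * z u * v, t⁻¹ * w u * v⁻¹] := by
    intro t u v
    simp only [diagMatrix, hx, hy, hz, hw, Matrix.mul_fin_two]
    exact matrix_fin_two_congr (by ring) (by ring) (by ring) (by ring)
  have hdet : ∀ u, u ≠ 0 → x u * w u - y u * z u = 1 := by
    intro u hu
    simp only [hx, hy, hz, hw]
    field_simp
    linear_combination (u ^ 2 * (p * s - q * r + 1)) * hd
  -- Only products `α β > 0` come directly from the tori; the Laurent property in `β` does the rest.
  have h1 : ∀ u α β : ℝ, u ≠ 0 → α ≠ 0 → β ≠ 0 →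
      F !![α * x u, β * y u; β⁻¹ * z u, α⁻¹ * w u] = 0 := by
    intro u α β hu hα hβ
    have hL : IsLaurent fun β => F !![α * x u, β * y u; β⁻¹ * z u, α⁻¹ * w u] := by
      refine hF.2 _ fun i j => ?_
      fin_cases i <;> fin_cases j <;> simp only [Matrix.of_apply, Matrix.cons_val_zero,
        Matrix.cons_val_one, Fin.zero_eta, Fin.mk_one]
      · exact IsLaurent.const _
      · exact IsLaurent.id.mul (IsLaurent.const _)
      · exact IsLaurent.inv.mul (IsLaurent.const _)
      · exact IsLaurent.const _
    have hinf : (Set.Ioi (0 : ℝ)).Infinite := Set.Ioi_infinite 0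
    have hinf' : ((fun s => α * s ^ 2) '' Set.Ioi (0 : ℝ)).Infinite := by
      refine hinf.image fun s hs s' hs' he => ?_
      exact (pow_left_inj₀ (le_of_lt hs) (le_of_lt hs') two_ne_zero).1 (mul_left_cancel₀ hα he)
    refine hL.eq_zero_of_infinite hinf' ?_ hβ
    rintro _ ⟨σ, hσ, rfl⟩
    have hσ0 : σ ≠ 0 := ne_of_gt hσ
    have := h (α * σ) u σ⁻¹ (mul_ne_zero hα hσ0) hu (inv_ne_zero hσ0)
    rw [hmid] at this
    convert this using 3
    ext i j
    fin_cases i <;> fin_cases j <;> simp <;> field_simp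
  set κ := -(p * q * r * s) with hκ
  have hκ0 : κ ≠ 0 := by rw [hκ]; simp [hp, hq, hr, hs]
  have hyz : ∀ u, y u * z u = κ * (u - u⁻¹) ^ 2 := fun u => by
    simp only [hy, hz, hκ]; ring
  -- The lower left entry takes a half-line of values, hence all values.
  have h2 : ∀ a b c : ℝ, a ≠ 0 → b ≠ 0 → c ≠ 0 → F !![a, b; c, (1 + b * c) * a⁻¹] = 0 := by
    intro a b c ha hb hc
    have hL : IsLaurent fun c => F !![a, b; c, (1 + b * c) * a⁻¹] := by
      refine hF.2 _ fun i j => ?_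
      fin_cases i <;> fin_cases j <;> simp only [Matrix.of_apply, Matrix.cons_val_zero,
        Matrix.cons_val_one, Fin.zero_eta, Fin.mk_one]
      · exact IsLaurent.const _
      · exact IsLaurent.const _
      · exact IsLaurent.id
      · exact ((IsLaurent.const _).add ((IsLaurent.const _).mul IsLaurent.id)).mul
          (IsLaurent.const _)
    have hinf' : ((fun s => κ * s ^ 2 / b) '' Set.Ioi (√(1 / |κ|))).Infinite := by
      refine (Set.Ioi_infinite _).image fun s hs s' hs' he => ?_
      have h0 : 0 ≤ s := (Real.sqrt_nonneg _).trans (le_of_lt hs)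
      have h0' : 0 ≤ s' := (Real.sqrt_nonneg _).trans (le_of_lt hs')
      exact (pow_left_inj₀ h0 h0' two_ne_zero).1
        (mul_left_cancel₀ hκ0 ((div_left_inj' hb).1 he))
    refine hL.eq_zero_of_infinite hinf' ?_ hc
    rintro _ ⟨σ, hσ, rfl⟩
    have hσ0 : 0 < σ := (Real.sqrt_nonneg _).trans_lt hσ
    have hσ1 : 1 < |κ| * σ ^ 2 := by
      have := (Real.sqrt_lt' hσ0).1 hσ
      rwa [div_lt_iff₀' (abs_pos.2 hκ0)] at this
    -- the positive solution of `u - 1 / u = σ`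
    set u := (σ + √(σ ^ 2 + 4)) / 2 with hu
    have hsq : √(σ ^ 2 + 4) ^ 2 = σ ^ 2 + 4 := Real.sq_sqrt (by positivity)
    have hu0 : u ≠ 0 := by positivity
    have huσ : u - u⁻¹ = σ := by
      field_simp
      rw [hu]
      linear_combination hsq / 4
    have hyz' := hyz u
    rw [huσ] at hyz'
    have hy0 : y u ≠ 0 := by
      simp only [hy, huσ]
      simp [hp, hq, hσ0.ne']
    have hxw : x u * w u = 1 + κ * σ ^ 2 := by linarith [hdet u hu0]
    have hx0 : x u ≠ 0 := by
      intro h0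
      rw [h0, zero_mul] at hxw
      have : |κ * σ ^ 2| = 1 := by rw [show κ * σ ^ 2 = -1 by linarith]; simp
      rw [abs_mul, abs_of_nonneg (sq_nonneg σ)] at this
      linarith
    have := h1 u (a / x u) (b / y u) hu0 (div_ne_zero ha hx0) (div_ne_zero hb hy0)
    convert this using 3
    ext i j
    fin_cases i <;> fin_cases j <;> simp
    · field_simp
    · field_simp
    · rw [← hyz']
      field_simp
    · field_simp
      rw [hxw]
  have h3 : ∀ a b c : ℝ, a ≠ 0 → F !![a, b; c, (1 + b * c) * a⁻¹] = 0 := by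
    intro a b c ha
    refine eq_zero_of_forall_ne (f := fun b => F !![a, b; c, (1 + b * c) * a⁻¹])
      (hF.1.comp ?_) (fun b hb => ?_) b
    · refine continuous_matrix fun i j => ?_
      fin_cases i <;> fin_cases j <;> simp <;> fun_prop
    · refine eq_zero_of_forall_ne (f := fun c => F !![a, b; c, (1 + b * c) * a⁻¹])
        (hF.1.comp ?_) (fun c hc => h2 a b c ha hb hc) c
      refine continuous_matrix fun i j => ?_
      fin_cases i <;> fin_cases j <;> simp <;> fun_prop
  by_cases ha : a = 0
  · have hb : b ≠ 0 := fun hb => by rw [ha, hb] at habcd; norm_num at habcd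
    have := eq_zero_of_forall_ne (f := fun a => F !![a, b; (a * d - 1) / b, d]) (hF.1.comp ?_)
      (fun a ha => ?_) a
    · convert this using 3
      ext i j
      fin_cases i <;> fin_cases j <;> simp
      field_simp
      linarith
    · refine continuous_matrix fun i j => ?_
      fin_cases i <;> fin_cases j <;> simp <;> fun_prop
    · convert h3 a b ((a * d - 1) / b) ha using 3
      ext i j
      fin_cases i <;> fin_cases j <;> simp
      field_simp
      ring
  · convert h3 a b c ha using 3
    ext i j
    fin_cases i <;> fin_cases j <;> simp
    field_simp
    linarith

/-! ### Non-elementary subgroups -/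

/-- The subgroups of `SL₂(ℝ)` which are unbounded, not conjugate to a group of upper triangular
matrices with diagonal entries `±1`, and not conjugate to a group of diagonal and antidiagonal
matrices. For discrete subgroups this means that they are non-elementary. -/
structure IsNonelementary (Γ : Subgroup SL(2, ℝ)) : Prop where
  unbounded : ∀ R : ℝ, ∃ γ ∈ Γ, ∃ i j, R < |γ.1 i j|
  not_parabolic : ∀ h : SL(2, ℝ), ∃ γ ∈ Γ, ¬ ((h⁻¹ * γ * h).1 1 0 = 0 ∧ |(h⁻¹ * γ * h).1 0 0| = 1)
  not_monomial : ∀ h : SL(2, ℝ), ∃ γ ∈ Γ,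
    ¬ (((h⁻¹ * γ * h).1 0 1 = 0 ∧ (h⁻¹ * γ * h).1 1 0 = 0) ∨
      ((h⁻¹ * γ * h).1 0 0 = 0 ∧ (h⁻¹ * γ * h).1 1 1 = 0))

theorem abs_mul_apply_le {g k : SL(2, ℝ)} {A B : ℝ} (hg : ∀ i j, |g.1 i j| ≤ A)
    (hk : ∀ i j, |k.1 i j| ≤ B) (i j : Fin 2) : |(g * k).1 i j| ≤ 2 * A * B := by
  rw [Matrix.SpecialLinearGroup.coe_mul, Matrix.mul_apply, Fin.sum_univ_two]
  have hA : 0 ≤ A := (abs_nonneg _).trans (hg 0 0)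
  refine (abs_add_le _ _).trans ?_
  rw [abs_mul, abs_mul]
  have h1 := mul_le_mul (hg i 0) (hk 0 j) (abs_nonneg _) hA
  have h2 := mul_le_mul (hg i 1) (hk 1 j) (abs_nonneg _) hA
  linarith

theorem exists_abs_entry_le (k : SL(2, ℝ)) : ∃ B, 0 ≤ B ∧ ∀ i j, |k.1 i j| ≤ B := by
  refine ⟨|k.1 0 0| + |k.1 0 1| + |k.1 1 0| + |k.1 1 1|, by positivity, fun i j => ?_⟩
  have a := abs_nonneg (k.1 0 0)
  have b := abs_nonneg (k.1 0 1)
  have c := abs_nonneg (k.1 1 0)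
  have d := abs_nonneg (k.1 1 1)
  fin_cases i <;> fin_cases j <;> simp <;> linarith

theorem isNonelementary_of_compactSpace {Γ : Subgroup SL(2, ℝ)}
    (h : CompactSpace (SL(2, ℝ) ⧸ Γ)) : IsNonelementary Γ := by
  obtain ⟨R, hR⟩ := exists_bound_of_compactSpace h
  have hR0 : 0 ≤ R := by
    obtain ⟨γ, -, h⟩ := hR 1
    exact (abs_nonneg _).trans (h 0 0)
  have hconj : ∀ k : SL(2, ℝ), ∃ S : ℝ, 0 ≤ S ∧ ∀ g : SL(2, ℝ), ∃ γ ∈ Γ,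
      ∀ i j, |(g * (k⁻¹ * γ * k)).1 i j| ≤ S := fun k => by
    obtain ⟨B, hB0, hB⟩ := exists_abs_entry_le k
    refine ⟨2 * R * B, by positivity, fun g => ?_⟩
    obtain ⟨γ, hγ, hb⟩ := hR (g * k⁻¹)
    refine ⟨γ, hγ, ?_⟩
    rw [show g * (k⁻¹ * γ * k) = (g * k⁻¹ * γ) * k by group]
    exact abs_mul_apply_le hb hB
  refine ⟨fun S => ?_, fun k => ?_, fun k => ?_⟩
  · by_contra! hcon
    have hS : 0 ≤ S := (abs_nonneg _).trans (hcon 1 Γ.one_mem 0 0)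
    set T := 2 * R * S + 1 with hT
    have hT0 : 0 < T := by positivity
    obtain ⟨γ, hγ, hb⟩ := hR (slMk T 0 0 T⁻¹ (by field_simp; ring))
    have := abs_mul_apply_le hb (hcon γ⁻¹ (Γ.inv_mem hγ)) 0 0
    rw [mul_inv_cancel_right] at this
    simp at this
    have := (le_abs_self T).trans this
    linarith
  · by_contra! hcon
    obtain ⟨S, hS0, hS⟩ := hconj k
    set T := S + 1 with hT
    have hT0 : 0 < T := by positivity
    obtain ⟨γ, hγ, hb⟩ := hS (slMk T 0 0 T⁻¹ (by field_simp; ring))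
    have hc := hcon γ hγ
    simp only [Matrix.SpecialLinearGroup.coe_mul (slMk T 0 0 T⁻¹ _), Matrix.mul_apply,
      Fin.sum_univ_two] at hb
    set D := (k⁻¹ * γ * k).1 with hD
    have h1 := hb 0 0
    simp at h1
    rw [hc.2, mul_one] at h1
    have := (le_abs_self T).trans h1
    linarith
  · by_contra! hcon
    obtain ⟨S, hS0, hS⟩ := hconj k
    set T := S ^ 2 + 1 with hT
    have hT0 : 0 < T := by positivity
    obtain ⟨γ, hγ, hb⟩ := hS (slMk 1 T 0 1 (by ring))
    have hc := hcon γ hγ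
    have hd := (k⁻¹ * γ * k).2
    rw [Matrix.det_fin_two] at hd
    simp only [Matrix.SpecialLinearGroup.coe_mul (slMk 1 T 0 1 _), Matrix.mul_apply,
      Fin.sum_univ_two] at hb
    set D := (k⁻¹ * γ * k).1 with hD
    have a00 := hb 0 0
    have a01 := hb 0 1
    have a10 := hb 1 0
    have a11 := hb 1 1
    simp at a00 a01 a10 a11
    rcases hc with ⟨h1, h2⟩ | ⟨h1, h2⟩
    · rw [h1, h2] at hd
      rw [h1, zero_add] at a01
      rw [h2, mul_zero, add_zero] at a00
      have h3 := mul_le_mul a00 a01 (abs_nonneg _) hS0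
      rw [← abs_mul, show D 0 0 * (T * D 1 1) = T by linear_combination T * hd] at h3
      have := (le_abs_self T).trans h3
      nlinarith
    · rw [h1, h2] at hd
      rw [h1, zero_add] at a00
      rw [h2, mul_zero, add_zero] at a01
      have h3 := mul_le_mul a00 a01 (abs_nonneg _) hS0
      rw [← abs_mul, show T * D 1 0 * D 0 1 = -T by linear_combination -T * hd, abs_neg] at h3
      have := (le_abs_self T).trans h3
      nlinarith

theorem mk_linearPower_eq {d : ℕ} {u w : Fin 2 → ℝ} (hu : u ≠ 0) (hw : w ≠ 0) {k : ℝ}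
    (h : u = k • w) : Projectivization.mk ℝ _ (linearPower_ne_zero (d := d) hu) =
      Projectivization.mk ℝ _ (linearPower_ne_zero (d := d) hw) := by
  rw [mk_eq_mk_iff_exists]
  have hk : k ≠ 0 := fun h0 => hu (by rw [h, h0, zero_smul])
  exact ⟨k ^ d, pow_ne_zero _ hk, by rw [h, linearPower_smul]⟩

/-- If the limit set is infinite the group is non-elementary. Otherwise some coefficient of
quadratic forms in a suitable basis would stay bounded along orbits; it would vanish at the limit
points, which leaves at most two of them. -/
theorem isNonelementary_of_infinite {Γ : Subgroup SL(2, ℝ)} [DiscreteTopology Γ]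
    (h : (limitSet hyperbolicPlane (Γ.map (rho 2))).Infinite) : IsNonelementary Γ := by
  have hlim : ∀ (k : SL(2, ℝ)) (S : Set SL(2, ℝ)) (φ : (Fin 3 → ℝ) → ℝ), Continuous φ →
      (∀ t c, φ (t • c) = t * φ c) → (∀ γ ∈ Γ, k⁻¹ * γ * k ∈ S) →
      (∀ c, ∃ B, ∀ D ∈ S, |φ (substMatrix 2 D.1 *ᵥ c)| ≤ B) →
      (∀ u : Fin 2 → ℝ, u ≠ 0 → φ (linearPower 2 u) = 0 → u 0 = 0 ∨ u 1 = 0) → False := by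
    intro k S φ hφ hφs hS hB hu
    have hne : ∀ w : Fin 2 → ℝ, w ≠ 0 → k⁻¹.1ᵀ *ᵥ w ≠ 0 := fun w hw h0 => hw (by
      have : k.1ᵀ *ᵥ (k⁻¹.1ᵀ *ᵥ w) = w := by
        rw [Matrix.mulVec_mulVec, ← Matrix.transpose_mul, ← Matrix.SpecialLinearGroup.coe_mul,
          inv_mul_cancel]
        simp
      rw [← this, h0, Matrix.mulVec_zero])
    have e0 : (![1, 0] : Fin 2 → ℝ) ≠ 0 := by simp
    have e1 : (![0, 1] : Fin 2 → ℝ) ≠ 0 := by simp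
    refine h ((Set.toFinite {Projectivization.mk ℝ _ (linearPower_ne_zero (d := 2) (hne _ e0)),
      Projectivization.mk ℝ _ (linearPower_ne_zero (d := 2) (hne _ e1))}).subset ?_)
    intro p hp
    obtain ⟨u, hu0, c, t, γ, rfl, -, ht, hγ, ht0, hlim⟩ := limitSet_hyperbolicPlane hp
    set u' := k.1ᵀ *ᵥ u with hu'
    have hback : k⁻¹.1ᵀ *ᵥ u' = u := by
      rw [hu', Matrix.mulVec_mulVec, ← Matrix.transpose_mul, ← Matrix.SpecialLinearGroup.coe_mul,
        mul_inv_cancel]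
      simp
    have hu'0 : u' ≠ 0 := fun h0 => hu0 (by rw [← hback, h0, Matrix.mulVec_zero])
    have hlim' : Tendsto (fun n => t n * φ (substMatrix 2 (k⁻¹ * γ n * k).1 *ᵥ
        (substMatrix 2 k.1 *ᵥ c))) atTop (𝓝 (φ (linearPower 2 u'))) := by
      have hc : Continuous fun v : Fin 3 → ℝ => φ (substMatrix 2 k.1 *ᵥ v) :=
        hφ.comp (by fun_prop)
      have := (hc.tendsto _).comp hlim
      rw [subst_linearPower] at this
      refine this.congr fun n => ?_
      rw [Function.comp_apply, Matrix.mulVec_smul, hφs, ← substMatrix_coe_mul_mulVec,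
        ← substMatrix_coe_mul_mulVec, show k * (k⁻¹ * γ n * k) = γ n * k by group]
    obtain ⟨B, hB⟩ := hB (substMatrix 2 k.1 *ᵥ c)
    have hz : φ (linearPower 2 u') = 0 := by
      refine tendsto_nhds_unique hlim' (squeeze_zero_norm (a := fun n => t n * B) (fun n => ?_) ?_)
      · rw [Real.norm_eq_abs, abs_mul, abs_of_pos (ht n)]
        exact mul_le_mul_of_nonneg_left (hB _ (hS _ (hγ n))) (ht n).le
      · simpa using ht0.mul_const B
    rcases hu u' hu'0 hz with h0 | h0
    · refine Or.inr (mk_linearPower_eq hu0 (hne _ e1) (k := u' 1) ?_)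
      rw [← Matrix.mulVec_smul]
      conv_lhs => rw [← hback]
      congr 1
      ext i; fin_cases i <;> simp [h0]
    · refine Or.inl (mk_linearPower_eq hu0 (hne _ e0) (k := u' 0) ?_)
      rw [← Matrix.mulVec_smul]
      conv_lhs => rw [← hback]
      congr 1
      ext i; fin_cases i <;> simp [h0]
  have hsub : ∀ (g : SL(2, ℝ)) (c : Fin 3 → ℝ), substMatrix 2 g.1 *ᵥ c =
      substMatrix 2 !![g.1 0 0, g.1 0 1; g.1 1 0, g.1 1 1] *ᵥ c := fun g c => by
    rw [← Matrix.eta_fin_two]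
  refine ⟨fun R => ?_, fun k => ?_, fun k => ?_⟩
  · by_contra! hcon
    obtain ⟨p, hp⟩ := h.nonempty
    refine hlim 1 {g | ∀ i j, |g.1 i j| ≤ R} (fun c => c 2) (by fun_prop) (fun t c => by simp)
      (fun γ hγ i j => by simpa using hcon γ hγ i j) (fun c => ?_) (fun u _ hu => ?_)
    · refine ⟨|c 0| * R ^ 2 + |c 1| * (R * R) + |c 2| * R ^ 2, fun D hD => ?_⟩
      have h0 : 0 ≤ R := (abs_nonneg _).trans (hD 0 0)
      rw [hsub, substMatrix_two_mulVec]
      refine (abs_add_three _ _ _).trans ?_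
      rw [abs_mul, abs_mul, abs_mul, abs_mul, abs_pow, abs_pow]
      have h1 := hD 0 0
      have h2 := hD 1 0
      gcongr
    · rw [linearPower_two] at hu
      simp at hu
      exact Or.inl hu
  · by_contra! hcon
    refine hlim k {g | g.1 1 0 = 0 ∧ |g.1 0 0| = 1} (fun c => c 2) (by fun_prop)
      (fun t c => by simp) (fun γ hγ => hcon γ hγ) (fun c => ⟨|c 2|, ?_⟩) (fun u _ hu => ?_)
    · rintro D ⟨h0, h1⟩
      rw [hsub, substMatrix_two_mulVec, h0]
      simp [abs_mul, h1]
    · rw [linearPower_two] at hu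
      simp at hu
      exact Or.inl hu
  · by_contra! hcon
    refine hlim k {g | (g.1 0 1 = 0 ∧ g.1 1 0 = 0) ∨ (g.1 0 0 = 0 ∧ g.1 1 1 = 0)} (fun c => c 1)
      (by fun_prop) (fun t c => by simp) (fun γ hγ => hcon γ hγ) (fun c => ⟨|c 1|, ?_⟩)
      (fun u _ hu => ?_)
    · rintro D (⟨h0, h1⟩ | ⟨h0, h1⟩)
      · have hd := D.2
        rw [Matrix.det_fin_two, h0, h1, mul_zero, sub_zero] at hd
        rw [hsub, substMatrix_two_mulVec, h0, h1]
        simp [hd]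
      · have hd := D.2
        rw [Matrix.det_fin_two, h0, h1, mul_zero, zero_sub] at hd
        rw [hsub, substMatrix_two_mulVec, h0, h1]
        have hd' : |D.1 0 1 * D.1 1 0| = 1 := by rw [← abs_neg, hd, abs_one]
        simp [hd']
    · rw [linearPower_two] at hu
      simpa using hu

/-- Non-elementary groups contain hyperbolic elements. Otherwise the traces are bounded, and a limit
`M` of normalized elements going to infinity is nilpotent with `tr (M γ) = 0` for all `γ`, so that
the group fixes the kernel of `M`. -/
theorem IsNonelementary.exists_hyperbolic {Γ : Subgroup SL(2, ℝ)} (hΓ : IsNonelementary Γ) :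
    ∃ γ ∈ Γ, 2 < |γ.1.trace| := by
  by_contra! htr
  have hun : ∀ n : ℕ, ∃ γ ∈ Γ, ∃ N : ℝ, (n : ℝ) < N ∧ (∀ i j, |γ.1 i j| ≤ N) ∧
      ∃ i j, |γ.1 i j| = N := by
    intro n
    obtain ⟨γ, hγ, i, j, hij⟩ := hΓ.unbounded n
    obtain ⟨k, -, hk⟩ := Finset.exists_max_image (Finset.univ : Finset (Fin 2 × Fin 2))
      (fun k => |γ.1 k.1 k.2|) Finset.univ_nonempty
    exact ⟨γ, hγ, |γ.1 k.1 k.2|, hij.trans_le (hk (i, j) (Finset.mem_univ _)),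
      fun i j => hk (i, j) (Finset.mem_univ _), k.1, k.2, rfl⟩
  choose γ hγ N hN hle ij hij using hun
  choose jj hij using hij
  have hN0 : ∀ n, 0 < N n := fun n => (Nat.cast_nonneg n).trans_lt (hN n)
  have hNinv : Tendsto (fun n => (N n)⁻¹) atTop (𝓝 0) :=
    tendsto_inv_atTop_zero.comp (tendsto_atTop_mono (fun n => (hN n).le)
      tendsto_natCast_atTop_atTop)
  have hK : IsCompact {A : Matrix (Fin 2) (Fin 2) ℝ | (∀ i j, |A i j| ≤ 1) ∧
      1 ≤ ∑ i, ∑ j, |A i j|} := by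
    have h1 := isCompact_univ_pi fun _ : Fin 2 => isCompact_univ_pi fun _ : Fin 2 =>
      isCompact_Icc (a := (-1 : ℝ)) (b := 1)
    have h2 : IsClosed {A : Matrix (Fin 2) (Fin 2) ℝ | 1 ≤ ∑ i, ∑ j, |A i j|} :=
      isClosed_le continuous_const (continuous_finsetSum _ fun i _ => continuous_finsetSum _
        fun j _ => (continuous_id.matrix_elem i j).abs)
    have h3 : {A : Matrix (Fin 2) (Fin 2) ℝ | (∀ i j, |A i j| ≤ 1) ∧ 1 ≤ ∑ i, ∑ j, |A i j|} =
        {A : Matrix (Fin 2) (Fin 2) ℝ | ∀ i j, |A i j| ≤ 1} ∩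
          {A : Matrix (Fin 2) (Fin 2) ℝ | 1 ≤ ∑ i, ∑ j, |A i j|} := rfl
    rw [h3]
    refine IsCompact.inter_right ?_ h2
    have h4 : {A : Matrix (Fin 2) (Fin 2) ℝ | ∀ i j, |A i j| ≤ 1} =
        Set.univ.pi fun _ : Fin 2 => Set.univ.pi fun _ : Fin 2 => Set.Icc (-1 : ℝ) 1 :=
      Set.ext fun A => ⟨fun h i _ j _ => abs_le.1 (h i j),
        fun h i j => abs_le.2 (h i trivial j trivial)⟩
    rw [h4]
    exact h1
  have : FirstCountableTopology (Matrix (Fin 2) (Fin 2) ℝ) :=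
    inferInstanceAs (FirstCountableTopology (Fin 2 → Fin 2 → ℝ))
  obtain ⟨M, ⟨-, hM1⟩, φ, hφ, hlim⟩ := hK.tendsto_subseq (x := fun n => (N n)⁻¹ • (γ n).1)
    (fun n => by
      have h0 : ∀ i j, |((N n)⁻¹ • (γ n).1) i j| = (N n)⁻¹ * |(γ n).1 i j| := fun i j => by
        rw [Matrix.smul_apply, smul_eq_mul, abs_mul, abs_of_pos (inv_pos.2 (hN0 n))]
      refine ⟨fun i j => ?_, ?_⟩
      · rw [h0, inv_mul_le_one₀ (hN0 n)]
        exact hle n i j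
      · have h1 : |((N n)⁻¹ • (γ n).1) (ij n) (jj n)| = 1 := by
          rw [h0, hij, inv_mul_cancel₀ (hN0 n).ne']
        exact h1.symm.le.trans <|
          (Finset.single_le_sum (f := fun j => |((N n)⁻¹ • (γ n).1) (ij n) j|)
          (fun j _ => abs_nonneg _) (Finset.mem_univ (jj n))).trans
          (Finset.single_le_sum (f := fun i => ∑ j, |((N n)⁻¹ • (γ n).1) i j|)
          (fun i _ => Finset.sum_nonneg fun j _ => abs_nonneg _) (Finset.mem_univ (ij n))))
  have hMne : M ≠ 0 := by
    rintro rfl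
    simp at hM1
    norm_num at hM1
  have hNφ := hNinv.comp hφ.tendsto_atTop
  have hdet : M.det = 0 := by
    have h1 : Tendsto (fun n => ((N (φ n))⁻¹ • (γ (φ n)).1).det) atTop (𝓝 M.det) :=
      ((continuous_id.matrix_det).tendsto M).comp hlim
    refine tendsto_nhds_unique h1 ?_
    have h2 := hNφ.mul hNφ
    rw [mul_zero] at h2
    refine h2.congr fun n => ?_
    rw [Matrix.det_smul, (γ (φ n)).2, Fintype.card_fin]
    simp [sq]
  have htrM : ∀ δ ∈ Γ, (M * δ.1).trace = 0 := by
    intro δ hδ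
    have h1 : Tendsto (fun n => (((N (φ n))⁻¹ • (γ (φ n)).1) * δ.1).trace) atTop
        (𝓝 (M * δ.1).trace) := by
      have hc : Continuous fun A : Matrix (Fin 2) (Fin 2) ℝ => (A * δ.1).trace :=
        (continuous_id.matrix_mul continuous_const).matrix_trace
      exact (hc.tendsto M).comp hlim
    refine tendsto_nhds_unique h1 (squeeze_zero_norm (a := fun n => (N (φ n))⁻¹ * 2)
      (fun n => ?_) (by simpa using hNφ.mul_const 2))
    rw [Matrix.smul_mul, Matrix.trace_smul, smul_eq_mul, Real.norm_eq_abs, abs_mul,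
      abs_of_pos (inv_pos.2 (hN0 _))]
    exact mul_le_mul_of_nonneg_left (htr _ (Γ.mul_mem (hγ _) hδ)) (inv_pos.2 (hN0 _)).le
  have htr1 : M.trace = 0 := by simpa using htrM 1 Γ.one_mem
  rw [Matrix.det_fin_two] at hdet
  rw [Matrix.trace_fin_two] at htr1
  -- a vector `v` spanning the image and the kernel of `M`, and a linear form `w` with `M = v wᵀ`
  obtain ⟨v, hv, x, hx, hM⟩ : ∃ v : Fin 2 → ℝ, v ≠ 0 ∧ ∃ x : ℝ, x ≠ 0 ∧
      M = x • !![-(v 0 * v 1), v 0 ^ 2; -v 1 ^ 2, v 0 * v 1] := by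
    have e11 : M 1 1 = -M 0 0 := by linarith
    by_cases h01 : M 0 1 = 0
    · have h00 : M 0 0 = 0 := by
        rw [h01, e11] at hdet
        have : M 0 0 ^ 2 = 0 := by linarith
        simpa using this
      refine ⟨![0, 1], by simp, -M 1 0, fun h => hMne ?_, ?_⟩
      · ext i j
        fin_cases i <;> fin_cases j <;> simp [h00, h01, e11]
        linarith
      · ext i j
        fin_cases i <;> fin_cases j <;> simp [h00, h01, e11]
    · refine ⟨![M 0 1, -M 0 0], by simp [h01], (M 0 1)⁻¹, inv_ne_zero h01, ?_⟩
      rw [e11] at hdet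
      ext i j
      fin_cases i <;> fin_cases j <;> simp [e11] <;> field_simp
      linarith
  obtain ⟨h, hh⟩ := exists_slMk_column hv
  obtain ⟨δ, hδ, hno⟩ := hΓ.not_parabolic h
  refine hno ?_
  have h00 : h.1 0 0 = v 0 := by
    have := congrFun hh 0
    simpa [Matrix.mulVec, dotProduct, Fin.sum_univ_two] using this
  have h10 : h.1 1 0 = v 1 := by
    have := congrFun hh 1
    simpa [Matrix.mulVec, dotProduct, Fin.sum_univ_two] using this
  have hlow : (h⁻¹ * δ * h).1 1 0 = 0 := by
    have h1 := htrM δ hδ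
    rw [hM, Matrix.smul_mul, Matrix.trace_smul, smul_eq_mul] at h1
    have h2 := (mul_eq_zero.1 h1).resolve_left hx
    rw [Matrix.trace_fin_two] at h2
    simp [Matrix.mul_apply, Fin.sum_univ_two] at h2
    rw [Matrix.SpecialLinearGroup.coe_mul, Matrix.SpecialLinearGroup.coe_mul,
      Matrix.SpecialLinearGroup.coe_inv, Matrix.adjugate_fin_two]
    simp [Matrix.mul_apply, Matrix.vecMul, dotProduct, Fin.sum_univ_two, h00, h10]
    linarith
  refine ⟨hlow, ?_⟩
  have htrδ : (h⁻¹ * δ * h).1.trace = δ.1.trace := by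
    rw [Matrix.SpecialLinearGroup.coe_mul, Matrix.trace_mul_comm,
      ← Matrix.SpecialLinearGroup.coe_mul, show h * (h⁻¹ * δ) = δ by group]
  have hdd := (h⁻¹ * δ * h).2
  have hb := htr δ hδ
  rw [← htrδ, Matrix.trace_fin_two] at hb
  rw [Matrix.det_fin_two, hlow, mul_zero, sub_zero] at hdd
  set a := (h⁻¹ * δ * h).1 0 0
  set d := (h⁻¹ * δ * h).1 1 1
  have h4 : (a + d) ^ 2 ≤ 2 ^ 2 := sq_le_sq' (by linarith [abs_le.1 hb]) (abs_le.1 hb).2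
  have h5 : a = d := by nlinarith [sq_nonneg (a - d)]
  rw [← h5] at hdd
  rcases mul_self_eq_one_iff.1 hdd with h6 | h6 <;> rw [h6] <;> simp

theorem exists_conj_diagMatrix {γ : SL(2, ℝ)} (hγ : 2 < |γ.1.trace|) :
    ∃ (h : SL(2, ℝ)) (l : ℝ), l ≠ 0 ∧ l ^ 2 ≠ 1 ∧ (h⁻¹ * γ * h).1 = diagMatrix l := by
  suffices H : ∃ (h : SL(2, ℝ)) (l : ℝ), l ≠ 0 ∧ l ^ 2 ≠ 1 ∧ γ.1 * h.1 = h.1 * diagMatrix l by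
    obtain ⟨h, l, h0, h1, he⟩ := H
    refine ⟨h, l, h0, h1, ?_⟩
    rw [mul_assoc, Matrix.SpecialLinearGroup.coe_mul, Matrix.SpecialLinearGroup.coe_mul γ, he,
      ← Matrix.mul_assoc, ← Matrix.SpecialLinearGroup.coe_mul, inv_mul_cancel]
    simp
  obtain ⟨a, b, c, d, hd, rfl⟩ := exists_eq_slMk γ
  rw [slMk_val, Matrix.trace_fin_two_of] at hγ
  have hsq : 2 ^ 2 < (a + d) ^ 2 := by rwa [sq_lt_sq, abs_two]
  by_cases hc : c = 0
  · subst hc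
    have had : a * d = 1 := by linarith
    have ha : a ≠ 0 := left_ne_zero_of_mul_eq_one had
    have hda : d = a⁻¹ := eq_inv_of_mul_eq_one_right had
    have hne : d - a ≠ 0 := fun h => by nlinarith
    refine ⟨slMk 1 (b / (d - a)) 0 1 (by ring), a, ha, fun h1 => hne ?_, ?_⟩
    · have : a * (d - a) = 0 := by linarith
      exact (mul_eq_zero.1 this).resolve_left ha
    · rw [slMk_val, slMk_val, diagMatrix, ← hda, Matrix.mul_fin_two, Matrix.mul_fin_two]
      refine matrix_fin_two_congr (by ring) ?_ (by ring) (by ring)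
      field_simp
      ring
  · set σ := √((a + d) ^ 2 - 4) with hσ
    have hσ2 : σ ^ 2 = (a + d) ^ 2 - 4 := Real.sq_sqrt (by linarith)
    have hσ0 : 0 < σ := Real.sqrt_pos.2 (by linarith)
    set l := (a + d + σ) / 2 with hl
    have hll : l * ((a + d - σ) / 2) = 1 := by rw [hl]; linear_combination -hσ2 / 4
    have hl0 : l ≠ 0 := left_ne_zero_of_mul_eq_one hll
    have hli : l⁻¹ = (a + d - σ) / 2 := (eq_inv_of_mul_eq_one_right hll).symm
    refine ⟨slMk (l - d) ((l⁻¹ - d) / (c * σ)) c (1 / σ) ?_, l, hl0, fun h1 => ?_, ?_⟩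
    · rw [hli, hl]
      field_simp
      ring
    · have : l = l⁻¹ := by
        field_simp
        exact h1
      rw [hli, hl] at this
      linarith
    · rw [slMk_val, slMk_val, diagMatrix, Matrix.mul_fin_two, Matrix.mul_fin_two]
      have q1 : l ^ 2 = (a + d) * l - 1 := by rw [hl]; linear_combination hσ2 / 4
      have q2 : l⁻¹ ^ 2 = (a + d) * l⁻¹ - 1 := by rw [hli]; linear_combination hσ2 / 4
      refine matrix_fin_two_congr ?_ ?_ (by ring) ?_
      · linear_combination -q1 - hd
      · have : b = (a * d - 1) / c := by field_simp; linarith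
        rw [this]
        generalize l⁻¹ = k at q2
        field_simp
        linear_combination -q2
      · generalize l⁻¹ = k at q2
        field_simp
        ring

/-- Discrete subgroups containing a hyperbolic diagonal matrix contain no element fixing exactly one
of its two fixed points, since conjugation would contract its commutators with the diagonal one. -/
theorem eq_zero_of_triangular {Γ : Subgroup SL(2, ℝ)}
    (hfin : ∀ R : ℝ, {g : SL(2, ℝ) | g ∈ Γ ∧ ∀ i j, |g.1 i j| ≤ R}.Finite) {l : ℝ} (hl0 : l ≠ 0)
    (hl : l ^ 2 ≠ 1) (hlΓ : slMk l 0 0 l⁻¹ (by field_simp; simp) ∈ Γ) {δ : SL(2, ℝ)} (hδ : δ ∈ Γ) :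
    (δ.1 1 0 = 0 → δ.1 0 1 = 0) ∧ (δ.1 0 1 = 0 → δ.1 1 0 = 0) := by
  have hmulmk : ∀ (p q r s p' q' r' s' : ℝ) (h : p * s - q * r = 1) (h' : p' * s' - q' * r' = 1),
      slMk p q r s h * slMk p' q' r' s' h' =
        slMk (p * p' + q * r') (p * q' + q * s') (r * p' + s * r') (r * q' + s * s')
          (by linear_combination (p' * s' - q' * r') * h + h') := by
    intros
    refine Subtype.ext ?_
    rw [Matrix.SpecialLinearGroup.coe_mul, slMk_val, slMk_val, slMk_val, Matrix.mul_fin_two]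
  have hmk : ∀ {p q r s p' q' r' s' : ℝ} {h : p * s - q * r = 1} {h' : p' * s' - q' * r' = 1},
      p = p' → q = q' → r = r' → s = s' → slMk p q r s h = slMk p' q' r' s' h' := by
    intros; subst_vars; rfl
  have hinv : ∀ (p q r s : ℝ) (h : p * s - q * r = 1),
      (slMk p q r s h)⁻¹ = slMk s (-q) (-r) p (by linarith) := by
    intro p q r s h
    refine inv_eq_of_mul_eq_one_right (Subtype.ext ?_)
    rw [Matrix.SpecialLinearGroup.coe_mul, slMk_val, slMk_val, Matrix.mul_fin_two,
      Matrix.SpecialLinearGroup.coe_one, Matrix.one_fin_two]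
    exact matrix_fin_two_congr (by linarith) (by ring) (by ring) (by linarith)
  have hlinv := Γ.inv_mem hlΓ
  rw [hinv] at hlinv
  obtain ⟨m, hm0, hm1, hmΓ⟩ : ∃ (m : ℝ) (hm : m ≠ 0), |m| < 1 ∧
      slMk m 0 0 m⁻¹ (by field_simp; simp) ∈ Γ := by
    rcases lt_trichotomy |l| 1 with h | h | h
    · exact ⟨l, hl0, h, hlΓ⟩
    · exact absurd (by rw [← sq_abs, h, one_pow]) hl
    · refine ⟨l⁻¹, inv_ne_zero hl0, by rw [abs_inv]; exact inv_lt_one_of_one_lt₀ h, ?_⟩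
      convert hlinv using 1
      exact hmk rfl (by simp) (by simp) (by simp)
  have hmΓ' := Γ.inv_mem hmΓ
  rw [hinv] at hmΓ'
  have hm2 : 0 < m ^ 2 := by positivity
  have hm21 : m ^ 2 < 1 := by rw [← sq_abs]; exact pow_lt_one₀ (abs_nonneg _) hm1 two_ne_zero
  have hinj : ∀ x : ℝ, x ≠ 0 → ∀ n k : ℕ, (m ^ 2) ^ n * x = (m ^ 2) ^ k * x → n = k := by
    intro x hx n k h
    exact (pow_right_strictAnti₀ hm2 hm21).injective (mul_right_cancel₀ hx h)
  have hup : ∀ x : ℝ, slMk 1 x 0 1 (by ring) ∈ Γ → x = 0 := by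
    intro x hx
    by_contra hx0
    have hn : ∀ n : ℕ, slMk 1 ((m ^ 2) ^ n * x) 0 1 (by ring) ∈ Γ := by
      intro n
      induction n with
      | zero => convert hx using 1; exact hmk rfl (by simp) rfl rfl
      | succ n ih =>
        have := Γ.mul_mem (Γ.mul_mem hmΓ ih) hmΓ'
        rw [hmulmk, hmulmk] at this
        convert this using 1
        refine hmk ?_ ?_ ?_ ?_ <;> field_simp <;> ring
    refine Set.infinite_of_injective_forall_mem (f := fun n : ℕ =>
      slMk 1 ((m ^ 2) ^ n * x) 0 1 (by ring)) (fun n k h => hinj x hx0 n k ?_) (fun n => ?_)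
      (hfin (1 + |x|))
    · exact congrFun (congrFun (congrArg Subtype.val h) 0) 1
    · refine ⟨hn n, fun i j => ?_⟩
      have h1 : |(m ^ 2) ^ n * x| ≤ |x| := by
        rw [abs_mul, abs_of_pos (pow_pos hm2 n)]
        exact mul_le_of_le_one_left (abs_nonneg _) (pow_le_one₀ hm2.le hm21.le)
      have h2 := abs_nonneg x
      rw [slMk_val]
      fin_cases i <;> fin_cases j
      · simp
      · exact h1.trans (by linarith)
      · simp; positivity
      · simp
  have hlo : ∀ x : ℝ, slMk 1 0 x 1 (by ring) ∈ Γ → x = 0 := by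
    intro x hx
    by_contra hx0
    have hn : ∀ n : ℕ, slMk 1 0 ((m ^ 2) ^ n * x) 1 (by ring) ∈ Γ := by
      intro n
      induction n with
      | zero => convert hx using 1; exact hmk rfl rfl (by simp) rfl
      | succ n ih =>
        have := Γ.mul_mem (Γ.mul_mem hmΓ' ih) hmΓ
        rw [hmulmk, hmulmk] at this
        convert this using 1
        refine hmk ?_ ?_ ?_ ?_ <;> field_simp <;> ring
    refine Set.infinite_of_injective_forall_mem (f := fun n : ℕ =>
      slMk 1 0 ((m ^ 2) ^ n * x) 1 (by ring)) (fun n k h => hinj x hx0 n k ?_) (fun n => ?_)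
      (hfin (1 + |x|))
    · exact congrFun (congrFun (congrArg Subtype.val h) 1) 0
    · refine ⟨hn n, fun i j => ?_⟩
      have h1 : |(m ^ 2) ^ n * x| ≤ |x| := by
        rw [abs_mul, abs_of_pos (pow_pos hm2 n)]
        exact mul_le_of_le_one_left (abs_nonneg _) (pow_le_one₀ hm2.le hm21.le)
      have h2 := abs_nonneg x
      rw [slMk_val]
      fin_cases i <;> fin_cases j
      · simp
      · simp; positivity
      · exact h1.trans (by linarith)
      · simp
  have hm2' : 1 - m ^ 2 ≠ 0 := by linarith
  obtain ⟨p, q, r, s, hd, rfl⟩ := exists_eq_slMk δ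
  have hδ' := Γ.inv_mem hδ
  rw [hinv] at hδ'
  simp only [slMk_val, Matrix.of_apply, Matrix.cons_val_one, Matrix.cons_val_zero,
    Matrix.cons_val_fin_one]
  constructor
  · rintro rfl
    have := Γ.mul_mem (Γ.mul_mem hδ hmΓ) (Γ.mul_mem hδ' hmΓ')
    rw [hmulmk, hmulmk, hmulmk] at this
    have hd' : p * s = 1 := by linarith
    simp only [neg_zero, mul_zero, zero_mul, add_zero, zero_add] at this
    have hp : p ≠ 0 := fun h => by rw [h] at hd; norm_num at hd
    have h0 := hup (p * q * (1 - m ^ 2)) (by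
      convert this using 1
      refine hmk ?_ ?_ ?_ ?_ <;> field_simp <;> linarith)
    simpa [hp, hm2'] using h0
  · rintro rfl
    have := Γ.mul_mem (Γ.mul_mem hδ hmΓ') (Γ.mul_mem hδ' hmΓ)
    rw [hmulmk, hmulmk, hmulmk] at this
    have hd' : p * s = 1 := by linarith
    simp only [neg_zero, mul_zero, zero_mul, add_zero, zero_add] at this
    have hs : s ≠ 0 := fun h => by rw [h] at hd; norm_num at hd
    have h0 := hlo (r * s * (1 - m ^ 2)) (by
      convert this using 1
      refine hmk ?_ ?_ ?_ ?_ <;> field_simp <;> linarith)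
    simpa [hs, hm2'] using h0

/-- A discrete group containing a hyperbolic diagonal matrix, and not contained in the normalizer of
the diagonal group, contains a matrix without zero entries. -/
theorem exists_forall_entry_ne_zero {Γ : Subgroup SL(2, ℝ)}
    (hfin : ∀ R : ℝ, {g : SL(2, ℝ) | g ∈ Γ ∧ ∀ i j, |g.1 i j| ≤ R}.Finite) {l : ℝ} (hl0 : l ≠ 0)
    (hl : l ^ 2 ≠ 1) (hlΓ : slMk l 0 0 l⁻¹ (by field_simp; simp) ∈ Γ)
    (hmon : ∃ γ ∈ Γ, ¬ ((γ.1 0 1 = 0 ∧ γ.1 1 0 = 0) ∨ (γ.1 0 0 = 0 ∧ γ.1 1 1 = 0))) :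
    ∃ δ ∈ Γ, ∀ i j, δ.1 i j ≠ 0 := by
  by_contra! hcon
  have hfull : ∀ δ ∈ Γ, δ.1 0 0 = 0 ∨ δ.1 0 1 = 0 ∨ δ.1 1 0 = 0 ∨ δ.1 1 1 = 0 := by
    intro δ hδ
    obtain ⟨i, j, h⟩ := hcon δ hδ
    fin_cases i <;> fin_cases j <;> simp at h <;> tauto
  have htri := fun δ hδ => eq_zero_of_triangular hfin hl0 hl hlΓ (δ := δ) hδ
  obtain ⟨γ, hγ, hmon⟩ := hmon
  have hr : γ.1 1 0 ≠ 0 := fun h => hmon (Or.inl ⟨(htri γ hγ).1 h, h⟩)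
  have hq : γ.1 0 1 ≠ 0 := fun h => hmon (Or.inl ⟨h, (htri γ hγ).2 h⟩)
  -- Exactly one diagonal entry of `γ` vanishes; the square of `γ`, or its product with a
  -- hyperbolic diagonal matrix in the middle, has no zero entry.
  have h1 := hfull _ (Γ.mul_mem hγ hγ)
  have h2 := hfull _ (Γ.mul_mem (Γ.mul_mem hγ hlΓ) hγ)
  have h0 := hfull γ hγ
  obtain ⟨p, q, r, s, hd, rfl⟩ := exists_eq_slMk γ
  simp only [Matrix.SpecialLinearGroup.coe_mul, slMk_val, Matrix.mul_fin_two] at h0 h1 h2 hr hq hmon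
  simp only [Matrix.of_apply, Matrix.cons_val_one, Matrix.cons_val_zero,
    Matrix.cons_val_fin_one] at h0 h1 h2 hr hq hmon
  rw [or_iff_right hq, or_iff_right hr] at h0
  rcases h0 with rfl | rfl
  · have hs : s ≠ 0 := fun h => hmon (Or.inr ⟨rfl, h⟩)
    have hqr : q * r = -1 := by linarith
    have e1 : s ^ 2 = 1 := by
      rcases h1 with h | h | h | h
      · linarith
      · simp [hq, hs] at h
      · simp [hr, hs] at h
      · linarith
    have e2 : s ^ 2 = l ^ 2 := by
      rcases h2 with h | h | h | h
      · simp [hq, hr, hl0] at h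
      · simp [hq, hs, hl0] at h
      · simp [hr, hs, hl0] at h
      · field_simp at h
        linear_combination h - l ^ 2 * hqr
    exact hl (e2.symm.trans e1)
  · have hp : p ≠ 0 := fun h => hmon (Or.inr ⟨h, rfl⟩)
    have hqr : q * r = -1 := by linarith
    have e1 : p ^ 2 = 1 := by
      rcases h1 with h | h | h | h
      · linarith
      · simp [hq, hp] at h
      · simp [hr, hp] at h
      · linarith
    have e2 : p ^ 2 * l ^ 2 = 1 := by
      rcases h2 with h | h | h | h
      · field_simp at h
        linear_combination h - hqr
      · simp [hq, hp, hl0] at h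
      · simp [hr, hp, hl0] at h
      · simp [hq, hr, hl0] at h
    rw [e1, one_mul] at e2
    exact hl e2

/-- Regular functions vanishing on a non-elementary discrete group vanish on `SL₂(ℝ)`. -/
theorem IsNonelementary.eq_zero_of_isRegular {Γ : Subgroup SL(2, ℝ)} [DiscreteTopology Γ]
    (hΓ : IsNonelementary Γ) {F : Matrix (Fin 2) (Fin 2) ℝ → ℝ} (hF : IsRegular F)
    (h0 : ∀ γ ∈ Γ, F γ.1 = 0) (g : SL(2, ℝ)) : F g.1 = 0 := by
  obtain ⟨γ, hγ, htr⟩ := hΓ.exists_hyperbolic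
  obtain ⟨h, l, hl0, hl, hdiag⟩ := exists_conj_diagMatrix htr
  set Γ' := Γ.map (MulAut.conj h⁻¹).toMonoidHom with hΓ'
  have hmem : ∀ δ, δ ∈ Γ' ↔ ∃ γ ∈ Γ, h⁻¹ * γ * h = δ := fun δ => by
    rw [hΓ', Subgroup.mem_map]
    simp
  have hfin : ∀ R : ℝ, {g : SL(2, ℝ) | g ∈ Γ' ∧ ∀ i j, |g.1 i j| ≤ R}.Finite := by
    intro R
    obtain ⟨B, hB0, hB⟩ := exists_abs_entry_le h
    obtain ⟨B', hB0', hB'⟩ := exists_abs_entry_le h⁻¹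
    refine ((finite_inter_slBox Γ (2 * (2 * B * R) * B')).image fun g => h⁻¹ * g * h).subset ?_
    rintro δ ⟨hδ, hb⟩
    obtain ⟨γ, hγ, rfl⟩ := (hmem δ).1 hδ
    refine ⟨γ, ⟨hγ, ?_⟩, rfl⟩
    have := abs_mul_apply_le (abs_mul_apply_le hB hb) hB'
    rwa [show h * (h⁻¹ * γ * h) * h⁻¹ = γ by group] at this
  have hlΓ : slMk l 0 0 l⁻¹ (by field_simp; simp) ∈ Γ' :=
    (hmem _).2 ⟨γ, hγ, Subtype.ext hdiag⟩
  obtain ⟨δ, hδ, hδ0⟩ := exists_forall_entry_ne_zero hfin hl0 hl hlΓ (by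
    obtain ⟨γ, hγ, hno⟩ := hΓ.not_monomial h
    exact ⟨_, (hmem _).2 ⟨γ, hγ, rfl⟩, hno⟩)
  have hG : IsRegular fun M => F (h.1 * M * h⁻¹.1) := hF.conj _ _
  have hG0 : ∀ δ ∈ Γ', F (h.1 * δ.1 * h⁻¹.1) = 0 := by
    intro δ hδ
    obtain ⟨γ, hγ, rfl⟩ := (hmem δ).1 hδ
    rw [← Matrix.SpecialLinearGroup.coe_mul, ← Matrix.SpecialLinearGroup.coe_mul,
      show h * (h⁻¹ * γ * h) * h⁻¹ = γ by group]
    exact h0 γ hγ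
  have hpow : ∀ n : ℕ, ((slMk l 0 0 l⁻¹ (by field_simp; simp)) ^ n).1 = diagMatrix (l ^ n) := by
    intro n
    induction n with
    | zero => simp [diagMatrix, Matrix.one_fin_two]
    | succ n ih =>
      rw [pow_succ, Matrix.SpecialLinearGroup.coe_mul, ih, slMk_val, diagMatrix, diagMatrix,
        Matrix.mul_fin_two]
      refine matrix_fin_two_congr (by ring) (by ring) (by ring) ?_
      rw [pow_succ, mul_inv]
      ring
  have hS : (Set.range fun n : ℕ => l ^ n).Infinite := by
    refine Set.infinite_range_of_injective fun n k hnk => ?_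
    have h1 : |l| ^ n = |l| ^ k := by rw [← abs_pow, ← abs_pow]; exact congrArg _ hnk
    have h2 : |l| ≠ 1 := fun h => hl (by rw [← sq_abs, h, one_pow])
    exact (pow_right_inj₀ (abs_pos.2 hl0) h2).1 h1
  obtain ⟨p, q, r, s, hd, rfl⟩ := exists_eq_slMk δ
  have hδi : ((slMk p q r s hd)⁻¹).1 = !![s, -q; -r, p] := by
    rw [Matrix.SpecialLinearGroup.coe_inv, slMk_val, Matrix.adjugate_fin_two_of]
  set G : ℝ → ℝ → ℝ → ℝ := fun t u v => F (h.1 * (diagMatrix t *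
    (!![p, q; r, s] * diagMatrix u * !![s, -q; -r, p]) * diagMatrix v) * h⁻¹.1) with hGdef
  have hGn : ∀ n m k : ℕ, G (l ^ n) (l ^ m) (l ^ k) = 0 := by
    intro n m k
    have := hG0 _ (Γ'.mul_mem (Γ'.mul_mem (Γ'.pow_mem hlΓ n)
      (Γ'.mul_mem (Γ'.mul_mem hδ (Γ'.pow_mem hlΓ m)) (Γ'.inv_mem hδ))) (Γ'.pow_mem hlΓ k))
    simp only [Matrix.SpecialLinearGroup.coe_mul, hpow, hδi, slMk_val] at this
    exact this
  have hc : ∀ (A : Matrix (Fin 2) (Fin 2) ℝ) (i j : Fin 2), IsLaurent fun _ => A i j :=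
    fun A i j => IsLaurent.const _
  have hG3 : ∀ t u v : ℝ, t ≠ 0 → u ≠ 0 → v ≠ 0 → G t u v = 0 := by
    have s1 : ∀ (t : ℝ) (m k : ℕ), t ≠ 0 → G t (l ^ m) (l ^ k) = 0 := by
      intro t m k ht
      have hL : IsLaurent fun t => G t (l ^ m) (l ^ k) := hG.2 _
        (IsLaurent.matrix_mul (IsLaurent.matrix_mul isLaurent_diagMatrix (hc _)) (hc _))
      refine hL.eq_zero_of_infinite hS ?_ ht
      rintro _ ⟨n, rfl⟩
      exact hGn n m k
    have s2 : ∀ (t u : ℝ) (k : ℕ), t ≠ 0 → u ≠ 0 → G t u (l ^ k) = 0 := by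
      intro t u k ht hu
      have hL : IsLaurent fun u => G t u (l ^ k) := hG.2 _
        (IsLaurent.matrix_mul (IsLaurent.matrix_mul (hc _) (IsLaurent.matrix_mul
          (IsLaurent.matrix_mul (hc _) isLaurent_diagMatrix) (hc _))) (hc _))
      refine hL.eq_zero_of_infinite hS ?_ hu
      rintro _ ⟨n, rfl⟩
      exact s1 t n k ht
    intro t u v ht hu hv
    have hL : IsLaurent fun v => G t u v := hG.2 _
      (IsLaurent.matrix_mul (hc _) isLaurent_diagMatrix)
    refine hL.eq_zero_of_infinite hS ?_ hv
    rintro _ ⟨n, rfl⟩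
    exact s2 t u n ht hu
  obtain ⟨a, b, c, d, habcd, he⟩ := exists_eq_slMk (h⁻¹ * g * h)
  have := hG.eq_zero_of_tori hd (hδ0 0 0) (hδ0 0 1) (hδ0 1 0) (hδ0 1 1) hG3
    (by linarith : a * d - b * c = 1)
  rw [← slMk_val a b c d habcd, ← he, ← Matrix.SpecialLinearGroup.coe_mul,
    ← Matrix.SpecialLinearGroup.coe_mul, show h * (h⁻¹ * g * h) * h⁻¹ = g by group] at this
  exact this

/-- The Zariski closure contains all substitutions of determinant `±1`. Those of determinant `-1`
are reached through the Laurent curve of the matrices of the substitutions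
`x ↦ √s x`, `y ↦ y / √s`, whose entries are powers of `s`. -/
theorem mem_zariskiClosure_of_eq_subst {Γ : Subgroup SL(2, ℝ)} [DiscreteTopology Γ]
    (hΓ : IsNonelementary Γ) {g : SL(5, ℝ)} {A : Matrix (Fin 2) (Fin 2) ℝ}
    (hA : A.det = 1 ∨ A.det = -1) (hg : g.1 = substMatrix 4 A) :
    g ∈ zariskiClosure (Γ.map (rho 4) : Set SL(5, ℝ)) := by
  intro P hP
  have hsl : ∀ B : Matrix (Fin 2) (Fin 2) ℝ, B.det = 1 →
      MvPolynomial.eval (fun ij => substMatrix 4 B ij.1 ij.2) P = 0 := fun B hB =>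
    hΓ.eq_zero_of_isRegular (isRegular_eval_substMatrix P) (fun γ hγ => by
      have := hP (rho 4 γ⁻¹) ⟨γ⁻¹, Γ.inv_mem hγ, rfl⟩
      rwa [rho_val, inv_inv] at this) ⟨B, hB⟩
  rw [hg]
  rcases hA with hA | hA
  · exact hsl A hA
  set D : ℝ → Matrix (Fin 5) (Fin 5) ℝ :=
    fun s => Matrix.diagonal ![s⁻¹ ^ 2, s⁻¹, 1, s, s ^ 2] with hD
  have hDe : ∀ a b s : ℝ, a * b⁻¹ = s → (a * b) ^ 2 = 1 → a ≠ 0 → b ≠ 0 →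
      D s = substMatrix 4 !![a, 0; 0, b] := by
    intro a b s hs hab ha hb
    have e1 : s = a ^ 3 * b := by rw [← hs]; field_simp; linear_combination -hab
    have e2 : s⁻¹ = a * b ^ 3 := by rw [← hs]; field_simp; linear_combination -hab
    refine Matrix.mulVec_injective (funext fun c => ?_)
    rw [substMatrix_four_mulVec]
    ext i
    simp only [hD, Matrix.mulVec_diagonal]
    rw [e2, e1]
    fin_cases i
    · simp
      linear_combination c 0 * b ^ 4 * hab
    · simp
      ring
    · simp
      linear_combination -c 2 * hab
    · simp
      ring
    · simp
      linear_combination c 4 * a ^ 4 * hab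
  set B : Matrix (Fin 2) (Fin 2) ℝ := !![1, 0; 0, -1] * A with hB
  have hBdet : B.det = 1 := by
    rw [hB, Matrix.det_mul, hA, Matrix.det_fin_two_of]
    norm_num
  have hL : IsLaurent fun s => MvPolynomial.eval
      (fun ij => (substMatrix 4 B * D s) ij.1 ij.2) P := by
    refine IsLaurent.eval_mvPolynomial P (f := fun ij s => (substMatrix 4 B * D s) ij.1 ij.2)
      fun ij => IsLaurent.matrix_mul (M := fun _ => substMatrix 4 B) (N := D)
        (fun _ _ => IsLaurent.const _) (fun i j => ?_) _ _
    have hd : ∀ i, IsLaurent fun s => (![s⁻¹ ^ 2, s⁻¹, 1, s, s ^ 2] : Fin 5 → ℝ) i := by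
      intro i
      fin_cases i
      · simpa [sq] using IsLaurent.inv.mul IsLaurent.inv
      · simpa using IsLaurent.inv
      · simpa using IsLaurent.const 1
      · simpa using IsLaurent.id
      · simpa [sq] using IsLaurent.id.mul IsLaurent.id
    by_cases hij : i = j
    · subst hij
      simpa [hD] using hd i
    · simpa [hD, hij] using IsLaurent.const 0
  have := hL.eq_zero_of_infinite (Set.Ioi_infinite (0 : ℝ)) (fun s hs => by
    have hs0 : 0 < √s := Real.sqrt_pos.2 hs
    have hss : √s ^ 2 = s := Real.sq_sqrt (le_of_lt hs)
    rw [hDe (√s) (√s)⁻¹ s (by rw [inv_inv, ← sq, hss]) (by field_simp) hs0.ne'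
      (inv_ne_zero hs0.ne'), ← substMatrix_mul]
    refine hsl _ ?_
    rw [Matrix.det_mul, hBdet, Matrix.det_fin_two_of]
    field_simp
    ring) (neg_ne_zero.2 one_ne_zero : (-1 : ℝ) ≠ 0)
  rw [hDe 1 (-1) (-1) (by norm_num) (by norm_num) (by norm_num) (by norm_num),
    ← substMatrix_mul, hB, ← Matrix.mul_assoc, Matrix.mul_fin_two] at this
  have h1 : (!![1 * 1 + 0 * 0, 1 * 0 + 0 * -1; 0 * 1 + -1 * 0, 0 * 0 + -1 * -1] :
      Matrix (Fin 2) (Fin 2) ℝ) = 1 := by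
    rw [Matrix.one_fin_two]
    exact matrix_fin_two_congr (by norm_num) (by norm_num) (by norm_num) (by norm_num)
  rwa [h1, Matrix.one_mul] at this

theorem IsAdmissible.isNonelementary {Γ : Subgroup SL(2, ℝ)} (hΓ : IsAdmissible Γ) :
    IsNonelementary Γ := by
  have := hΓ.1
  rcases hΓ.2 with h | h
  · exact isNonelementary_of_compactSpace h
  · exact isNonelementary_of_infinite h.1

theorem zariskiClosure_map_rho {Γ : Subgroup SL(2, ℝ)} (hΓ : IsAdmissible Γ) :
    zariskiClosure (Γ.map (rho 4) : Set SL(5, ℝ)) =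
      {g | ∃ A : Matrix (Fin 2) (Fin 2) ℝ, (A.det = 1 ∨ A.det = -1) ∧ g.1 = substMatrix 4 A} := by
  have := hΓ.1
  ext g
  exact ⟨exists_eq_subst_of_mem_zariskiClosure, fun ⟨A, hA, he⟩ =>
    mem_zariskiClosure_of_eq_subst hΓ.isNonelementary hA he⟩

/-! ### The position of the Zariski closure in `SL₅(ℝ)` -/

theorem mem_map_conj_iff {G : Type*} [Group G] {K : Subgroup G} {h g : G} :
    g ∈ K.map (MulAut.conj h).toMonoidHom ↔ h⁻¹ * g * h ∈ K := by
  rw [Subgroup.mem_map]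
  constructor
  · rintro ⟨k, hk, rfl⟩
    convert hk using 1
    simp [mul_assoc]
  · intro hk
    exact ⟨_, hk, by simp [mul_assoc]⟩

theorem eq_of_quadraticForm_eq {n : Type*} [Fintype n] [DecidableEq n] {A B : Matrix n n ℝ}
    (hA : Aᵀ = A) (hB : Bᵀ = B) (h : ∀ y, y ⬝ᵥ A *ᵥ y = y ⬝ᵥ B *ᵥ y) : A = B := by
  have hs : ∀ (C : Matrix n n ℝ) i j, Pi.single i (1 : ℝ) ⬝ᵥ C *ᵥ Pi.single j 1 = C i j := by
    intro C i j
    rw [Matrix.mulVec_single_one, single_one_dotProduct, Matrix.col_apply]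
  ext i j
  have h1 := h (Pi.single i 1 + Pi.single j 1)
  have h2 := h (Pi.single i 1)
  have h3 := h (Pi.single j 1)
  simp only [Matrix.mulVec_add, dotProduct_add, add_dotProduct, hs] at h1 h2 h3
  have h4 : A j i = A i j := congrFun (congrFun hA i) j
  have h5 : B j i = B i j := congrFun (congrFun hB i) j
  linarith

/-- The linear change of coordinates, with `γ ^ 5 = -9`, in which the opposite of the quadratic
invariant of binary quartics is a multiple of the standard form of signature `(2, 3)`. -/
noncomputable def invariantBasis (γ : ℝ) : Matrix (Fin 5) (Fin 5) ℝ :=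
  !![-(γ ^ 2 / 12), 0, γ ^ 2 / 12, 0, 0; 0, 1, 0, 1, 0; 0, 0, 0, 0, γ;
    0, γ ^ 2 / 3, 0, -(γ ^ 2 / 3), 0; 1, 0, 1, 0, 0]

theorem det_invariantBasis (γ : ℝ) : (invariantBasis γ).det = -γ ^ 5 / 9 := by
  simp [invariantBasis, Matrix.det_succ_row_zero, Fin.sum_univ_succ, Fin.succAbove]
  ring

theorem invI_invariantBasis (γ : ℝ) (y : Fin 5 → ℝ) : invI (invariantBasis γ *ᵥ y) =
    -(γ ^ 2 / 12) * (y ⬝ᵥ signatureMatrix 5 2 *ᵥ y) := by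
  simp [invI, invariantBasis, signatureMatrix, Matrix.mulVec, dotProduct, Fin.sum_univ_five,
    Matrix.diagonal_apply]
  ring

theorem exists_conj_indefiniteSO : ∃ h : SL(5, ℝ), ∀ g : SL(5, ℝ), PreservesInvariants g.1 →
    g ∈ (indefiniteSO 5 2).map (MulAut.conj h).toMonoidHom := by
  obtain ⟨γ, hγ⟩ : ∃ γ : ℝ, γ ^ 5 = -9 :=
    ⟨-(9 : ℝ) ^ ((5 : ℕ) : ℝ)⁻¹, by
      rw [neg_pow, Real.rpow_inv_natCast_pow (by norm_num) (by norm_num)]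
      norm_num⟩
  have hγ0 : γ ≠ 0 := fun h => by rw [h] at hγ; norm_num at hγ
  set h : SL(5, ℝ) := ⟨invariantBasis γ, by rw [det_invariantBasis, hγ]; norm_num⟩ with hh
  refine ⟨h, fun g hg => mem_map_conj_iff.2 ?_⟩
  set M := h⁻¹ * g * h with hM
  have hS : (signatureMatrix 5 2)ᵀ = signatureMatrix 5 2 := Matrix.diagonal_transpose _
  change M.1ᵀ * signatureMatrix 5 2 * M.1 = signatureMatrix 5 2
  refine eq_of_quadraticForm_eq ?_ hS fun y => ?_
  · rw [Matrix.transpose_mul, Matrix.transpose_mul, Matrix.transpose_transpose, hS,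
      Matrix.mul_assoc]
  have h1 : y ⬝ᵥ (M.1ᵀ * signatureMatrix 5 2 * M.1) *ᵥ y =
      (M.1 *ᵥ y) ⬝ᵥ signatureMatrix 5 2 *ᵥ (M.1 *ᵥ y) := by
    rw [← Matrix.mulVec_mulVec, ← Matrix.mulVec_mulVec, Matrix.dotProduct_mulVec,
      Matrix.vecMul_transpose]
  rw [h1]
  have h2 : invI (h.1 *ᵥ (M.1 *ᵥ y)) = invI (h.1 *ᵥ y) := by
    rw [Matrix.mulVec_mulVec, ← Matrix.SpecialLinearGroup.coe_mul, hM,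
      show h * (h⁻¹ * g * h) = g * h by group, Matrix.SpecialLinearGroup.coe_mul,
      ← Matrix.mulVec_mulVec, (hg _).1]
  change invI (invariantBasis γ *ᵥ _) = invI (invariantBasis γ *ᵥ _) at h2
  rw [invI_invariantBasis, invI_invariantBasis] at h2
  exact mul_left_cancel₀ (neg_ne_zero.2 (by positivity)) h2

theorem exists_not_preservesInvariants : ∃ g : SL(5, ℝ), ¬ PreservesInvariants g.1 := by
  refine ⟨⟨Matrix.diagonal ![2, 1 / 2, 1, 1, 1], ?_⟩, fun h => ?_⟩
  · rw [Matrix.det_diagonal, Fin.prod_univ_five]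
    simp
  · have := (h ![1, 0, 0, 0, 1]).1
    simp [invI, Matrix.mulVec_diagonal] at this

theorem trace_substMatrix_four (A : Matrix (Fin 2) (Fin 2) ℝ) :
    (substMatrix 4 A).trace = A.trace ^ 4 - 3 * A.det * A.trace ^ 2 + A.det ^ 2 := by
  have h : ∀ i, substMatrix 4 A i i = (substMatrix 4 A *ᵥ Pi.single i 1) i := fun i => by
    rw [Matrix.mulVec_single_one, Matrix.col_apply]
  rw [Matrix.trace, Fin.sum_univ_five, Matrix.trace_fin_two, Matrix.det_fin_two]
  simp only [Matrix.diag_apply, h]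
  rw [Matrix.eta_fin_two A]
  simp only [substMatrix_four_mulVec]
  simp
  ring

/-- In the standard `SO(4,1)` there is an element of trace `-3`, smaller than the traces of the
substitutions of determinant `±1`. -/
theorem exists_mem_indefiniteSO_not_subst (h : SL(5, ℝ)) :
    ∃ g ∈ (indefiniteSO 5 4).map (MulAut.conj h).toMonoidHom,
      ¬ ∃ A : Matrix (Fin 2) (Fin 2) ℝ, (A.det = 1 ∨ A.det = -1) ∧ g.1 = substMatrix 4 A := by
  set d : SL(5, ℝ) := ⟨Matrix.diagonal ![-1, -1, -1, -1, 1], by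
    rw [Matrix.det_diagonal, Fin.prod_univ_five]; simp⟩ with hd
  refine ⟨h * d * h⁻¹, mem_map_conj_iff.2 ?_, ?_⟩
  · rw [show h⁻¹ * (h * d * h⁻¹) * h = d by group]
    change (Matrix.diagonal _)ᵀ * signatureMatrix 5 4 * Matrix.diagonal _ = _
    rw [Matrix.diagonal_transpose, signatureMatrix, Matrix.diagonal_mul_diagonal,
      Matrix.diagonal_mul_diagonal]
    congr 1
    ext i
    fin_cases i <;> simp
  · rintro ⟨A, hA, he⟩
    have h1 : (h * d * h⁻¹).1.trace = d.1.trace := by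
      rw [Matrix.SpecialLinearGroup.coe_mul, Matrix.trace_mul_comm,
        ← Matrix.SpecialLinearGroup.coe_mul, show h⁻¹ * (h * d) = d by group]
    have h2 : d.1.trace = -3 := by
      rw [hd, Matrix.trace_diagonal, Fin.sum_univ_five]
      simp
      norm_num
    rw [he, trace_substMatrix_four, h2] at h1
    rcases hA with hA | hA <;> rw [hA] at h1
    · nlinarith [sq_nonneg (2 * A.trace ^ 2 - 3)]
    · nlinarith [sq_nonneg (A.trace ^ 2), sq_nonneg A.trace]

/-! ### A cocompact lattice from a quaternion algebra -/

open MeasureTheory in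
/-- Minkowski's theorem for the cube. -/
theorem exists_int_mulVec_le {n : ℕ} (A : Matrix (Fin n) (Fin n) ℝ) {r : ℝ} (hr : 0 ≤ r)
    (hA : A.det ≠ 0) (h : |A.det| < r ^ n) :
    ∃ x : Fin n → ℤ, x ≠ 0 ∧ ∀ i, |(A *ᵥ fun j => (x j : ℝ)) i| ≤ r := by
  set b := Pi.basisFun ℝ (Fin n) with hb
  set L := (Submodule.span ℤ (Set.range b)).toAddSubgroup with hL
  have hfund : IsAddFundamentalDomain L (ZSpan.fundamentalDomain b) volume :=
    ZSpan.isAddFundamentalDomain b volume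
  have hvol : volume (ZSpan.fundamentalDomain b) = 1 := by
    rw [ZSpan.volume_fundamentalDomain]
    have : (Matrix.of ⇑b) = 1 := by
      ext i j
      simp [hb, Matrix.one_apply, Pi.single_apply, eq_comm]
    simp [this]
  have hdet : LinearMap.det (Matrix.toLin' A) ≠ 0 := by rwa [LinearMap.det_toLin']
  have hlt : volume (ZSpan.fundamentalDomain b) * 2 ^ Module.finrank ℝ (Fin n → ℝ) <
      volume (Matrix.toLin' A ⁻¹' Metric.closedBall 0 r) := by
    rw [hvol, one_mul, Measure.addHaar_preimage_linearMap _ hdet, LinearMap.det_toLin',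
      Real.volume_pi_closedBall _ hr, Module.finrank_fin_fun, Fintype.card_fin,
      ← ENNReal.ofReal_mul (abs_nonneg _)]
    rw [show (2 : ENNReal) ^ n = ENNReal.ofReal (2 ^ n) by
      rw [ENNReal.ofReal_pow (by norm_num)]; simp]
    refine (ENNReal.ofReal_lt_ofReal_iff_of_nonneg (by positivity)).2 ?_
    rw [abs_inv, ← div_eq_inv_mul, lt_div_iff₀ (abs_pos.2 hA), mul_pow]
    exact mul_lt_mul_of_pos_left h (by positivity)
  have : Countable L := inferInstanceAs (Countable (Submodule.span ℤ (Set.range b)))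
  obtain ⟨⟨x, hxL⟩, hx0, hx⟩ := exists_ne_zero_mem_lattice_of_measure_mul_two_pow_lt_measure hfund
    (fun x hx => by simpa [Matrix.mulVec_neg] using hx)
    ((convex_closedBall (0 : Fin n → ℝ) r).linear_preimage _) hlt
  have hxL' : x ∈ Submodule.span ℤ (Set.range b) := hxL
  rw [Module.Basis.mem_span_iff_repr_mem] at hxL'
  choose z hz using hxL'
  have hzx : (fun j => (z j : ℝ)) = x := funext fun j => by simpa [hb] using hz j
  refine ⟨z, fun h0 => hx0 ?_, fun i => ?_⟩
  · have hx00 : x = 0 := by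
      rw [← hzx, h0]
      simp
      rfl
    exact Subtype.ext hx00
  · rw [hzx]
    have h1 : Matrix.toLin' A x ∈ Metric.closedBall (0 : Fin n → ℝ) r := hx
    rw [mem_closedBall_zero_iff, Matrix.toLin'_apply] at h1
    exact (norm_le_pi_norm _ i).trans h1

/-- The real matrix of the quaternion `x₀ + x₁ i + (x₂ + x₃ i) j`, with `i ^ 2 = 2`, `j ^ 2 = 3`. -/
noncomputable def quatMatrix (x : Fin 4 → ℝ) : Matrix (Fin 2) (Fin 2) ℝ :=
  !![x 0 + x 1 * √2, 3 * (x 2 + x 3 * √2); x 2 - x 3 * √2, x 0 - x 1 * √2]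

/-- The product of quaternions. -/
def quatMul {R : Type*} [CommRing R] (x y : Fin 4 → R) : Fin 4 → R :=
  ![x 0 * y 0 + 2 * x 1 * y 1 + 3 * (x 2 * y 2 - 2 * x 3 * y 3),
    x 0 * y 1 + x 1 * y 0 + 3 * (x 3 * y 2 - x 2 * y 3),
    x 0 * y 2 + 2 * x 1 * y 3 + x 2 * y 0 - 2 * x 3 * y 1,
    x 0 * y 3 + x 1 * y 2 + x 3 * y 0 - x 2 * y 1]

/-- The conjugate of a quaternion. -/
def quatConj {R : Type*} [CommRing R] (x : Fin 4 → R) : Fin 4 → R := ![x 0, -x 1, -x 2, -x 3]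

/-- The norm of a quaternion. -/
def quatNorm {R : Type*} [CommRing R] (x : Fin 4 → R) : R :=
  x 0 ^ 2 - 2 * x 1 ^ 2 - 3 * x 2 ^ 2 + 6 * x 3 ^ 2

theorem sqrt_two_mul_self : √2 * √2 = (2 : ℝ) := Real.mul_self_sqrt (by norm_num)

theorem quatMatrix_mul (x y : Fin 4 → ℝ) :
    quatMatrix x * quatMatrix y = quatMatrix (quatMul x y) := by
  have h := sqrt_two_mul_self
  rw [quatMatrix, quatMatrix, quatMatrix, Matrix.mul_fin_two]
  simp [quatMul]
  refine ⟨⟨?_, ?_⟩, ?_, ?_⟩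
  · linear_combination (x 1 * y 1 - 3 * x 3 * y 3) * h
  · linear_combination (3 * x 1 * y 3 - 3 * x 3 * y 1) * h
  · linear_combination (x 1 * y 3 - x 3 * y 1) * h
  · linear_combination (x 1 * y 1 - 3 * x 3 * y 3) * h

theorem det_quatMatrix (x : Fin 4 → ℝ) : (quatMatrix x).det = quatNorm x := by
  rw [quatMatrix, Matrix.det_fin_two_of, quatNorm]
  linear_combination (3 * x 3 ^ 2 - x 1 ^ 2) * sqrt_two_mul_self

theorem quatMatrix_mul_conj (x : Fin 4 → ℝ) :
    quatMatrix x * quatMatrix (quatConj x) = quatNorm x • 1 := by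
  rw [quatMatrix_mul, quatMatrix, Matrix.one_fin_two]
  ext i j
  fin_cases i <;> fin_cases j <;> simp [quatMul, quatConj, quatNorm] <;> ring

/-- An integral quaternion as a real one. -/
def quatCast (x : Fin 4 → ℤ) : Fin 4 → ℝ := fun i => (x i : ℝ)

theorem quatCast_mul (x y : Fin 4 → ℤ) :
    quatCast (quatMul x y) = quatMul (quatCast x) (quatCast y) := by
  ext i
  fin_cases i <;> simp [quatCast, quatMul]

theorem quatCast_conj (x : Fin 4 → ℤ) : quatCast (quatConj x) = quatConj (quatCast x) := by
  ext i
  fin_cases i <;> simp [quatCast, quatConj]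

theorem quatCast_norm (x : Fin 4 → ℤ) : quatNorm (quatCast x) = ((quatNorm x : ℤ) : ℝ) := by
  simp [quatCast, quatNorm]

/-- The quaternion algebra is a division algebra, by infinite descent at the prime `3`. -/
theorem quatNorm_ne_zero {x : Fin 4 → ℤ} (hx : x ≠ 0) : quatNorm x ≠ 0 := by
  have key : ∀ (n : ℕ) (x : Fin 4 → ℤ), quatNorm x = 0 → ∀ i, (3 : ℤ) ^ n ∣ x i := by
    have hmod : ∀ a b : ℤ, (3 : ℤ) ∣ a ^ 2 - 2 * b ^ 2 → 3 ∣ a ∧ 3 ∣ b := by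
      intro a b h
      have h1 : ∀ u v : ZMod 3, u ^ 2 - 2 * v ^ 2 = 0 → u = 0 ∧ v = 0 := by decide
      have h2 := (ZMod.intCast_zmod_eq_zero_iff_dvd (a ^ 2 - 2 * b ^ 2) 3).2 h
      push_cast at h2
      have h3 := h1 _ _ h2
      exact ⟨(ZMod.intCast_zmod_eq_zero_iff_dvd a 3).1 h3.1,
        (ZMod.intCast_zmod_eq_zero_iff_dvd b 3).1 h3.2⟩
    intro n
    induction n with
    | zero => intro x _ i; simp
    | succ n ih =>
      intro x hx
      rw [quatNorm] at hx
      obtain ⟨⟨a, ha⟩, b, hb⟩ := hmod (x 0) (x 1) ⟨x 2 ^ 2 - 2 * x 3 ^ 2, by linarith⟩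
      rw [ha, hb] at hx
      obtain ⟨⟨c, hc⟩, d, hd⟩ := hmod (x 2) (x 3) ⟨a ^ 2 - 2 * b ^ 2, by linarith⟩
      rw [hc, hd] at hx
      have := ih ![a, b, c, d] (by simp [quatNorm]; linarith)
      intro i
      rw [pow_succ']
      fin_cases i
      · simpa [ha] using mul_dvd_mul_left 3 (this 0)
      · simpa [hb] using mul_dvd_mul_left 3 (this 1)
      · simpa [hc] using mul_dvd_mul_left 3 (this 2)
      · simpa [hd] using mul_dvd_mul_left 3 (this 3)
  intro h0
  refine hx (funext fun i => ?_)
  by_contra hi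
  have h1 := Int.le_of_dvd (abs_pos.2 hi) ((dvd_abs _ _).2 (key (x i).natAbs x h0 i))
  have h2 : (x i).natAbs < 3 ^ (x i).natAbs := Nat.lt_pow_self (by norm_num)
  have h3 : ((x i).natAbs : ℤ) < 3 ^ (x i).natAbs := by exact_mod_cast h2
  rw [Int.natCast_natAbs] at h3
  linarith

/-- The group of integral quaternions of norm one. -/
noncomputable def quatGroup : Subgroup SL(2, ℝ) where
  carrier := {g | ∃ x : Fin 4 → ℤ, g.1 = quatMatrix (quatCast x)}
  one_mem' := ⟨![1, 0, 0, 0], by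
    ext i j
    fin_cases i <;> fin_cases j <;> simp [quatMatrix, quatCast]⟩
  mul_mem' := by
    rintro g h ⟨x, hx⟩ ⟨y, hy⟩
    refine ⟨quatMul x y, ?_⟩
    rw [Matrix.SpecialLinearGroup.coe_mul, hx, hy, quatCast_mul, quatMatrix_mul]
  inv_mem' := by
    rintro g ⟨x, hx⟩
    refine ⟨quatConj x, ?_⟩
    rw [Matrix.SpecialLinearGroup.coe_inv, hx, quatCast_conj, quatMatrix,
      Matrix.adjugate_fin_two_of]
    ext i j
    fin_cases i <;> fin_cases j <;> simp [quatMatrix, quatConj] <;> ring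

theorem discreteTopology_quatGroup : DiscreteTopology quatGroup := by
  set V : Set SL(2, ℝ) := {g | |g.1 0 0 - 1| < 1 / 2 ∧ |g.1 1 1 - 1| < 1 / 2 ∧
    |g.1 0 1| < 1 / 2 ∧ |g.1 1 0| < 1 / 2} with hV
  have hc := fun i j => continuous_slVal.matrix_elem i j
  have hVo : IsOpen V :=
    (isOpen_lt ((hc 0 0).sub continuous_const).abs continuous_const).inter
      ((isOpen_lt ((hc 1 1).sub continuous_const).abs continuous_const).inter
        ((isOpen_lt (hc 0 1).abs continuous_const).inter
          (isOpen_lt (hc 1 0).abs continuous_const)))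
  refine discreteTopology_of_isOpen_singleton_one ?_
  convert hVo.preimage (continuous_subtype_val (p := fun g => g ∈ quatGroup)) using 1
  ext ⟨g, hg⟩
  simp only [Set.mem_singleton_iff, Set.mem_preimage]
  constructor
  · intro h
    have h' : g = 1 := congrArg Subtype.val h
    subst h'
    simp [hV]
  · rintro ⟨h0, h1, h2, h3⟩
    refine Subtype.ext (Subtype.ext ?_)
    obtain ⟨x, hx⟩ := hg
    have hs : 1 ≤ √2 := Real.one_le_sqrt.2 (by norm_num)
    have hint : ∀ k : ℤ, |(k : ℝ)| < 1 → k = 0 := fun k hk =>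
      Int.abs_lt_one_iff.1 (by exact_mod_cast hk)
    have hint' : ∀ k : ℤ, |(k : ℝ) * √2| < 1 → k = 0 := fun k hk => hint k (by
      rw [abs_mul, abs_of_nonneg (by linarith : 0 ≤ √2)] at hk
      nlinarith [abs_nonneg (k : ℝ)])
    simp only [hx] at h0 h1 h2 h3
    simp [quatMatrix, quatCast] at h0 h1 h2 h3
    have h2' : |(x 2 : ℝ) + x 3 * √2| < 1 / 2 := by linarith [abs_nonneg ((x 2 : ℝ) + x 3 * √2)]
    rw [abs_lt] at h0 h1 h2' h3
    have e0 : x 0 - 1 = 0 := hint _ (by rw [abs_lt]; push_cast; constructor <;> linarith)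
    have e1 : x 1 = 0 := hint' _ (by rw [abs_lt]; constructor <;> linarith)
    have e2 : x 2 = 0 := hint _ (by rw [abs_lt]; constructor <;> linarith)
    have e3 : x 3 = 0 := hint' _ (by rw [abs_lt]; constructor <;> linarith)
    have e0' : x 0 = 1 := by linarith
    change g.1 = 1
    rw [hx, Matrix.one_fin_two]
    ext i j
    fin_cases i <;> fin_cases j <;> simp [quatMatrix, quatCast, e0', e1, e2, e3]

/-- Integral quaternions of bounded non-zero norm fall into finitely many classes modulo units:
two of them with the same norm `k` and congruent modulo `k` are associated. -/
theorem exists_finite_representatives (K : ℕ) : ∃ Y : Set (Fin 4 → ℤ), Y.Finite ∧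
    (∀ y ∈ Y, quatNorm y ≠ 0) ∧ ∀ x : Fin 4 → ℤ, quatNorm x ≠ 0 → |quatNorm x| ≤ K →
      ∃ y ∈ Y, ∃ u : Fin 4 → ℤ, quatNorm u = 1 ∧ quatMul u y = x := by
  set X : Set (Fin 4 → ℤ) := {x | quatNorm x ≠ 0 ∧ |quatNorm x| ≤ K} with hX
  set f : (Fin 4 → ℤ) → ℤ × (Fin 4 → ℤ) := fun x => (quatNorm x, fun i => x i % quatNorm x) with hf
  have hfin : (f '' X).Finite := by
    refine ((Set.finite_Icc (-(K : ℤ)) K).prod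
      (Set.Finite.pi' (t := fun _ : Fin 4 => Set.Icc (0 : ℤ) K)
        fun _ => Set.finite_Icc _ _)).subset ?_
    rintro _ ⟨x, ⟨h0, h1⟩, rfl⟩
    exact ⟨abs_le.1 h1, fun i => ⟨Int.emod_nonneg _ h0, (Int.emod_lt_abs _ h0).le.trans h1⟩⟩
  obtain ⟨Y, hYX, hbij⟩ := Set.exists_subset_bijOn X f
  refine ⟨Y, hbij.finite_iff_finite.2 hfin, fun y hy => (hYX hy).1, fun x h0 h1 => ?_⟩
  obtain ⟨y, hy, hxy⟩ := hbij.surjOn ⟨x, ⟨h0, h1⟩, rfl⟩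
  have hn : quatNorm y = quatNorm x := congrArg Prod.fst hxy
  have hk := (hYX hy).1
  have hmod : ∀ i, ∃ z, x i = y i + quatNorm y * z := fun i => by
    have h2 : y i % quatNorm y = x i % quatNorm x := congrFun (congrArg Prod.snd hxy) i
    rw [← hn] at h2
    obtain ⟨z, hz⟩ := Int.dvd_of_emod_eq_zero
      (Int.emod_eq_emod_iff_emod_sub_eq_zero.1 h2.symm)
    exact ⟨z, by linarith⟩
  choose z hz using hmod
  set w := quatMul z (quatConj y) with hw
  set u : Fin 4 → ℤ := ![1 + w 0, w 1, w 2, w 3] with hu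
  have hux : quatMul u y = x := by
    ext i
    rw [hz i]
    fin_cases i <;> simp [hu, hw, quatMul, quatConj, quatNorm] <;> ring
  have hmulnorm : quatNorm (quatMul u y) = quatNorm u * quatNorm y := by
    simp [quatMul, quatNorm]
    ring
  refine ⟨y, hy, u, ?_, hux⟩
  rw [hux, ← hn] at hmulnorm
  exact (mul_eq_right₀ hk).1 hmulnorm.symm

/-- Minkowski's theorem gives an integral quaternion `x ≠ 0` with `g x` bounded; as the norm of
`x` is then bounded, `x` is the product of a unit and of one of finitely many quaternions. -/
theorem exists_bound_quatGroup : ∃ R : ℝ, ∀ g : SL(2, ℝ), ∃ γ ∈ quatGroup,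
    ∀ i j, |(g * γ).1 i j| ≤ R := by
  obtain ⟨Y, hY, hY0, hrep⟩ := exists_finite_representatives 18
  obtain ⟨B, hB⟩ := (hY.image fun y => ∑ i, ∑ j, |quatMatrix (quatConj (quatCast y)) i j|).bddAbove
  refine ⟨6 * B, fun g => ?_⟩
  obtain ⟨p, q, r, s, hd, rfl⟩ := exists_eq_slMk g
  -- the matrix of `x ↦ g x`, with entries listed row by row
  set A : Matrix (Fin 4) (Fin 4) ℝ := !![p, p * √2, q, -(q * √2); q, -(q * √2), 3 * p, 3 * p * √2;
    r, r * √2, s, -(s * √2); s, -(s * √2), 3 * r, 3 * r * √2] with hA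
  have hAdet : A.det = 24 := by
    have h2 := sqrt_two_mul_self
    simp [hA, Matrix.det_succ_row_zero, Fin.sum_univ_succ, Fin.succAbove]
    linear_combination (12 * (p * s - q * r) ^ 2) * h2 + (24 * (p * s - q * r + 1)) * hd
  obtain ⟨x, hx0, hx⟩ := exists_int_mulVec_le A (r := 3) (by norm_num) (by rw [hAdet]; norm_num)
    (by rw [hAdet]; norm_num)
  have hgx : ∀ i j, |(!![p, q; r, s] * quatMatrix (quatCast x)) i j| ≤ 3 := by
    have h0 := hx 0
    have h1 := hx 1
    have h2 := hx 2
    have h3 := hx 3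
    simp [hA, Matrix.mulVec, dotProduct, Fin.sum_univ_four] at h0 h1 h2 h3
    intro i j
    rw [quatMatrix, Matrix.mul_fin_two]
    fin_cases i <;> fin_cases j <;> simp [quatCast]
    · convert h0 using 2; ring
    · convert h1 using 2; ring
    · convert h2 using 2; ring
    · convert h3 using 2; ring
  have hN : |quatNorm x| ≤ (18 : ℕ) := by
    have h1 : |((quatNorm x : ℤ) : ℝ)| ≤ 18 := by
      rw [← quatCast_norm, ← det_quatMatrix]
      have h2 : (!![p, q; r, s] * quatMatrix (quatCast x)).det = (quatMatrix (quatCast x)).det := by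
        rw [Matrix.det_mul, Matrix.det_fin_two_of, hd, one_mul]
      rw [← h2, Matrix.det_fin_two]
      refine (abs_sub _ _).trans ?_
      rw [abs_mul, abs_mul]
      have a := mul_le_mul (hgx 0 0) (hgx 1 1) (abs_nonneg _) (by norm_num)
      have b := mul_le_mul (hgx 0 1) (hgx 1 0) (abs_nonneg _) (by norm_num)
      linarith
    exact_mod_cast h1
  obtain ⟨y, hy, u, hu1, hux⟩ := hrep x (quatNorm_ne_zero hx0) hN
  set γ : SL(2, ℝ) := ⟨quatMatrix (quatCast u), by
    rw [det_quatMatrix, quatCast_norm, hu1]; simp⟩ with hγ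
  refine ⟨γ, ⟨u, rfl⟩, fun i j => ?_⟩
  set n : ℝ := ((quatNorm y : ℤ) : ℝ) with hn
  have hn1 : 1 ≤ |n| := by
    have := Int.one_le_abs (hY0 y hy)
    rw [hn]
    exact_mod_cast this
  have he : n • (slMk p q r s hd * γ).1 =
      (!![p, q; r, s] * quatMatrix (quatCast x)) * quatMatrix (quatConj (quatCast y)) := by
    rw [← hux, quatCast_mul, ← quatMatrix_mul, Matrix.mul_assoc, Matrix.mul_assoc,
      quatMatrix_mul_conj, quatCast_norm, Matrix.mul_smul, Matrix.mul_one, Matrix.mul_smul,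
      Matrix.SpecialLinearGroup.coe_mul]
    rfl
  have hyB : ∀ i j, |quatMatrix (quatConj (quatCast y)) i j| ≤ B := fun i j => by
    refine le_trans ?_ (hB ⟨y, hy, rfl⟩)
    exact (Finset.single_le_sum (f := fun j => |quatMatrix (quatConj (quatCast y)) i j|)
      (fun j _ => abs_nonneg _) (Finset.mem_univ j)).trans
      (Finset.single_le_sum (f := fun i => ∑ j, |quatMatrix (quatConj (quatCast y)) i j|)
      (fun i _ => Finset.sum_nonneg fun j _ => abs_nonneg _) (Finset.mem_univ i))
  have h1 : |n| * |(slMk p q r s hd * γ).1 i j| ≤ 6 * B := by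
    rw [← abs_mul, ← smul_eq_mul, ← Matrix.smul_apply, he, Matrix.mul_apply, Fin.sum_univ_two]
    refine (abs_add_le _ _).trans ?_
    rw [abs_mul, abs_mul]
    have a := mul_le_mul (hgx i 0) (hyB 0 j) (abs_nonneg _) (by norm_num)
    have b := mul_le_mul (hgx i 1) (hyB 1 j) (abs_nonneg _) (by norm_num)
    linarith
  exact (le_mul_of_one_le_left (abs_nonneg _) hn1).trans h1

theorem compactSpace_quotient_of_bound {Γ : Subgroup SL(2, ℝ)} {R : ℝ}
    (h : ∀ g : SL(2, ℝ), ∃ γ ∈ Γ, ∀ i j, |(g * γ).1 i j| ≤ R) : CompactSpace (SL(2, ℝ) ⧸ Γ) := by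
  refine ⟨?_⟩
  convert (isCompact_slBox R).image (QuotientGroup.continuous_mk (N := Γ)) using 1
  refine (Set.eq_univ_of_forall fun x => ?_).symm
  obtain ⟨g, rfl⟩ := QuotientGroup.mk_surjective x
  obtain ⟨γ, hγ, hb⟩ := h g
  exact ⟨g * γ, hb, QuotientGroup.mk_mul_of_mem g hγ⟩

theorem isAdmissible_quatGroup : IsAdmissible quatGroup := by
  obtain ⟨R, hR⟩ := exists_bound_quatGroup
  exact ⟨discreteTopology_quatGroup, Or.inl (compactSpace_quotient_of_bound hR)⟩

end HilbertGeometry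

theorem proposition10p6 :
    ∃ Ω : Set (ℙ ℝ (Fin 5 → ℝ)),
      HilbertGeometry.IsProperlyConvex Ω ∧
      HilbertGeometry.HasStrictlyConvexBoundary Ω ∧
      HilbertGeometry.HasC1Boundary Ω ∧
      (∃ Γ' : Subgroup SL(2, ℝ), HilbertGeometry.IsAdmissible Γ') ∧
      ∀ Γ' : Subgroup SL(2, ℝ), HilbertGeometry.IsAdmissible Γ' →
        ∀ Γ : Subgroup SL(5, ℝ), Γ = Γ'.map (HilbertGeometry.rho 4) →
          Γ ≤ HilbertGeometry.Aut Ω ∧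
          DiscreteTopology Γ ∧
          HilbertGeometry.ActsConvexCocompactly Ω Γ ∧
          HilbertGeometry.zariskiClosure (Γ : Set SL(5, ℝ)) =
            {g | ∃ A : Matrix (Fin 2) (Fin 2) ℝ, (A.det = 1 ∨ A.det = -1) ∧
              g.1 = HilbertGeometry.substMatrix 4 A} ∧
          (∃ h : SL(5, ℝ), HilbertGeometry.zariskiClosure (Γ : Set SL(5, ℝ)) ⊆
            ((HilbertGeometry.indefiniteSO 5 2).map (MulAut.conj h).toMonoidHom :
              Subgroup SL(5, ℝ))) ∧
          HilbertGeometry.zariskiClosure (Γ : Set SL(5, ℝ)) ≠ Set.univ ∧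
          ¬ ∃ h : SL(5, ℝ), HilbertGeometry.zariskiClosure (Γ : Set SL(5, ℝ)) =
            ((HilbertGeometry.indefiniteSO 5 4).map (MulAut.conj h).toMonoidHom :
              Subgroup SL(5, ℝ)) := by
  refine ⟨HilbertGeometry.quarticDomain, HilbertGeometry.isProperlyConvex_quarticDomain,
    HilbertGeometry.hasStrictlyConvexBoundary_quarticDomain,
    HilbertGeometry.hasC1Boundary_quarticDomain,
    ⟨HilbertGeometry.quatGroup, HilbertGeometry.isAdmissible_quatGroup⟩, ?_⟩
  rintro Γ' hΓ Γ rfl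
  have hd := hΓ.1
  rw [HilbertGeometry.zariskiClosure_map_rho hΓ]
  refine ⟨HilbertGeometry.map_rho_le_aut Γ', HilbertGeometry.discreteTopology_map_rho Γ', ?_, rfl,
    ?_, ?_, ?_⟩
  · rcases hΓ.2 with h | h
    · exact HilbertGeometry.actsConvexCocompactly_of_compactSpace h
    · exact HilbertGeometry.actsConvexCocompactly_of_hyperbolicPlane h.2
  · obtain ⟨h, hh⟩ := HilbertGeometry.exists_conj_indefiniteSO
    refine ⟨h, ?_⟩
    rintro g ⟨A, hA, he⟩
    exact hh g (he ▸ HilbertGeometry.preservesInvariants_subst hA)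
  · intro huniv
    obtain ⟨g, hg⟩ := HilbertGeometry.exists_not_preservesInvariants
    obtain ⟨A, hA, he⟩ := huniv.symm.subset (Set.mem_univ g)
    exact hg (he ▸ HilbertGeometry.preservesInvariants_subst hA)
  · rintro ⟨h, hh⟩
    obtain ⟨g, hg, hno⟩ := HilbertGeometry.exists_mem_indefiniteSO_not_subst h
    exact hno (hh.symm.subset hg)
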